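/- Let $U\subset\mathbb{R}^n$ be open, $r\ge 2$, $f:U\to\mathbb{R}^n$ of class $C^r$, and let $H:U\to\mathbb{R}$ be a $C^1$ first integral, $DH(x)f(x)=0$ on $U$. Consider $$\dot x=f(x)+\varepsilon\,g(x,t;T,\varepsilon),\qquad g(x,t+T;T,\varepsilon)=g(x,t;T,\varepsilon),$$ for $x\in U$, $t\in\mathbb{R}$, $T>0$, $|\varepsilon|<\varepsilon_1$, where $g$ is $C^{r-1}$ jointly in all its arguments and $C^r$ in $(x,T,\varepsilon)$, with $(x,T,\varepsilon)$-derivatives of order $r$ that are continuous in all arguments. (Mechanical systems with energy $H$ are the special case $x=(q,\dot q)$.) Let $\mathcal Z\subset U$ be a periodic orbit of $\dot x=f(x)$ with minimal period $\tau>0$, let $p\in\mathcal Z$, and let $x_0(t)$ be the solution with $x_0(0)=p$. Let $\Pi=Y(\tau)$ be the monodromy matrix, where $\dot Y=Df(x_0(t))Y$, $Y(0)=I$. Let $l,m\ge1$ be coprime integers, and let $\mathcal Z$ be $m$-normal: either the geometric multiplicity of the eigenvalue $1$ of $\Pi^m$ is $1$, or it is $2$ and $f(p)\notin\operatorname{range}(\Pi^m-I)$.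 Put $$M^{m:l}(s)=\int_0^{m\tau}\big\langle DH(x_0(t+s)),\,g(x_0(t+s),t;m\tau/l,0)\big\rangle\,dt .$$ We say that $\mathcal Z$ persists with class $C^k$ from $x_0(s)$ if for some $\varepsilon_0\in(0,\varepsilon_1]$ there are $C^k$ maps $\xi:[0,\varepsilon_0)\to\mathbb{R}^n$ and $T:[0,\varepsilon_0)\to(0,\infty)$ with $\xi(0)=x_0(s)$ and $T(0)=m\tau/l$, such that for every $\varepsilon\in[0,\varepsilon_0)$ the solution of the system with forcing period $T(\varepsilon)$ that starts from $\xi(\varepsilon)$ at time $0$ stays in $U$ and is $lT(\varepsilon)$-periodic. A scalar function $L(\xi,\bar T)$ parametrises the family of conservative periodic orbits around $\mathcal Z$ if it is $C^r$ near $\mathcal Z\times\{m\tau\}$ and, for $\lambda$ near $\lambda_0=L(p,m\tau)$, there are periodic solutions $X_\lambda$ of $\dot x=f(x)$ in $U$, of period $\mathcal T(\lambda)>0$, with $X_\lambda(0)$ and $\mathcal T(\lambda)$ of class $C^1$ in $\lambda$, $X_{\lambda_0}=x_0$, $\mathcal T(\lambda_0)=\tau$, and $L(X_\lambda(t),m\mathcal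 T(\lambda))=\lambda$ for all $t$. A zero of a function is topologically transverse if the function changes sign across it (if the zero is not isolated: across some closed interval of zeros containing it, the function taking opposite signs at points arbitrarily close to its two ends). Theorem. 1. Suppose that $M^{m:l}(s_0)=0$ and $DM^{m:l}(s_0)\ne0$. Then $\mathcal Z$ persists with class $C^{r-1}$ from $x_0(s_0)$. Moreover, for every $L$ that parametrises the family, $\xi$ and $T$ can be chosen such that in addition $L(\xi(\varepsilon),lT(\varepsilon))=L(p,m\tau)$ for all $\varepsilon\in[0,\varepsilon_0)$. Finally, $M^{m:l}$ has at least one further topologically transverse zero in $(s_0,s_0+m\tau)$. 2. Suppose that $|M^{m:l}(s)|\ge c$ for some $c>0$ and all $s$. Then $\mathcal Z$ does not persist smoothly: it does not persist with class $C^1$ from any of its points, and for every $C$ there is $\bar\varepsilon>0$ such that for $0<\varepsilon<\bar\varepsilon$ and every $T>0$ with $|T-m\tau/l|\le C\varepsilon$, no $lT$-periodic solution in $U$ starts at time $0$ within distance $C\varepsilon$ of $\mathcal Z$. -/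

import Mathlib

open Set

namespace Resonance

/- The state space is a finite-dimensional real normed space `E`, for instance `ℝⁿ` with the
Euclidean norm. -/
variable {E : Type*} [NormedAddCommGroup E] [NormedSpace ℝ E]

/-- `z` is a periodic solution, defined for all times and staying in `U`, of `ẋ = f x`, with
minimal period `τ > 0`. In particular `z` is not an equilibrium. -/
structure IsPeriodicOrbit (U : Set E) (f : E → E)
    (z : ℝ → E) (τ : ℝ) : Prop where
  mem : ∀ t, z t ∈ U
  ode : ∀ t, HasDerivAt z (f (z t)) t
  pos : 0 < τ
  periodic : Function.Periodic z τ
  minimal : ∀ σ, 0 < σ → σ < τ → ¬ Function.Periodic z σ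

/-- `Y` solves the equation of variations `Ẏ = Df(z(t)) Y`, `Y(0) = I`, along `z`. -/
structure IsVariationalSolution (f : E → E) (z : ℝ → E)
    (Y : ℝ → E →L[ℝ] E) : Prop where
  init : Y 0 = ContinuousLinearMap.id ℝ E
  ode : ∀ t, HasDerivAt Y ((fderiv ℝ f (z t)).comp (Y t)) t

/-- `m`-normality of the periodic orbit `z` of period `τ`. With the monodromy matrix
`Π = Y(τ)` at `p = z 0`, either the geometric multiplicity of the eigenvalue `1` of `Π ^ m` is one,
or it is two and `f p` is not in the range of `Π ^ m - I`. -/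
def IsNormal (f : E → E) (z : ℝ → E) (τ : ℝ) (m : ℕ) : Prop :=
  ∃ Y : ℝ → E →L[ℝ] E, IsVariationalSolution f z Y ∧
    (Module.finrank ℝ
        (Module.End.eigenspace ((Y τ ^ m : E →L[ℝ] E) : Module.End ℝ E) 1) = 1 ∨
      (Module.finrank ℝ
        (Module.End.eigenspace ((Y τ ^ m : E →L[ℝ] E) : Module.End ℝ E) 1) = 2 ∧
        ¬ ∃ v : E, (Y τ ^ m) v - v = f (z 0)))

/-- The values of `(x, T, ε)` at which the perturbation `g(x, t; T, ε)` is considered. -/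
def paramDomain (U : Set E) (ε₁ : ℝ) : Set (E × ℝ × ℝ) :=
  U ×ˢ (Ioi (0 : ℝ) ×ˢ Ioo (-ε₁) ε₁)

/-- Hypotheses on the perturbation `g x t T ε`: it is of class `C^(r-1)` jointly in all arguments,
of class `C^r` in `(x, T, ε)` with derivatives that depend continuously on all arguments
including `t`, and it is `T`-periodic in `t`. -/
structure IsPerturbation (U : Set E) (ε₁ : ℝ) (r : ℕ)
    (g : E → ℝ → ℝ → ℝ → E) : Prop where
  joint : ContDiffOn ℝ ((r - 1 : ℕ) : WithTop ℕ∞)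
    (fun w : (E × ℝ × ℝ) × ℝ => g w.1.1 w.2 w.1.2.1 w.1.2.2)
    (paramDomain U ε₁ ×ˢ univ)
  params : ∀ t : ℝ, ContDiffOn ℝ (r : WithTop ℕ∞)
    (fun y : E × ℝ × ℝ => g y.1 t y.2.1 y.2.2) (paramDomain U ε₁)
  params_cont : ContinuousOn
    (fun w : (E × ℝ × ℝ) × ℝ =>
      iteratedFDeriv ℝ r (fun y : E × ℝ × ℝ => g y.1 w.2 y.2.1 y.2.2) w.1)
    (paramDomain U ε₁ ×ˢ univ)
  periodic : ∀ x ∈ U, ∀ t T ε : ℝ, 0 < T → ε ∈ Ioo (-ε₁) ε₁ → g x (t + T) T ε = g x t T ε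

/-- The forced-damped system `ẋ = f(x) + ε g(x, t; T, ε)` has a `P`-periodic solution in `U` which
is at `ξ` at time `0`. -/
def HasPeriodicSolution (U : Set E) (f : E → E)
    (g : E → ℝ → ℝ → ℝ → E) (T ε P : ℝ) (ξ : E) : Prop :=
  ∃ y : ℝ → E, (∀ t, y t ∈ U) ∧ y 0 = ξ ∧
    (∀ t, HasDerivAt y (f (y t) + ε • g (y t) t T ε) t) ∧ Function.Periodic y P

/-- The Melnikov function
`M^{m:l}(s) = ∫_0^{mτ} ⟨DH(x₀(t+s)), g(x₀(t+s), t; mτ/l, 0)⟩ dt`, where `x₀(t) = z t`. -/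
noncomputable def melnikov (H : E → ℝ) (g : E → ℝ → ℝ → ℝ → E)
    (z : ℝ → E) (τ : ℝ) (m l : ℕ) (s : ℝ) : ℝ :=
  ∫ t in (0 : ℝ)..(m * τ), fderiv ℝ H (z (t + s)) (g (z (t + s)) t (m * τ / l) 0)

/-- A branch, of class `C^k` in `ε ∈ [0, ε₀)`, of initial conditions `ξ ε` and forcing periods `T ε`
of `lT`-periodic orbits of the forced-damped system, which starts at `ε = 0` from the point `z s`
of the conservative orbit and from the forcing period `mτ/l`. -/
structure IsBranch (U : Set E) (f : E → E)
    (g : E → ℝ → ℝ → ℝ → E) (ε₁ : ℝ) (z : ℝ → E) (τ : ℝ) (m l k : ℕ) (s : ℝ)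
    (ε₀ : ℝ) (ξ : ℝ → E) (T : ℝ → ℝ) : Prop where
  pos : 0 < ε₀
  le : ε₀ ≤ ε₁
  smooth_init : ContDiffOn ℝ (k : WithTop ℕ∞) ξ (Ico 0 ε₀)
  smooth_period : ContDiffOn ℝ (k : WithTop ℕ∞) T (Ico 0 ε₀)
  init_zero : ξ 0 = z s
  period_zero : T 0 = m * τ / l
  period_pos : ∀ ε ∈ Ico 0 ε₀, 0 < T ε
  orbit : ∀ ε ∈ Ico 0 ε₀, HasPeriodicSolution U f g (T ε) ε (l * T ε) (ξ ε)

/-- The conservative orbit persists, with class `C^k`, from its point `z s`. -/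
def PersistsAt (U : Set E) (f : E → E)
    (g : E → ℝ → ℝ → ℝ → E) (ε₁ : ℝ) (z : ℝ → E) (τ : ℝ) (m l k : ℕ)
    (s : ℝ) : Prop :=
  ∃ (ε₀ : ℝ) (ξ : ℝ → E) (T : ℝ → ℝ), IsBranch U f g ε₁ z τ m l k s ε₀ ξ T

/-- The same under the resonance condition `L(ξ, lT) = L(p, mτ)`, with `p = z 0`. -/
def PersistsAlong (U : Set E) (f : E → E)
    (g : E → ℝ → ℝ → ℝ → E) (ε₁ : ℝ) (z : ℝ → E) (τ : ℝ) (m l k : ℕ)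
    (L : E × ℝ → ℝ) (s : ℝ) : Prop :=
  ∃ (ε₀ : ℝ) (ξ : ℝ → E) (T : ℝ → ℝ), IsBranch U f g ε₁ z τ m l k s ε₀ ξ T ∧
    ∀ ε ∈ Ico 0 ε₀, L (ξ ε, l * T ε) = L (z 0, m * τ)

/-- `L` parametrises the family of conservative periodic orbits around `z`: it is of class `C^r`
near all `(z s, mτ)`, and for `lam` close to `lam₀ = L(z 0, mτ)` there are periodic orbits
`X lam` of `f`, of period `𝒯 lam`, with initial condition and period of class `C^1` in `lam`, equal
to `z` and `τ` at `lam₀`, along each of which `L(·, m 𝒯 lam)` has the constant value `lam`. -/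
def Parametrises (U : Set E) (f : E → E) (z : ℝ → E) (τ : ℝ)
    (m r : ℕ) (L : E × ℝ → ℝ) : Prop :=
  (∃ V : Set (E × ℝ), IsOpen V ∧ (∀ s, (z s, m * τ) ∈ V) ∧
    ContDiffOn ℝ (r : WithTop ℕ∞) L V) ∧
  ∃ (δ : ℝ) (X : ℝ → ℝ → E) (𝒯 : ℝ → ℝ), 0 < δ ∧
    X (L (z 0, m * τ)) = z ∧ 𝒯 (L (z 0, m * τ)) = τ ∧
    ContDiffOn ℝ 1 (fun lam => X lam 0) (Metric.ball (L (z 0, m * τ)) δ) ∧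
    ContDiffOn ℝ 1 𝒯 (Metric.ball (L (z 0, m * τ)) δ) ∧
    ∀ lam ∈ Metric.ball (L (z 0, m * τ)) δ,
      0 < 𝒯 lam ∧ (∀ t, X lam t ∈ U) ∧ (∀ t, HasDerivAt (X lam) (f (X lam t)) t) ∧
        Function.Periodic (X lam) (𝒯 lam) ∧ ∀ t, L (X lam t, m * 𝒯 lam) = lam

/-- A topologically transverse zero of `F`: a zero across which `F` changes sign. If the zero is
not isolated, it may belong to an interval `[a, b]` of zeros, and the sign changes across this
interval; for an isolated zero, `a = b = s` is forced. -/
def IsTransverseZero (F : ℝ → ℝ) (s : ℝ) : Prop :=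
  ∃ a b : ℝ, a ≤ s ∧ s ≤ b ∧ (∀ u ∈ Icc a b, F u = 0) ∧
    ∀ δ > 0, ∃ u ∈ Ioo (a - δ) a, ∃ v ∈ Ioo b (b + δ), F u * F v < 0

end Resonance

open Resonance

/-! A periodic solution is sought as `x(θ) = z(a + mτθ) + ε y(θ)`, where `θ ∈ [0,1]` is time divided
by `lT` and the forcing period is `T = mτ/l + εT₁`. By Hadamard's lemma the equation for the
deviation `y` can be divided by `ε`. The resulting `deviationField` is of class `C^(r-1)` in all
variables, including `ε` at `0`, where it is affine in `(y, T₁)`. Periodicity becomes `y(1) = y(0)`: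
`dim E` equations for the `dim E + 2` unknowns `(y(0), T₁, a)`.

At `ε = 0`, varying `(y(0), T₁)` moves `y(1) - y(0)` by `Y(a)` applied to values of `periodDefect`.
The linearised flow conserves `DH` and `DH` annihilates `f`, so all these values lie in the kernel
of `DH(z(a))`. Pairing with `DH` therefore leaves `DH(z(a))(y(1) - y(0)) = M(a)`
(`fderiv_deviation_eq_melnikov`). Hence `M(s₀) = 0` is the solvability condition, and `M'(s₀) ≠ 0`
makes the phase `a` supply the missing direction.

Normality says that the kernel of `periodDefect` has dimension at most two
(`finrank_ker_periodDefect_le`). It contains the velocity `(f(p), 0)`, and a second vector because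
`DH ≠ 0`. Two scalar equations remove it: a phase condition `ρ`, nonzero on the velocity, and a
condition `q`, whose linear part `κ` sees the second vector. The linearisation is then invertible,
and the implicit function theorem gives the branch (`exists_deviation_branch`). For the constraint
on `L`, `q` is the difference quotient of `L`, and the second kernel vector is the tangent of the
conservative family. The smooth dependence of solutions on data comes from the implicit function
theorem for the integral equation in `C([0,1], E)` (`exists_solution_map`).

For non-persistence, `H` has the same value at both ends of a period, so the integral of `DH(x) g`
vanishes when `ε ≠ 0`. Near the orbit this integral, in rescaled time, is close to `M(s)/(mτ) ≠ 0`.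
Compactness of the orbit makes the contradiction uniform.

The further zero exists because `M` is continuous and `τ`-periodic: crossing zero in the same
direction at `s₀` and `s₀ + τ`, it must cross back in between. -/

namespace Resonance

open Filter Topology

/-! ### Superposition operators on spaces of continuous functions -/

section Superposition

universe u

variable {K : Type*} [TopologicalSpace K] [CompactSpace K]
  {G F : Type*} [NormedAddCommGroup G] [NormedSpace ℝ G] [NormedAddCommGroup F] [NormedSpace ℝ F]

/-- Pointwise application of a continuous family of operators, as a bilinear map. -/
noncomputable def pointwiseApply (K G F : Type*) [TopologicalSpace K] [CompactSpace K]
    [NormedAddCommGroup G] [NormedSpace ℝ G] [NormedAddCommGroup F] [NormedSpace ℝ F] :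
    C(K, G →L[ℝ] F) →L[ℝ] C(K, G) →L[ℝ] C(K, F) :=
  LinearMap.mkContinuous₂
    (LinearMap.mk₂ ℝ
      (fun (A : C(K, G →L[ℝ] F)) (v : C(K, G)) =>
        (⟨fun t => A t (v t), A.continuous.clm_apply v.continuous⟩ : C(K, F)))
      (fun A B v => by ext t; simp) (fun c A v => by ext t; simp)
      (fun A v w => by ext t; simp) (fun c A v => by ext t; simp))
    1 (fun A v => by
      rw [ContinuousMap.norm_le _ (by positivity)]
      intro t
      rw [one_mul]
      exact ((A t).le_opNorm _).trans
        (mul_le_mul (A.norm_coe_le_norm t) (v.norm_coe_le_norm t) (norm_nonneg _) (by positivity)))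

@[simp]
theorem pointwiseApply_apply (A : C(K, G →L[ℝ] F)) (v : C(K, G)) (t : K) :
    pointwiseApply K G F A v t = A t (v t) := rfl

/-- The range of `y` is compact, so `V'` is uniformly continuous at it. The mean value inequality
then bounds the remainder at every `t` by the same multiple of `‖w - y‖`. -/
theorem hasFDerivAt_superposition {V : G → F} {V' : G → G →L[ℝ] F}
    (hV : ∀ x, HasFDerivAt V (V' x) x) (hc : Continuous V) (hc' : Continuous V') (y : C(K, G)) :
    HasFDerivAt (fun y : C(K, G) => (⟨V, hc⟩ : C(G, F)).comp y)
      (pointwiseApply K G F ((⟨V', hc'⟩ : C(G, G →L[ℝ] F)).comp y)) y := by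
  rw [hasFDerivAt_iff_isLittleO, Asymptotics.isLittleO_iff]
  intro c hcpos
  have hK : IsCompact (range y) := isCompact_range y.continuous
  have := hK.uniformContinuousAt_of_continuousAt V' (fun a _ => hc'.continuousAt)
    (Metric.dist_mem_uniformity hcpos)
  obtain ⟨δ, hδ, hsub⟩ := Metric.mem_uniformity_dist.1 this
  filter_upwards [Metric.ball_mem_nhds y hδ] with w hw
  rw [ContinuousMap.norm_le _ (by positivity)]
  intro t
  have hwt : dist (w t) (y t) < δ := lt_of_le_of_lt (ContinuousMap.dist_apply_le_dist t) hw
  have key := (convex_ball (y t) δ).norm_image_sub_le_of_norm_hasFDerivWithin_le'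
    (f := V) (f' := V') (φ := V' (y t)) (C := c) (x := y t) (y := w t)
    (fun x _ => (hV x).hasFDerivWithinAt)
    (fun x hx => by
      have h1 : dist (y t) x < δ := by rw [dist_comm]; exact hx
      have := hsub h1 (mem_range_self t)
      rw [← dist_eq_norm, dist_comm]
      exact le_of_lt this)
    (Metric.mem_ball_self hδ) hwt
  refine le_trans (le_of_eq ?_) (key.trans ?_)
  · simp
  · gcongr
    exact (w - y).norm_coe_le_norm t

/-- Induction on the order: the derivative is superposition with `V'` followed by a bounded linear
operator. The target changes to an operator space at each step, whence the common universe. -/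
theorem contDiff_superposition {G F : Type u} [NormedAddCommGroup G] [NormedSpace ℝ G]
    [NormedAddCommGroup F] [NormedSpace ℝ F] {n : ℕ} {V : G → F} (hV : ContDiff ℝ n V) :
    ContDiff ℝ n (fun y : C(K, G) => (⟨V, hV.continuous⟩ : C(G, F)).comp y) := by
  induction n generalizing F with
  | zero =>
    exact contDiff_zero.2 (ContinuousMap.continuous_postcomp _)
  | succ n ih =>
    have hV1 : ContDiff ℝ ((n : WithTop ℕ∞) + 1) V := by exact_mod_cast hV
    obtain ⟨V', hV', hd⟩ := contDiff_succ_iff_hasFDerivAt.1 hV1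
    have := contDiff_succ_iff_hasFDerivAt (𝕜 := ℝ) (n := n)
      (f := fun y : C(K, G) => (⟨V, hV.continuous⟩ : C(G, F)).comp y)
    refine this.2 ⟨fun y => pointwiseApply K G F ((⟨V', hV'.continuous⟩ : C(G, G →L[ℝ] F)).comp y),
      ContDiff.comp (g := pointwiseApply K G F) (ContinuousLinearMap.contDiff _) (ih hV'), fun y => ?_⟩
    exact hasFDerivAt_superposition hd _ _ y

end Superposition

/-! ### Invertibility of linear Volterra equations -/

section Volterra

open scoped unitInterval

variable {E : Type*} [NormedAddCommGroup E]

/-- The extension to `ℝ` of a continuous function on the unit interval. -/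
noncomputable def extendUnit (y : C(I, E)) : ℝ → E := IccExtend zero_le_one y

theorem continuous_extendUnit (y : C(I, E)) : Continuous (extendUnit y) :=
  y.continuous.Icc_extend'

theorem extendUnit_of_mem (y : C(I, E)) {t : ℝ} (ht : t ∈ Icc (0 : ℝ) 1) :
    extendUnit y t = y ⟨t, ht⟩ := IccExtend_of_mem _ _ ht

theorem norm_extendUnit_le (y : C(I, E)) (t : ℝ) : ‖extendUnit y t‖ ≤ ‖y‖ :=
  y.norm_coe_le_norm _

variable [NormedSpace ℝ E]

/-- Integration from `0`, as an operator on the continuous functions on the unit interval. -/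
noncomputable def primitive (E : Type*) [NormedAddCommGroup E] [NormedSpace ℝ E] :
    C(I, E) →L[ℝ] C(I, E) :=
  LinearMap.mkContinuous
    { toFun := fun y => ⟨fun t => ∫ s in (0 : ℝ)..t, extendUnit y s,
        (intervalIntegral.continuous_primitive
          (fun a b => (continuous_extendUnit y).intervalIntegrable a b) 0).comp
          continuous_subtype_val⟩
      map_add' := fun y w => by
        ext t
        have : extendUnit (y + w) = fun s => extendUnit y s + extendUnit w s := rfl
        simp only [ContinuousMap.coe_mk, ContinuousMap.add_apply, this]
        exact intervalIntegral.integral_add ((continuous_extendUnit y).intervalIntegrable _ _)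
          ((continuous_extendUnit w).intervalIntegrable _ _)
      map_smul' := fun c y => by
        ext t
        have : extendUnit (c • y) = fun s => c • extendUnit y s := rfl
        simp only [ContinuousMap.coe_mk, ContinuousMap.smul_apply, this, RingHom.id_apply]
        exact intervalIntegral.integral_smul _ _ }
    1 (fun y => by
      rw [ContinuousMap.norm_le _ (by positivity)]
      intro t
      refine (intervalIntegral.norm_integral_le_of_norm_le_const
        (C := ‖y‖) (fun s _ => norm_extendUnit_le y s)).trans ?_
      rw [sub_zero, abs_of_nonneg t.2.1, mul_comm]
      exact mul_le_mul_of_nonneg_right t.2.2 (norm_nonneg _))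

theorem primitive_apply (y : C(I, E)) (t : I) :
    primitive E y t = ∫ s in (0 : ℝ)..t, extendUnit y s := rfl

/-- Multiplication by `exp (c t)`. -/
noncomputable def expWeight (E : Type*) [NormedAddCommGroup E] [NormedSpace ℝ E] (c : ℝ) :
    C(I, E) →L[ℝ] C(I, E) :=
  pointwiseApply I E E ⟨fun t => Real.exp (c * t) • ContinuousLinearMap.id ℝ E, by fun_prop⟩

theorem expWeight_apply (c : ℝ) (y : C(I, E)) (t : I) :
    expWeight E c y t = Real.exp (c * t) • y t := by
  simp [expWeight]

theorem expWeight_mul_neg (c : ℝ) : expWeight E c * expWeight E (-c) = 1 := by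
  ext y t
  simp [expWeight_apply, smul_smul, ← Real.exp_add]

/-- Conjugation by the weight `exp (c t)` (Bielecki's norm) brings the norm of the Volterra operator
down to `‖A‖ / c`. With `c = ‖A‖ + 1` this is less than one, and the Neumann series applies without
any smallness of `A`. -/
theorem isUnit_one_sub_primitive [CompleteSpace E] (A : C(I, E →L[ℝ] E)) :
    IsUnit (1 - primitive E * pointwiseApply I E E A) := by
  set c : ℝ := ‖A‖ + 1 with hc
  have hcpos : 0 < c := by positivity
  set T : C(I, E) →L[ℝ] C(I, E) :=
    expWeight E (-c) * (primitive E * pointwiseApply I E E A) * expWeight E c with hT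
  have hTn : ‖T‖ ≤ ‖A‖ / c := by
    refine ContinuousLinearMap.opNorm_le_bound _ (by positivity) fun y => ?_
    rw [ContinuousMap.norm_le _ (by positivity)]
    intro t
    have h1 : T y t = Real.exp (-c * t) •
        ∫ s in (0 : ℝ)..t, extendUnit (pointwiseApply I E E A (expWeight E c y)) s := by
      simp [hT, expWeight_apply, primitive_apply]
    have hb : ‖∫ s in (0 : ℝ)..t, extendUnit (pointwiseApply I E E A (expWeight E c y)) s‖ ≤
        ∫ s in (0 : ℝ)..t, ‖A‖ * ‖y‖ * Real.exp (c * s) := by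
      refine intervalIntegral.norm_integral_le_of_norm_le t.2.1
        (MeasureTheory.ae_of_all _ fun s hs => ?_)
        ((by fun_prop : Continuous fun s : ℝ => ‖A‖ * ‖y‖ * Real.exp (c * s)).intervalIntegrable
          _ _)
      have hs' : s ∈ Icc (0 : ℝ) 1 := ⟨hs.1.le, hs.2.trans t.2.2⟩
      rw [extendUnit_of_mem _ hs', pointwiseApply_apply, expWeight_apply, map_smul, norm_smul,
        Real.norm_of_nonneg (Real.exp_pos _).le, mul_comm]
      gcongr
      exact ((A _).le_opNorm _).trans (mul_le_mul (A.norm_coe_le_norm _) (y.norm_coe_le_norm _)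
        (norm_nonneg _) (by positivity))
    have hi : ∫ s in (0 : ℝ)..t, ‖A‖ * ‖y‖ * Real.exp (c * s) =
        ‖A‖ * ‖y‖ * ((Real.exp (c * t) - 1) / c) := by
      rw [intervalIntegral.integral_const_mul, intervalIntegral.integral_comp_mul_left _ hcpos.ne',
        integral_exp]
      simp [div_eq_inv_mul]
    rw [h1, norm_smul, Real.norm_of_nonneg (Real.exp_pos _).le]
    calc Real.exp (-c * t) * _ ≤ Real.exp (-c * t) * (‖A‖ * ‖y‖ * ((Real.exp (c * t) - 1) / c)) := by
          rw [← hi]; gcongr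
      _ ≤ Real.exp (-c * t) * (‖A‖ * ‖y‖ * (Real.exp (c * t) / c)) := by gcongr; linarith
      _ = (Real.exp (-c * t) * Real.exp (c * t)) * (‖A‖ / c * ‖y‖) := by ring
      _ = ‖A‖ / c * ‖y‖ := by rw [← Real.exp_add]; simp
  have hTlt : ‖T‖ < 1 := hTn.trans_lt (by rw [div_lt_one hcpos, hc]; linarith)
  have hu : IsUnit (1 - T) := (Units.oneSub T hTlt).isUnit
  have h1 : expWeight E c * expWeight E (-c) = 1 := expWeight_mul_neg c
  have h2 : expWeight E (-c) * expWeight E c = 1 := by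
    simpa using expWeight_mul_neg (E := E) (-c)
  have hw1 : IsUnit (expWeight E c) := ⟨⟨_, _, h1, h2⟩, rfl⟩
  have hw2 : IsUnit (expWeight E (-c)) := ⟨⟨_, _, h2, h1⟩, rfl⟩
  have heq : 1 - primitive E * pointwiseApply I E E A =
      expWeight E c * (1 - T) * expWeight E (-c) := by
    rw [mul_sub, sub_mul, mul_one, h1, hT]
    congr 1
    calc primitive E * pointwiseApply I E E A
        = 1 * (primitive E * pointwiseApply I E E A) * 1 := by rw [one_mul, mul_one]
      _ = _ := by rw [← h1]; simp only [mul_assoc]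
  rw [heq]
  exact (hw1.mul hu).mul hw2

end Volterra
end Resonance

namespace Resonance

open Filter Topology

/-! ### Smooth dependence of solutions on initial values and parameters -/

section SolutionMap

open scoped unitInterval

universe u

/-- The constant functions, as an operator. -/
noncomputable def constOperator (X : Type*) [NormedAddCommGroup X] [NormedSpace ℝ X] :
    X →L[ℝ] C(I, X) :=
  LinearMap.mkContinuous
    { toFun := fun x => ContinuousMap.const I x
      map_add' := fun _ _ => rfl
      map_smul' := fun _ _ => rfl } 1
    (fun x => by
      rw [ContinuousMap.norm_le _ (by positivity)]
      intro t
      rw [one_mul]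
      exact le_rfl)

@[simp]
theorem constOperator_apply {X : Type*} [NormedAddCommGroup X] [NormedSpace ℝ X] (x : X) (t : I) :
    constOperator X x t = x := rfl

/-- Adjoining a constant parameter to a curve. -/
noncomputable def adjoinParam (E P : Type*) [NormedAddCommGroup E] [NormedSpace ℝ E]
    [NormedAddCommGroup P] [NormedSpace ℝ P] : P × C(I, E) →L[ℝ] C(I, (E × P) × ℝ) :=
  ((ContinuousLinearMap.inl ℝ (E × P) ℝ ∘L
      ContinuousLinearMap.inl ℝ E P).compLeftContinuous ℝ I) ∘L ContinuousLinearMap.snd ℝ _ _ +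
  ((ContinuousLinearMap.inl ℝ (E × P) ℝ ∘L
      ContinuousLinearMap.inr ℝ E P).compLeftContinuous ℝ I) ∘L
        constOperator P ∘L ContinuousLinearMap.fst ℝ _ _

/-- The curve `t ↦ ((0, 0), t)`. -/
noncomputable def timeCurve (X : Type*) [NormedAddCommGroup X] : C(I, X × ℝ) :=
  ⟨fun t => (0, (t : ℝ)), by fun_prop⟩

variable {E : Type u} [NormedAddCommGroup E] [NormedSpace ℝ E]
  {P : Type} [NormedAddCommGroup P] [NormedSpace ℝ P]

theorem adjoinParam_apply (p : P) (y : C(I, E)) (t : I) :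
    adjoinParam E P (p, y) t = ((y t, p), 0) := by
  simp [adjoinParam]

theorem adjoinParam_add_time_apply (p : P) (y : C(I, E)) (t : I) :
    (adjoinParam E P (p, y) + timeCurve (E × P)) t = ((y t, p), (t : ℝ)) := by
  simp [adjoinParam_apply, timeCurve]

/-- The velocity along `y` of a vector field depending on parameters and on time. -/
noncomputable def velocity {V : (E × P) × ℝ → E} (hV : Continuous V) (p : P) (y : C(I, E)) :
    C(I, E) :=
  (⟨V, hV⟩ : C((E × P) × ℝ, E)).comp (adjoinParam E P (p, y) + timeCurve (E × P))

theorem velocity_apply {V : (E × P) × ℝ → E} (hV : Continuous V) (p : P) (y : C(I, E)) (t : I) :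
    velocity hV p y t = V ((y t, p), (t : ℝ)) := by
  simp only [velocity, ContinuousMap.comp_apply, ContinuousMap.coe_mk, adjoinParam_add_time_apply]

theorem contDiff_velocity {V : (E × P) × ℝ → E} {n : ℕ} (hV : ContDiff ℝ n V) :
    ContDiff ℝ n (fun w : P × C(I, E) => velocity hV.continuous w.1 w.2) := by
  refine (contDiff_superposition (K := I) hV).comp ?_
  exact (adjoinParam E P).contDiff.add contDiff_const

theorem hasFDerivAt_velocity {V : (E × P) × ℝ → E} {V' : (E × P) × ℝ → ((E × P) × ℝ) →L[ℝ] E}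
    (hV : ∀ x, HasFDerivAt V (V' x) x) (hc : Continuous V) (hc' : Continuous V')
    (w : P × C(I, E)) :
    HasFDerivAt (fun w : P × C(I, E) => velocity hc w.1 w.2)
      (pointwiseApply I _ E ((⟨V', hc'⟩ : C(_, ((E × P) × ℝ) →L[ℝ] E)).comp
        (adjoinParam E P w + timeCurve (E × P))) ∘L adjoinParam E P) w :=
  (hasFDerivAt_superposition hV hc hc' _).comp w
    ((adjoinParam E P).hasFDerivAt.add_const (timeCurve (E × P)))


/-- The antiderivative on `ℝ` of the extension of a function on the unit interval. -/
theorem hasDerivAt_integral_extendUnit [CompleteSpace E] (v : E) (c : C(I, E)) (t : ℝ) :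
    HasDerivAt (fun t => v + ∫ s in (0 : ℝ)..t, extendUnit c s) (extendUnit c t) t :=
  (intervalIntegral.integral_hasDerivAt_right ((continuous_extendUnit c).intervalIntegrable _ _)
    ((continuous_extendUnit c).stronglyMeasurableAtFilter _ _)
    (continuous_extendUnit c).continuousAt).const_add v

theorem exists_affine_solution [CompleteSpace E] {A : ℝ → E →L[ℝ] E} (hA : Continuous A) {b : ℝ → E}
    (hb : Continuous b) (v : E) :
    ∃ w : ℝ → E, w 0 = v ∧ ∀ t ∈ Icc (0 : ℝ) 1, HasDerivAt w (A t (w t) + b t) t := by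
  set A' : C(I, E →L[ℝ] E) := ⟨fun t => A t, by fun_prop⟩ with hA'
  set b' : C(I, E) := ⟨fun t => b t, by fun_prop⟩ with hb'
  obtain ⟨u, hu⟩ := isUnit_one_sub_primitive A'
  set y : C(I, E) := (↑u⁻¹ : C(I, E) →L[ℝ] C(I, E)) (constOperator E v + primitive E b') with hy
  have h1 : y - primitive E (pointwiseApply I E E A' y) = constOperator E v + primitive E b' := by
    have : ((u : C(I, E) →L[ℝ] C(I, E)) * (↑u⁻¹ : C(I, E) →L[ℝ] C(I, E)))
        (constOperator E v + primitive E b') = constOperator E v + primitive E b' := by simp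
    rw [hu] at this
    simpa [hy] using this
  have h2 : y = constOperator E v + primitive E (pointwiseApply I E E A' y + b') := by
    rw [map_add, ← add_assoc, add_right_comm, ← h1]; abel
  refine ⟨fun t => v + ∫ s in (0 : ℝ)..t, extendUnit (pointwiseApply I E E A' y + b') s,
    by simp, fun t ht => ?_⟩
  have h3 : v + ∫ s in (0 : ℝ)..t, extendUnit (pointwiseApply I E E A' y + b') s = y ⟨t, ht⟩ := by
    conv_rhs => rw [h2]
    rw [ContinuousMap.add_apply, constOperator_apply, primitive_apply]
  have h4 := hasDerivAt_integral_extendUnit v (pointwiseApply I E E A' y + b') t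
  rw [extendUnit_of_mem _ ht] at h4
  simp only [h3]
  exact h4

theorem eq_const_add_primitive [CompleteSpace E] {y : ℝ → E} {c : C(I, E)}
    (h : ∀ t (ht : t ∈ Icc (0 : ℝ) 1), HasDerivAt y (c ⟨t, ht⟩) t) (yI : C(I, E))
    (hyI : ∀ t : I, yI t = y t) : yI = constOperator E (y 0) + primitive E c := by
  ext t
  have : ∫ s in (0 : ℝ)..t, extendUnit c s = y t - y 0 := by
    refine intervalIntegral.integral_eq_sub_of_hasDerivAt (fun s hs => ?_)
      ((continuous_extendUnit c).intervalIntegrable _ _)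
    rw [uIcc_of_le t.2.1] at hs
    have hs' : s ∈ Icc (0 : ℝ) 1 := ⟨hs.1, hs.2.trans t.2.2⟩
    rw [extendUnit_of_mem _ hs']
    exact h s hs'
  simp [primitive_apply, this, hyI]

/-- The residual of the integral equation. -/
noncomputable def residual {V : (E × P) × ℝ → E} (hV : Continuous V) (w : (E × P) × C(I, E)) :
    C(I, E) :=
  w.2 - constOperator E w.1.1 - primitive E (velocity hV w.1.2 w.2)

/-- The derivative of the residual, for the coefficients `D`. -/
noncomputable def residualDeriv (D : C(I, ((E × P) × ℝ) →L[ℝ] E)) :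
    (E × P) × C(I, E) →L[ℝ] C(I, E) :=
  ContinuousLinearMap.snd ℝ _ _ -
    constOperator E ∘L ContinuousLinearMap.fst ℝ _ _ ∘L ContinuousLinearMap.fst ℝ _ _ -
    primitive E ∘L (pointwiseApply I _ E D ∘L adjoinParam E P) ∘L
      ((ContinuousLinearMap.snd ℝ _ _ ∘L ContinuousLinearMap.fst ℝ _ _).prod
        (ContinuousLinearMap.snd ℝ _ _))

theorem residualDeriv_apply (D : C(I, ((E × P) × ℝ) →L[ℝ] E)) (w : (E × P) × C(I, E)) :
    residualDeriv D w = w.2 - constOperator E w.1.1 -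
      primitive E (pointwiseApply I _ E D (adjoinParam E P (w.1.2, w.2))) := rfl

theorem contDiff_residual {V : (E × P) × ℝ → E} {n : ℕ} (hV : ContDiff ℝ n V) :
    ContDiff ℝ n (residual hV.continuous) := by
  have h1 : ContDiff ℝ n (fun w : (E × P) × C(I, E) => velocity hV.continuous w.1.2 w.2) :=
    ContDiff.comp (g := fun w : P × C(I, E) => velocity hV.continuous w.1 w.2)
      (f := fun w : (E × P) × C(I, E) => (w.1.2, w.2)) (contDiff_velocity hV)
      ((contDiff_snd.comp contDiff_fst).prodMk contDiff_snd)
  have h2 : ContDiff ℝ n (fun w : (E × P) × C(I, E) => constOperator E w.1.1) :=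
    (constOperator E).contDiff.comp (contDiff_fst.comp contDiff_fst)
  exact (contDiff_snd.sub h2).sub ((primitive E).contDiff.comp h1)

theorem hasFDerivAt_residual {V : (E × P) × ℝ → E} (hV : ContDiff ℝ 1 V) (w : (E × P) × C(I, E)) :
    HasFDerivAt (residual hV.continuous)
      (residualDeriv ((⟨fderiv ℝ V, hV.continuous_fderiv one_ne_zero⟩ :
        C(_, ((E × P) × ℝ) →L[ℝ] E)).comp
          (adjoinParam E P (w.1.2, w.2) + timeCurve (E × P)))) w := by
  have hd : ∀ x, HasFDerivAt V (fderiv ℝ V x) x := fun x =>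
    (hV.differentiable one_ne_zero x).hasFDerivAt
  have h0 := ((ContinuousLinearMap.snd ℝ (E) P ∘L ContinuousLinearMap.fst ℝ (E × P) C(I, E)).prod
          (ContinuousLinearMap.snd ℝ (E × P) C(I, E))).hasFDerivAt (x := w)
  have h1 := HasFDerivAt.comp (g := fun w : P × C(I, E) => velocity hV.continuous w.1 w.2)
    (f := fun w : (E × P) × C(I, E) => (w.1.2, w.2)) w
    (hasFDerivAt_velocity hd hV.continuous (hV.continuous_fderiv one_ne_zero) (w.1.2, w.2)) h0
  have h2 := (ContinuousLinearMap.snd ℝ (E × P) C(I, E) - constOperator E ∘L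
        ContinuousLinearMap.fst ℝ E P ∘L ContinuousLinearMap.fst ℝ (E × P) C(I, E)).hasFDerivAt
        (x := w)
  exact h2.sub ((primitive E).hasFDerivAt.comp w h1)

/-- The partial derivative with respect to the curve is `1 - primitive * A`, with `A` the
linearisation along the curve. -/
theorem residualDeriv_comp_inr_isInvertible [CompleteSpace E] (D : C(I, ((E × P) × ℝ) →L[ℝ] E)) :
    (residualDeriv D ∘L .inr ℝ (E × P) C(I, E)).IsInvertible := by
  set A : C(I, E →L[ℝ] E) :=
    ⟨fun t => D t ∘L (ContinuousLinearMap.inl ℝ (E × P) ℝ ∘L ContinuousLinearMap.inl ℝ E P),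
      by fun_prop⟩ with hA
  obtain ⟨v, hv⟩ := isUnit_one_sub_primitive A
  refine ⟨ContinuousLinearEquiv.unitsEquiv ℝ _ v, ?_⟩
  have : (residualDeriv D ∘L .inr ℝ (E × P) C(I, E)) =
      1 - primitive E * pointwiseApply I E E A := by
    ext1 w
    have h1 : pointwiseApply I _ E D (adjoinParam E P (0, w)) = pointwiseApply I E E A w := by
      ext t
      rw [pointwiseApply_apply, pointwiseApply_apply, adjoinParam_apply]
      rfl
    rw [ContinuousLinearMap.comp_apply, residualDeriv_apply]
    change w - constOperator E 0 - primitive E (pointwiseApply I _ E D (adjoinParam E P (0, w))) =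
      w - primitive E (pointwiseApply I E E A w)
    rw [h1, map_zero, sub_zero]
  rw [this, ← hv]
  rfl

/-- Smooth dependence of solutions on initial conditions and parameters, near a given solution on
the unit interval. -/
theorem exists_solution_map [CompleteSpace E] [CompleteSpace P] {V : (E × P) × ℝ → E} {n : ℕ} (hn : 1 ≤ n)
    (hV : ContDiff ℝ n V) {y : ℝ → E} {p : P}
    (hy : ∀ t ∈ Icc (0 : ℝ) 1, HasDerivAt y (V ((y t, p), t)) t) :
    ∃ S : E × P → ℝ → E,
      ContDiffAt ℝ n (fun q => S q 1) (y 0, p) ∧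
      (∀ t ∈ Icc (0 : ℝ) 1, S (y 0, p) t = y t) ∧
      (∀ᶠ q in 𝓝 (y 0, p), S q 0 = q.1 ∧
        ∀ t ∈ Icc (0 : ℝ) 1, HasDerivAt (S q) (V ((S q t, q.2), t)) t) ∧
      (∀ η > 0, ∀ᶠ q in 𝓝 (y 0, p), ∀ t ∈ Icc (0 : ℝ) 1, ‖S q t - y t‖ < η) ∧
      ∀ q' : E × P, ∃ w : ℝ → E, w 0 = q'.1 ∧
        (∀ t ∈ Icc (0 : ℝ) 1, HasDerivAt w (fderiv ℝ V ((y t, p), t) ((w t, q'.2), 0)) t) ∧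
        fderiv ℝ (fun q => S q 1) (y 0, p) q' = w 1 := by
  have hn0 : ((n : ℕ) : WithTop ℕ∞) ≠ 0 := by
    exact_mod_cast (by omega : n ≠ 0)
  have hyc : ContinuousOn y (Icc 0 1) := fun t ht => (hy t ht).continuousAt.continuousWithinAt
  set yI : C(I, E) := ⟨fun t => y t, continuousOn_iff_continuous_domRestrict.1 hyc⟩ with hyI
  have hV1 : ContDiff ℝ 1 V := hV.of_le (by exact_mod_cast hn)
  set N : P → C(I, E) → C(I, E) := velocity hV.continuous with hN
  set Φ : (E × P) × C(I, E) → C(I, E) := residual hV.continuous with hΦ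
  have hΦeq : ∀ w, Φ w = w.2 - constOperator E w.1.1 - primitive E (N w.1.2 w.2) := fun _ => rfl
  set u : (E × P) × C(I, E) := ((y 0, p), yI) with hu
  have hΦc : ContDiff ℝ n Φ := contDiff_residual hV
  have hΦu : Φ u = 0 := by
    have := eq_const_add_primitive (c := N p yI)
      (fun t ht => by rw [hN, velocity_apply]; exact hy t ht) yI (fun t => rfl)
    rw [hΦeq, sub_sub, sub_eq_zero]
    exact this
  set D : C(I, ((E × P) × ℝ) →L[ℝ] E) :=
    (⟨fderiv ℝ V, hV1.continuous_fderiv one_ne_zero⟩ : C(_, ((E × P) × ℝ) →L[ℝ] E)).comp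
        (adjoinParam E P (p, yI) + timeCurve (E × P)) with hD
  have hDt : ∀ t : I, D t = fderiv ℝ V ((y t, p), t) := fun t => by
    simp only [hD, ContinuousMap.comp_apply, ContinuousMap.coe_mk, adjoinParam_add_time_apply]
    rfl
  have hΦL : HasFDerivAt Φ (residualDeriv D) u := hasFDerivAt_residual hV1 u
  have hinv : (fderiv ℝ Φ u ∘L .inr ℝ (E × P) C(I, E)).IsInvertible := by
    rw [hΦL.fderiv]
    exact residualDeriv_comp_inr_isInvertible D
  have hΦcu : ContDiffAt ℝ n Φ u := hΦc.contDiffAt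
  set S : E × P → C(I, E) := hΦcu.implicitFunction hn0 hinv with hS
  have hSc : ContDiffAt ℝ n S (y 0, p) := hΦcu.contDiffAt_implicitFunction hn0 hinv
  have hS0 : S (y 0, p) = yI := hΦcu.implicitFunction_apply_self hn0 hinv
  have hSe : ∀ᶠ q in 𝓝 (y 0, p), Φ (q, S q) = 0 := by
    rw [← hΦu]; exact hΦcu.eventually_apply_implicitFunction hn0 hinv
  -- The implicit function takes values in curves on the closed interval. The antiderivative extends
  -- them to `ℝ`, so that two-sided derivatives exist at `0` and `1` too.
  set S' : E × P → ℝ → E := fun q t => q.1 + ∫ s in (0 : ℝ)..t, extendUnit (N q.2 (S q)) s with hS'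
  have hSS : ∀ q, Φ (q, S q) = 0 → ∀ t (ht : t ∈ Icc (0 : ℝ) 1), S' q t = S q ⟨t, ht⟩ := by
    intro q hq t ht
    have : S q = constOperator E q.1 + primitive E (N q.2 (S q)) := by
      rw [← sub_eq_zero, ← hq, hΦeq]
      abel
    conv_rhs => rw [this]
    rw [ContinuousMap.add_apply, constOperator_apply, primitive_apply]
  have hone : (1 : ℝ) ∈ Icc (0 : ℝ) 1 := by simp
  have hev : (fun q => S' q 1) =ᶠ[𝓝 (y 0, p)]
      fun q => ContinuousMap.evalCLM ℝ (⟨1, hone⟩ : I) (S q) := by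
    filter_upwards [hSe] with q hq
    exact hSS q hq 1 hone
  refine ⟨S', ?_, ?_, ?_, ?_, ?_⟩
  · exact ((ContinuousLinearMap.contDiff _).contDiffAt.comp _ hSc).congr_of_eventuallyEq hev
  · intro t ht
    rw [hSS _ (by rw [hS0]; exact hΦu) t ht, hS0]
    rfl
  · filter_upwards [hSe] with q hq
    refine ⟨by simp [hS'], fun t ht => ?_⟩
    have := hasDerivAt_integral_extendUnit q.1 (N q.2 (S q)) t
    rw [extendUnit_of_mem _ ht, hN, velocity_apply, ← hSS q hq t ht] at this
    exact this
  · intro η hη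
    filter_upwards [hSe, hSc.continuousAt.eventually (Metric.ball_mem_nhds _ hη)] with q hq hq2 t ht
    rw [hSS q hq t ht]
    rw [hS0] at hq2
    have := (ContinuousMap.dist_apply_le_dist (f := S q) (g := yI) ⟨t, ht⟩).trans_lt hq2
    rwa [dist_eq_norm] at this
  · intro q'
    have hSd : HasFDerivAt S (fderiv ℝ S (y 0, p)) (y 0, p) :=
      (hSc.differentiableAt hn0).hasFDerivAt
    set W : C(I, E) := fderiv ℝ S (y 0, p) q' with hW
    have h1 : HasFDerivAt (fun q => Φ (q, S q))
        (residualDeriv D ∘L (ContinuousLinearMap.id ℝ _).prod (fderiv ℝ S (y 0, p))) (y 0, p) := by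
      refine HasFDerivAt.comp (g := Φ) (y 0, p) ?_ ((hasFDerivAt_id _).prodMk hSd)
      change HasFDerivAt Φ _ ((y 0, p), S (y 0, p))
      rw [hS0]; exact hΦL
    -- Differentiating `Φ (q, S q) = 0` yields the variational equation in integrated form.
    have h2 : (residualDeriv D ∘L (ContinuousLinearMap.id ℝ _).prod (fderiv ℝ S (y 0, p))) = 0 := by
      refine h1.unique ?_
      exact (hasFDerivAt_const (0 : C(I, E)) _).congr_of_eventuallyEq hSe
    have h3 : W - constOperator E q'.1 -
        primitive E (pointwiseApply I _ E D (adjoinParam E P (q'.2, W))) = 0 := by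
      have := DFunLike.congr_fun h2 q'
      exact this
    set c := pointwiseApply I _ E D (adjoinParam E P (q'.2, W)) with hc
    have h4 : W = constOperator E q'.1 + primitive E c := by
      rw [← sub_eq_zero, ← h3]; abel
    have h5 : ∀ t (ht : t ∈ Icc (0 : ℝ) 1),
        q'.1 + ∫ s in (0 : ℝ)..t, extendUnit c s = W ⟨t, ht⟩ := by
      intro t ht
      conv_rhs => rw [h4]
      rw [ContinuousMap.add_apply, constOperator_apply, primitive_apply]
    refine ⟨fun t => q'.1 + ∫ s in (0 : ℝ)..t, extendUnit c s, by simp, fun t ht => ?_, ?_⟩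
    · have := hasDerivAt_integral_extendUnit q'.1 c t
      rw [extendUnit_of_mem _ ht] at this
      simp only [h5 t ht]
      convert this using 1
      rw [hc, pointwiseApply_apply, adjoinParam_apply, hDt]
    · refine Eq.trans ?_ (h5 1 hone).symm
      rw [hev.fderiv_eq, hW]
      have := ((ContinuousMap.evalCLM (M := E) ℝ (⟨1, hone⟩ : I)).hasFDerivAt.comp (y 0, p) hSd).fderiv
      simp only [Function.comp_def] at this
      rw [this]
      rfl

end SolutionMap

/-! ### Hadamard's lemma: smooth division by `ε` -/

section Hadamard

open scoped unitInterval

universe u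

/-- The integral is superposition along `s ↦ (x, s)`, followed by the bounded operator that
evaluates the primitive at `1`. -/
theorem contDiff_integral_unit {X F : Type u} [NormedAddCommGroup X] [NormedSpace ℝ X]
    [NormedAddCommGroup F] [NormedSpace ℝ F] {G : X × ℝ → F} {n : ℕ}
    (hG : ContDiff ℝ n G) : ContDiff ℝ n (fun x => ∫ s in (0 : ℝ)..1, G (x, s)) := by
  set j : X → C(I, X × ℝ) := fun x =>
    (ContinuousLinearMap.inl ℝ X ℝ).compLeftContinuous ℝ I (constOperator X x) + timeCurve X with hj
  have hjc : ContDiff ℝ n j :=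
    (((ContinuousLinearMap.inl ℝ X ℝ).compLeftContinuous ℝ I ∘L constOperator X).contDiff).add
      contDiff_const
  have h1 := (contDiff_superposition (K := I) hG).comp hjc
  have hone : (1 : ℝ) ∈ Icc (0 : ℝ) 1 := by simp
  have h2 := (ContinuousMap.evalCLM (M := F) ℝ (⟨1, hone⟩ : I) ∘L primitive F).contDiff.comp h1
  convert h2 using 1
  ext x
  simp only [Function.comp_def, ContinuousLinearMap.comp_apply, ContinuousMap.evalCLM_apply,
    primitive_apply]
  refine intervalIntegral.integral_congr fun s hs => ?_
  rw [uIcc_of_le zero_le_one] at hs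
  simp only [extendUnit_of_mem _ hs]
  simp [hj, timeCurve]

variable {X F : Type u} [NormedAddCommGroup X] [NormedSpace ℝ X]
    [NormedAddCommGroup F] [NormedSpace ℝ F]

/-- The quotient `(f (x + ε y) - f x) / ε`, written as an integral. -/
noncomputable def hadamardQuotient (f : X → F) (w : X × X × ℝ) : F :=
  ∫ s in (0 : ℝ)..1, fderiv ℝ f (w.1 + (s * w.2.2) • w.2.1) w.2.1

theorem contDiff_hadamardQuotient {f : X → F} {n : ℕ} (hf : ContDiff ℝ (n + 1 : ℕ) f) :
    ContDiff ℝ n (hadamardQuotient f) := by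
  refine contDiff_integral_unit
    (G := fun w : (X × X × ℝ) × ℝ => fderiv ℝ f (w.1.1 + (w.2 * w.1.2.2) • w.1.2.1) w.1.2.1) ?_
  have h1 : ContDiff ℝ n (fderiv ℝ f) := hf.fderiv_right (by norm_cast)
  refine (h1.comp ?_).clm_apply ?_ <;> fun_prop

theorem hadamardQuotient_zero [CompleteSpace F] (f : X → F) (x y : X) :
    hadamardQuotient f (x, y, 0) = fderiv ℝ f x y := by
  simp [hadamardQuotient]

theorem hadamardQuotient_spec [CompleteSpace F] {f : X → F} (hf : ContDiff ℝ 1 f) (x y : X)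
    (ε : ℝ) : f (x + ε • y) = f x + ε • hadamardQuotient f (x, y, ε) := by
  have h1 : ∀ s : ℝ, HasDerivAt (fun s : ℝ => f (x + (s * ε) • y))
      (ε • fderiv ℝ f (x + (s * ε) • y) y) s := by
    intro s
    have h2 : HasDerivAt (fun s : ℝ => x + (s * ε) • y) (ε • y) s := by
      simpa using (((hasDerivAt_id s).mul_const ε).smul_const y).const_add x
    have h3 := ((hf.differentiable one_ne_zero (x + (s * ε) • y)).hasFDerivAt).comp_hasDerivAt s h2
    rw [map_smul] at h3
    exact h3
  have hc : Continuous fun s : ℝ => ε • fderiv ℝ f (x + (s * ε) • y) y := by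
    have := hf.continuous_fderiv one_ne_zero
    fun_prop
  have h4 := intervalIntegral.integral_eq_sub_of_hasDerivAt (a := 0) (b := 1)
    (fun s _ => h1 s) (hc.intervalIntegrable _ _)
  rw [intervalIntegral.integral_smul] at h4
  simp only [one_mul, zero_mul, zero_smul, add_zero] at h4
  rw [hadamardQuotient, h4]
  abel

end Hadamard
end Resonance

namespace Resonance

open Filter Topology

/-! ### Extension of local data by cut-off functions -/

section Cutoff

variable {G F : Type*} [NormedAddCommGroup G] [NormedSpace ℝ G] [FiniteDimensional ℝ G]
  [NormedAddCommGroup F] [NormedSpace ℝ F]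

theorem exists_contDiff_cutoff {W K : Set G} (hW : IsOpen W) (hK : IsCompact K) (hKW : K ⊆ W) :
    ∃ χ : G → ℝ, (∀ n : ℕ, ContDiff ℝ n χ) ∧ (∀ᶠ x in 𝓝ˢ K, χ x = 1) ∧
      ∀ x ∉ W, ∀ᶠ y in 𝓝 x, χ y = 0 := by
  obtain ⟨χ, h0, h1, -⟩ := exists_contMDiffMap_zero_one_nhds_of_isClosed (n := ⊤)
    (modelWithCornersSelf ℝ G) hW.isClosed_compl hK.isClosed
    (disjoint_left.2 fun x hx hxK => hx (hKW hxK))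
  refine ⟨χ, fun n => ?_, h1, fun x hx => ?_⟩
  · exact (contMDiff_iff_contDiff.1 χ.contMDiff).of_le (by exact_mod_cast le_top)
  · exact (eventually_nhdsSet_iff_forall.1 h0) x hx

/-- The cut-off acts on the first factor only, so the agreement near `K` holds for all times at once
although the time axis is not compact. -/
theorem exists_contDiff_extension_prod {W K : Set G} (hW : IsOpen W) (hK : IsCompact K)
    (hKW : K ⊆ W) {n : ℕ} {h : G × ℝ → F} (hh : ContDiffOn ℝ n h (W ×ˢ univ)) :
    ∃ k : G × ℝ → F, ContDiff ℝ n k ∧ ∀ᶠ x in 𝓝ˢ K, ∀ t, k (x, t) = h (x, t) := by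
  obtain ⟨χ, hχ, h1, h0⟩ := exists_contDiff_cutoff hW hK hKW
  refine ⟨fun w => χ w.1 • h w, ?_, ?_⟩
  · rw [contDiff_iff_contDiffAt]
    intro w
    by_cases hw : w.1 ∈ W
    · have hw' : W ×ˢ (univ : Set ℝ) ∈ 𝓝 w :=
        (hW.prod isOpen_univ).mem_nhds ⟨hw, mem_univ _⟩
      exact ((hχ n).contDiffAt.comp w contDiffAt_fst).smul (hh.contDiffAt hw')
    · have : (fun w : G × ℝ => χ w.1 • h w) =ᶠ[𝓝 w] fun _ => 0 := by
        filter_upwards [continuous_fst.continuousAt.eventually (h0 w.1 hw)] with v hv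
        rw [hv, zero_smul]
      exact contDiffAt_const.congr_of_eventuallyEq this
  · filter_upwards [h1] with x hx t
    rw [hx, one_smul]

theorem exists_contDiff_extension {W K : Set G} (hW : IsOpen W) (hK : IsCompact K)
    (hKW : K ⊆ W) {n : ℕ} {h : G → F} (hh : ContDiffOn ℝ n h W) :
    ∃ k : G → F, ContDiff ℝ n k ∧ ∀ᶠ x in 𝓝ˢ K, k x = h x := by
  obtain ⟨k, hk, hkh⟩ := exists_contDiff_extension_prod hW hK hKW (h := fun w : G × ℝ => h w.1)
    (hh.comp contDiffOn_fst fun w hw => hw.1)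
  refine ⟨fun x => k (x, 0), hk.comp (by fun_prop), ?_⟩
  filter_upwards [hkh] with x hx
  exact hx 0

end Cutoff

/-! ### Uniqueness, periodic extension and regularity of solutions -/

section Uniqueness

variable {E : Type*} [NormedAddCommGroup E] [NormedSpace ℝ E]

/-- `U` need not be convex, so the local field need not be Lipschitz. Its `C^1` extension from the
two compact trajectories is Lipschitz on a ball containing both. -/
theorem solution_unique [FiniteDimensional ℝ E] {U : Set E} (hU : IsOpen U) {F : E × ℝ → E}
    (hF : ContDiffOn ℝ 1 F (U ×ˢ univ)) {y₁ y₂ : ℝ → E}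
    (hU₁ : ∀ t ∈ Icc (0 : ℝ) 1, y₁ t ∈ U) (hU₂ : ∀ t ∈ Icc (0 : ℝ) 1, y₂ t ∈ U)
    (h₁ : ∀ t ∈ Icc (0 : ℝ) 1, HasDerivAt y₁ (F (y₁ t, t)) t)
    (h₂ : ∀ t ∈ Icc (0 : ℝ) 1, HasDerivAt y₂ (F (y₂ t, t)) t) (h0 : y₁ 0 = y₂ 0) :
    EqOn y₁ y₂ (Icc 0 1) := by
  have hc₁ : ContinuousOn y₁ (Icc 0 1) := fun t ht => (h₁ t ht).continuousAt.continuousWithinAt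
  have hc₂ : ContinuousOn y₂ (Icc 0 1) := fun t ht => (h₂ t ht).continuousAt.continuousWithinAt
  set K : Set E := y₁ '' Icc 0 1 ∪ y₂ '' Icc 0 1 with hKdef
  have hK : IsCompact K := (isCompact_Icc.image_of_continuousOn hc₁).union
    (isCompact_Icc.image_of_continuousOn hc₂)
  have hKU : K ⊆ U := by
    rintro x (⟨t, ht, rfl⟩ | ⟨t, ht, rfl⟩)
    exacts [hU₁ t ht, hU₂ t ht]
  obtain ⟨k, hk, hkF⟩ := exists_contDiff_extension_prod hU hK hKU (n := 1) (by exact_mod_cast hF)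
  have hk1 : ContDiff ℝ 1 k := by exact_mod_cast hk
  have hkF' : ∀ x ∈ K, ∀ t, k (x, t) = F (x, t) := fun x hx => hkF.self_of_nhdsSet x hx
  obtain ⟨ρ, hρ⟩ := hK.isBounded.subset_closedBall (0 : E)
  set B : Set (E × ℝ) := Metric.closedBall 0 ρ ×ˢ Icc 0 1 with hB
  have hBc : IsCompact B := (isCompact_closedBall 0 ρ).prod isCompact_Icc
  obtain ⟨C, hC⟩ := (hBc.image (hk1.continuous_fderiv one_ne_zero)).isBounded.exists_norm_le
  have hlip : LipschitzOnWith C.toNNReal k B := by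
    refine ((convex_closedBall 0 ρ).prod (convex_Icc 0 1)).lipschitzOnWith_of_nnnorm_fderiv_le
      (fun x _ => hk1.differentiable one_ne_zero x) fun x hx => ?_
    rw [← NNReal.coe_le_coe, coe_nnnorm]
    exact (hC _ (mem_image_of_mem _ hx)).trans (Real.le_coe_toNNReal C)
  refine ODE_solution_unique_of_mem_Icc_right (v := fun t x => k (x, t))
    (s := fun _ => Metric.closedBall 0 ρ) (K := C.toNNReal)
    (fun t ht => ?_) hc₁ (fun t ht => ?_) (fun t ht => ?_) hc₂ (fun t ht => ?_) (fun t ht => ?_) h0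
  · refine LipschitzOnWith.of_dist_le_mul fun x hx x' hx' => ?_
    have := hlip.dist_le_mul (x, t) ⟨hx, ht.1, ht.2.le⟩ (x', t) ⟨hx', ht.1, ht.2.le⟩
    rwa [Prod.dist_eq, dist_self, max_eq_left dist_nonneg] at this
  · have ht' : t ∈ Icc (0 : ℝ) 1 := ⟨ht.1, ht.2.le⟩
    rw [hkF' _ (Or.inl (mem_image_of_mem _ ht'))]
    exact (h₁ t ht').hasDerivWithinAt
  · exact hρ (Or.inl (mem_image_of_mem _ ⟨ht.1, ht.2.le⟩))
  · have ht' : t ∈ Icc (0 : ℝ) 1 := ⟨ht.1, ht.2.le⟩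
    rw [hkF' _ (Or.inr (mem_image_of_mem _ ht'))]
    exact (h₂ t ht').hasDerivWithinAt
  · exact hρ (Or.inr (mem_image_of_mem _ ⟨ht.1, ht.2.le⟩))

theorem linear_solution_unique {A : ℝ → E →L[ℝ] E} {K : ℝ} (hA : ∀ t, ‖A t‖ ≤ K) {y₁ y₂ : ℝ → E}
    (h₁ : ∀ t, HasDerivAt y₁ (A t (y₁ t)) t) (h₂ : ∀ t, HasDerivAt y₂ (A t (y₂ t)) t)
    {t₀ : ℝ} (h0 : y₁ t₀ = y₂ t₀) : y₁ = y₂ := by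
  refine ODE_solution_unique_univ (v := fun t x => A t x) (s := fun _ => univ) (K := K.toNNReal)
    (fun t => LipschitzWith.lipschitzOnWith ?_) (fun t => ⟨h₁ t, mem_univ _⟩)
    (fun t => ⟨h₂ t, mem_univ _⟩) h0
  refine (A t).lipschitz.weaken ?_
  rw [← NNReal.coe_le_coe, coe_nnnorm]
  exact (hA t).trans (Real.le_coe_toNNReal K)

/-- A solution of a `P`-periodic equation on `[0, P]` with equal end points extends periodically. -/
theorem exists_periodic_extension {F : E → ℝ → E} {P : ℝ} (hP : 0 < P) {y : ℝ → E}
    (hF : ∀ s ∈ Icc 0 P, Function.Periodic (F (y s)) P)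
    (hy : ∀ t ∈ Icc 0 P, HasDerivAt y (F (y t) t) t) (h0 : y P = y 0) :
    ∃ x : ℝ → E, x 0 = y 0 ∧ Function.Periodic x P ∧ (∀ t, HasDerivAt x (F (x t) t) t) ∧
      ∀ t, ∃ s ∈ Icc 0 P, x t = y s := by
  set x : ℝ → E := fun t => y (toIcoMod hP 0 t) with hx
  -- The two representatives modulo `P` differ only at multiples of `P`, where they are `0` and `P`
  -- and `y` takes equal values. The first gives the right derivative of `x`, the second the left
  -- one.
  have hx' : ∀ t, x t = y (toIocMod hP 0 t) := by
    intro t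
    by_cases h : toIcoMod hP 0 t = toIocMod hP 0 t
    · simp only [hx, h]
    · have h1 : t ≡ 0 [PMOD P] := by
        by_contra hc
        exact h ((AddCommGroup.not_modEq_iff_toIcoMod_eq_toIocMod hP).1 fun h => hc h.symm)
      have h2 : toIcoMod hP 0 t = 0 :=
        ((AddCommGroup.modEq_iff_toIcoMod_eq_left hP).1 h1.symm)
      have h3 : toIocMod hP 0 t = 0 + P :=
        ((AddCommGroup.modEq_iff_toIocMod_eq_right hP).1 h1.symm)
      simp only [hx, h2, h3, zero_add, h0]
  have hmem : ∀ t, toIcoMod hP 0 t ∈ Icc 0 P := fun t => by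
    have := toIcoMod_mem_Ico hP 0 t
    rw [zero_add] at this
    exact ⟨this.1, this.2.le⟩
  have hmem' : ∀ t, toIocMod hP 0 t ∈ Icc 0 P := fun t => by
    have := toIocMod_mem_Ioc hP 0 t
    rw [zero_add] at this
    exact ⟨this.1.le, this.2⟩
  refine ⟨x, by simp [hx], fun t => by simp [hx], fun t => ?_, fun t => ⟨_, hmem t, rfl⟩⟩
  have hshift : ∀ (k : ℤ), t - k * P ∈ Icc 0 P → x t = y (t - k * P) →
      HasDerivAt (fun u => y (u - k * P)) (F (x t) t) t := by
    intro k hk hxk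
    have h1 : F (x t) t = F (y (t - k * P)) (t - k * P) := by
      rw [hxk, (hF _ hk).sub_int_mul_eq]
    rw [h1]
    exact (hy _ hk).comp_sub_const t (k * P)
  have hIci : HasDerivWithinAt x (F (x t) t) (Ici t) t := by
    set k := toIcoDiv hP 0 t with hk
    have hkt : toIcoMod hP 0 t = t - k * P := by rw [toIcoMod, hk, zsmul_eq_mul]
    have h1 : HasDerivAt (fun u => y (u - k * P)) (F (x t) t) t :=
      hshift k (hkt ▸ hmem t) (by rw [← hkt])
    refine h1.hasDerivWithinAt.congr_of_eventuallyEq ?_ (by rw [← hkt])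
    have hlt : t < P + k * P := by
      have := (toIcoMod_mem_Ico hP 0 t).2
      rw [hkt] at this; linarith
    filter_upwards [self_mem_nhdsWithin, mem_nhdsWithin_of_mem_nhds (Iio_mem_nhds hlt)]
      with u hu1 hu2
    have h0t := (hkt ▸ hmem t : t - k * P ∈ Icc 0 P).1
    have : toIcoMod hP 0 u = u - k • P := by
      rw [toIcoMod, (toIcoDiv_eq_of_sub_zsmul_mem_Ico hP (a := 0) (b := u) (n := k) ?_)]
      simp only [zsmul_eq_mul, mem_Ico, zero_add]
      simp only [mem_Ici, mem_Iio] at hu1 hu2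
      constructor <;> linarith
    simp only [hx, this, zsmul_eq_mul]
  have hIic : HasDerivWithinAt x (F (x t) t) (Iic t) t := by
    set k := toIocDiv hP 0 t with hk
    have hkt : toIocMod hP 0 t = t - k * P := by rw [toIocMod, hk, zsmul_eq_mul]
    have hxt : x t = y (t - k * P) := by rw [hx' t, hkt]
    have h1 : HasDerivAt (fun u => y (u - k * P)) (F (x t) t) t :=
      hshift k (hkt ▸ hmem' t) hxt
    refine h1.hasDerivWithinAt.congr_of_eventuallyEq ?_ hxt
    have hlt : k * P < t := by
      have := (toIocMod_mem_Ioc hP 0 t).1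
      rw [hkt] at this; linarith
    filter_upwards [self_mem_nhdsWithin, mem_nhdsWithin_of_mem_nhds (Ioi_mem_nhds hlt)]
      with u hu1 hu2
    have h0t := (hkt ▸ hmem' t : t - k * P ∈ Icc 0 P).2
    have : toIocMod hP 0 u = u - k • P := by
      rw [toIocMod, (toIocDiv_eq_of_sub_zsmul_mem_Ioc hP (a := 0) (b := u) (n := k) ?_)]
      simp only [zsmul_eq_mul, mem_Ioc, zero_add]
      simp only [mem_Iic, mem_Ioi] at hu1 hu2
      constructor <;> linarith
    rw [hx' u, this, zsmul_eq_mul]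
  have := hIic.union hIci
  rwa [Iic_union_Ici, hasDerivWithinAt_univ] at this

/-- Bootstrapping `ż = f ∘ z` one order at a time gains a derivative over `f`. -/
theorem contDiff_solution {n : ℕ} {f : E → E} (hf : ContDiff ℝ n f) {z : ℝ → E}
    (hz : ∀ t, HasDerivAt z (f (z t)) t) : ContDiff ℝ (n + 1 : ℕ) z := by
  have hd : deriv z = f ∘ z := funext fun t => (hz t).deriv
  have hdiff : Differentiable ℝ z := fun t => (hz t).differentiableAt
  have key : ∀ k : ℕ, k ≤ n + 1 → ContDiff ℝ k z := by
    intro k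
    induction k with
    | zero => exact fun _ => contDiff_zero.2 hdiff.continuous
    | succ k ih =>
      intro hk
      have : ContDiff ℝ ((k : WithTop ℕ∞) + 1) z := by
        rw [contDiff_succ_iff_deriv]
        refine ⟨hdiff, by simp, ?_⟩
        rw [hd]
        exact (hf.of_le (by exact_mod_cast (by omega : k ≤ n))).comp (ih (by omega))
      exact_mod_cast this
  exact key _ le_rfl

end Uniqueness
end Resonance

/-! ### The first integral along the conservative orbit and the Melnikov function -/

namespace Resonance

open Filter Topology

variable {E : Type*} [NormedAddCommGroup E] [NormedSpace ℝ E]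

/-- A periodic orbit in an open set `O` on which `H` is a first integral of the globally defined
vector field `f`. -/
structure ConservativeOrbit (O : Set E) (f : E → E) (H : E → ℝ) (z : ℝ → E) (τ : ℝ) : Prop where
  isOpen : IsOpen O
  contDiff_f : ContDiff ℝ 2 f
  contDiff_H : ContDiff ℝ 1 H
  integral : ∀ x ∈ O, fderiv ℝ H x (f x) = 0
  mem : ∀ t, z t ∈ O
  ode : ∀ t, HasDerivAt z (f (z t)) t
  pos : 0 < τ
  periodic : Function.Periodic z τ

namespace ConservativeOrbit

variable {O : Set E} {f : E → E} {H : E → ℝ} {z : ℝ → E} {τ : ℝ}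

theorem continuous (h : ConservativeOrbit O f H z τ) : Continuous z :=
  continuous_iff_continuousAt.2 fun t => (h.ode t).continuousAt

theorem continuous_fderiv_f (h : ConservativeOrbit O f H z τ) : Continuous (fderiv ℝ f) :=
  h.contDiff_f.continuous_fderiv two_ne_zero

theorem continuous_fderiv_H (h : ConservativeOrbit O f H z τ) : Continuous (fderiv ℝ H) :=
  h.contDiff_H.continuous_fderiv one_ne_zero

theorem isCompact_range (h : ConservativeOrbit O f H z τ) : IsCompact (range z) := by
  rw [← h.periodic.image_uIcc h.pos.ne' 0]
  exact isCompact_uIcc.image h.continuous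

theorem hasDerivAt_comp_affine (h : ConservativeOrbit O f H z τ) (a c θ : ℝ) :
    HasDerivAt (fun θ => z (a + c * θ)) (c • f (z (a + c * θ))) θ := by
  have h1 : HasDerivAt (fun θ : ℝ => a + c * θ) c θ := by
    simpa using ((hasDerivAt_id θ).const_mul c).const_add a
  exact (h.ode _).scomp θ h1

end ConservativeOrbit

/-- Continuity of `J` at `0` is enough, because the slope of `ε J(ε)` at `0` is `J(ε)` itself. -/
theorem hasDerivAt_smul_zero {J : ℝ → ℝ} (hJ : ContinuousAt J 0) :
    HasDerivAt (fun ε => ε * J ε) (J 0) 0 := by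
  rw [hasDerivAt_iff_tendsto_slope]
  refine (hJ.tendsto.mono_left nhdsWithin_le_nhds).congr' ?_
  filter_upwards [self_mem_nhdsWithin] with ε hε
  have : ε ≠ 0 := hε
  simp [slope, this]

/-- Points of a compact curve in an open set can be uniformly moved along a bounded direction. -/
theorem eventually_forall_add_smul_mem {O : Set E} (hO : IsOpen O) {x y : ℝ → E}
    (hx : Continuous x) (hy : Continuous y) (hxO : ∀ t, x t ∈ O) :
    ∀ᶠ ε in 𝓝 (0 : ℝ), ∀ θ ∈ Icc (0 : ℝ) 1, x θ + ε • y θ ∈ O := by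
  refine isCompact_Icc.eventually_forall_of_forall_eventually fun θ _ => ?_
  have : Continuous fun w : ℝ × ℝ => x w.2 + w.1 • y w.2 := by fun_prop
  exact this.continuousAt.eventually (hO.mem_nhds (by simpa using hxO θ))

namespace ConservativeOrbit

universe u

variable {E : Type u} [NormedAddCommGroup E] [NormedSpace ℝ E] [CompleteSpace E]
variable {O : Set E} {f : E → E} {H : E → ℝ} {z : ℝ → E} {τ : ℝ}

/-- The gradient of the first integral along the orbit solves the adjoint variational equation, in
integrated form. -/
theorem fderiv_sub_eq_integral_of_continuous (h : ConservativeOrbit O f H z τ) (a c : ℝ)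
    {y y' : ℝ → E} (hyc : Continuous y) (hyc' : Continuous y')
    (hy : ∀ θ ∈ Ioo (0 : ℝ) 1, HasDerivAt y (y' θ) θ) :
    fderiv ℝ H (z (a + c)) (y 1) - fderiv ℝ H (z a) (y 0) =
      ∫ θ in (0 : ℝ)..1, fderiv ℝ H (z (a + c * θ))
        (y' θ - c • fderiv ℝ f (z (a + c * θ)) (y θ)) := by
  set x : ℝ → E := fun θ => z (a + c * θ) with hx
  have hzc := h.continuous
  have hxc : Continuous x := by fun_prop
  have hQ : Continuous (hadamardQuotient f) :=
    (contDiff_hadamardQuotient (n := 1) (by exact_mod_cast h.contDiff_f)).continuous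
  have hH := h.continuous_fderiv_H
  set J : ℝ → ℝ := fun ε => ∫ θ in (0 : ℝ)..1,
    fderiv ℝ H (x θ + ε • y θ) (y' θ - c • hadamardQuotient f (x θ, y θ, ε)) with hJ
  have hJc : Continuous J := by
    refine intervalIntegral.continuous_parametric_intervalIntegral_of_continuous ?_
      continuous_const
    simp only [Function.uncurry_def]
    fun_prop
  have hfd : Differentiable ℝ H := h.contDiff_H.differentiable one_ne_zero
  have hev : (fun ε => H (x 1 + ε • y 1) - H (x 0 + ε • y 0)) =ᶠ[𝓝 0] fun ε => ε * J ε := by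
    filter_upwards [eventually_forall_add_smul_mem h.isOpen hxc hyc (fun θ => h.mem _)] with ε hε
    have hint : ContinuousOn (fun θ => H (x θ + ε • y θ)) (Icc 0 1) :=
      (hfd.continuous.comp (by fun_prop : Continuous fun θ => x θ + ε • y θ)).continuousOn
    have hcont : Continuous fun θ => ε *
        fderiv ℝ H (x θ + ε • y θ) (y' θ - c • hadamardQuotient f (x θ, y θ, ε)) := by fun_prop
    rw [← intervalIntegral.integral_eq_sub_of_hasDerivAt_of_le zero_le_one hint (fun θ hθ => ?_)
      (hcont.intervalIntegrable _ _), intervalIntegral.integral_const_mul]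
    have h1 : HasDerivAt (fun θ => x θ + ε • y θ) (c • f (x θ) + ε • y' θ) θ :=
      (h.hasDerivAt_comp_affine a c θ).add ((hy θ hθ).const_smul ε)
    have h2 := (hfd (x θ + ε • y θ)).hasFDerivAt.comp_hasDerivAt θ h1
    -- `H` is only `C^1`, so `DH` cannot be differentiated along the orbit. Instead `H` is followed
    -- along the shifted curve `x + ε y`: the part of the velocity parallel to `f (x + ε y)` does
    -- not change `H`, the rest has a factor `ε`, and the result is differentiated in `ε` at `0`.
    have h3 : c • f (x θ) + ε • y' θ = c • f (x θ + ε • y θ) +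
        ε • (y' θ - c • hadamardQuotient f (x θ, y θ, ε)) := by
      rw [hadamardQuotient_spec (h.contDiff_f.of_le one_le_two), smul_add, smul_sub,
        smul_comm c ε]
      abel
    rw [h3, map_add, map_smul, map_smul, h.integral _ (hε θ ⟨hθ.1.le, hθ.2.le⟩), smul_zero,
      zero_add] at h2
    exact h2
  have hd1 : HasDerivAt (fun ε : ℝ => H (x 1 + ε • y 1) - H (x 0 + ε • y 0))
      (fderiv ℝ H (x 1) (y 1) - fderiv ℝ H (x 0) (y 0)) 0 := by
    have aux : ∀ p v : E, HasDerivAt (fun ε : ℝ => H (p + ε • v)) (fderiv ℝ H p v) 0 := by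
      intro p v
      have h1 : HasDerivAt (fun ε : ℝ => p + ε • v) v 0 := by
        simpa using ((hasDerivAt_id (0 : ℝ)).smul_const v).const_add p
      have h2 : HasFDerivAt H (fderiv ℝ H p) (p + (0 : ℝ) • v) := by
        simpa using (hfd p).hasFDerivAt
      exact h2.comp_hasDerivAt 0 h1
    exact (aux _ _).sub (aux _ _)
  have hd2 : HasDerivAt (fun ε : ℝ => H (x 1 + ε • y 1) - H (x 0 + ε • y 0)) (J 0) 0 :=
    (hasDerivAt_smul_zero hJc.continuousAt).congr_of_eventuallyEq hev
  have := hd1.unique hd2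
  simp only [hx, mul_one, mul_zero, add_zero] at this
  rw [this, hJ]
  simp [hadamardQuotient_zero, hx]

/-- Extending `y` and `y'` by constants makes them continuous on `ℝ` but may destroy
differentiability at the end points. The preceding version therefore requires derivatives on the
open interval only. -/
theorem fderiv_sub_eq_integral (h : ConservativeOrbit O f H z τ) (a c : ℝ)
    {y y' : ℝ → E} (hyc' : ContinuousOn y' (Icc 0 1))
    (hy : ∀ θ ∈ Icc (0 : ℝ) 1, HasDerivAt y (y' θ) θ) :
    fderiv ℝ H (z (a + c)) (y 1) - fderiv ℝ H (z a) (y 0) =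
      ∫ θ in (0 : ℝ)..1, fderiv ℝ H (z (a + c * θ))
        (y' θ - c • fderiv ℝ f (z (a + c * θ)) (y θ)) := by
  have hyc : ContinuousOn y (Icc 0 1) := fun t ht => (hy t ht).continuousAt.continuousWithinAt
  set Y : ℝ → E := IccExtend zero_le_one (Set.domRestrict (Icc 0 1) y) with hY
  set Y' : ℝ → E := IccExtend zero_le_one (Set.domRestrict (Icc 0 1) y') with hY'
  have e1 : ∀ θ ∈ Icc (0 : ℝ) 1, Y θ = y θ := fun θ hθ => IccExtend_of_mem _ _ hθ
  have e2 : ∀ θ ∈ Icc (0 : ℝ) 1, Y' θ = y' θ := fun θ hθ => IccExtend_of_mem _ _ hθ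
  have := h.fderiv_sub_eq_integral_of_continuous a c (y := Y) (y' := Y')
    (continuousOn_iff_continuous_domRestrict.1 hyc).Icc_extend'
    (continuousOn_iff_continuous_domRestrict.1 hyc').Icc_extend' (fun θ hθ => by
      rw [e2 θ ⟨hθ.1.le, hθ.2.le⟩]
      refine (hy θ ⟨hθ.1.le, hθ.2.le⟩).congr_of_eventuallyEq ?_
      filter_upwards [Ioo_mem_nhds hθ.1 hθ.2] with s hs
      exact e1 s ⟨hs.1.le, hs.2.le⟩)
  rw [e1 1 (by simp), e1 0 (by simp)] at this
  rw [this]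
  refine intervalIntegral.integral_congr fun θ hθ => ?_
  rw [uIcc_of_le zero_le_one] at hθ
  simp only [e1 θ hθ, e2 θ hθ]

end ConservativeOrbit

section Melnikov

variable {O : Set E} {f : E → E} {H : E → ℝ} {z : ℝ → E} {τ : ℝ}

/-- A perturbation with uncurried arguments, as a function of state, time, period and `ε`. -/
abbrev curried (g : (E × ℝ × ℝ) × ℝ → E) (x : E) (t T ε : ℝ) : E := g ((x, T, ε), t)

theorem continuous_melnikov (h : ConservativeOrbit O f H z τ) {g : (E × ℝ × ℝ) × ℝ → E}
    (hg : Continuous g) (m l : ℕ) : Continuous (melnikov H (curried g) z τ m l) := by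
  have := h.continuous_fderiv_H
  have := h.continuous
  refine intervalIntegral.continuous_parametric_intervalIntegral_of_continuous ?_ continuous_const
  simp only [Function.uncurry_def]
  fun_prop

theorem periodic_melnikov {g : E → ℝ → ℝ → ℝ → E} (hz : Function.Periodic z τ) (m l : ℕ) :
    Function.Periodic (melnikov H g z τ m l) τ := by
  intro s
  simp only [melnikov, ← add_assoc, hz _]

theorem melnikov_eq_integral_unit {g : E → ℝ → ℝ → ℝ → E} (m l : ℕ) (a : ℝ) :
    melnikov H g z τ m l a = ∫ θ in (0 : ℝ)..1, (m * τ) *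
      fderiv ℝ H (z (a + m * τ * θ)) (g (z (a + m * τ * θ)) (m * τ * θ) (m * τ / l) 0) := by
  have := intervalIntegral.mul_integral_comp_mul_left (a := 0) (b := 1) (c := m * τ)
    (f := fun t => fderiv ℝ H (z (t + a)) (g (z (t + a)) t (m * τ / l) 0))
  rw [mul_zero, mul_one] at this
  rw [melnikov, ← this, ← intervalIntegral.integral_const_mul]
  simp only [add_comm a]

end Melnikov
end Resonance

namespace Resonance

open Filter Topology

/-! ### Linear algebra of the linearised period map -/

section LinearAlgebra

variable {E : Type*} [NormedAddCommGroup E] [NormedSpace ℝ E]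

/-- The linearised period map, as a function of the initial condition and of the period. -/
noncomputable def periodDefect (A : E →L[ℝ] E) (p : E) (c : ℝ) : E × ℝ →L[ℝ] E :=
  (A - 1) ∘L ContinuousLinearMap.fst ℝ E ℝ +
    (c • ContinuousLinearMap.snd ℝ E ℝ).smulRight p

theorem periodDefect_apply (A : E →L[ℝ] E) (p : E) (c : ℝ) (w : E × ℝ) :
    periodDefect A p c w = A w.1 - w.1 + (c * w.2) • p := by
  simp [periodDefect]

variable [FiniteDimensional ℝ E]

theorem finrank_le_of_fst_mem {N : Submodule ℝ E} {S : Submodule ℝ (E × ℝ)}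
    (h : ∀ w ∈ S, w.2 = 0 → w.1 ∈ N) : Module.finrank ℝ S ≤ Module.finrank ℝ N + 1 := by
  set φ : S →ₗ[ℝ] ℝ := (LinearMap.snd ℝ E ℝ).domRestrict S with hφ
  have h1 := φ.finrank_range_add_finrank_ker
  have h2 : Module.finrank ℝ (LinearMap.range φ) ≤ 1 := by
    simpa using (LinearMap.range φ).finrank_le
  have h3 : Module.finrank ℝ (LinearMap.ker φ) ≤ Module.finrank ℝ N := by
    refine LinearMap.finrank_le_finrank_of_injective
      (f := ((LinearMap.fst ℝ E ℝ ∘ₗ S.subtype).restrict (p := LinearMap.ker φ) (q := N)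
        fun w hw => h w.1 w.2 hw)) ?_
    rintro ⟨⟨⟨a, b⟩, h1⟩, h2⟩ ⟨⟨⟨c, d⟩, h3⟩, h4⟩ heq
    have hb : b = 0 := h2
    have hd : d = 0 := h4
    have hac : a = c := congrArg Subtype.val heq
    subst hb hd hac
    rfl
  omega

theorem finrank_le_of_snd_eq_zero {N : Submodule ℝ E} {S : Submodule ℝ (E × ℝ)}
    (h : ∀ w ∈ S, w.2 = 0 ∧ w.1 ∈ N) : Module.finrank ℝ S ≤ Module.finrank ℝ N := by
  refine LinearMap.finrank_le_finrank_of_injective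
    (f := (LinearMap.fst ℝ E ℝ).restrict (p := S) (q := N) fun w hw => (h w hw).2) ?_
  rintro ⟨⟨a, b⟩, h1⟩ ⟨⟨c, d⟩, h2⟩ heq
  have hb : b = 0 := (h _ h1).1
  have hd : d = 0 := (h _ h2).1
  have hac : a = c := congrArg Subtype.val heq
  subst hb hd hac
  rfl

/-- A kernel vector with nonzero period component exhibits `p` in the range of `A - 1`. In the
second case of normality the kernel thus lies in the eigenspace; in the first, the period component
adds at most one dimension to a line. -/
theorem finrank_ker_periodDefect_le (A : E →L[ℝ] E) (p : E) {c : ℝ} (hc : c ≠ 0)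
    (h : Module.finrank ℝ (Module.End.eigenspace (A : Module.End ℝ E) 1) = 1 ∨
      (Module.finrank ℝ (Module.End.eigenspace (A : Module.End ℝ E) 1) = 2 ∧
        ¬ ∃ v : E, A v - v = p)) :
    Module.finrank ℝ (LinearMap.ker (periodDefect A p c : E × ℝ →ₗ[ℝ] E)) ≤ 2 := by
  have hmem : ∀ w ∈ LinearMap.ker (periodDefect A p c : E × ℝ →ₗ[ℝ] E), w.2 = 0 →
      w.1 ∈ Module.End.eigenspace (A : Module.End ℝ E) 1 := by
    intro w hw hw2
    have h1 : periodDefect A p c w = 0 := hw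
    rw [periodDefect_apply, hw2, mul_zero, zero_smul, add_zero, sub_eq_zero] at h1
    rw [Module.End.mem_eigenspace_iff, one_smul]
    exact h1
  rcases h with h | ⟨h, hp⟩
  · exact (finrank_le_of_fst_mem hmem).trans (by omega)
  · refine (finrank_le_of_snd_eq_zero fun w hw => ?_).trans h.le
    suffices hw2 : w.2 = 0 from ⟨hw2, hmem w hw hw2⟩
    by_contra hne
    have h1 : periodDefect A p c w = 0 := hw
    rw [periodDefect_apply] at h1
    refine hp ⟨(-(c * w.2)⁻¹) • w.1, ?_⟩
    have h2 : A w.1 - w.1 = -((c * w.2) • p) := eq_neg_of_add_eq_zero_left h1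
    rw [map_smul, ← smul_sub, h2, neg_smul, smul_neg, neg_neg, smul_smul,
      inv_mul_cancel₀ (mul_ne_zero hc hne), one_smul]

/-- The values on `u` and `k` are triangular, so `(κ, ρ)` maps the kernel of `D` onto `ℝ²`. As the
kernel has dimension at most two, the map is also injective there. -/
theorem eq_zero_of_finrank_ker_le_two {D : E × ℝ →L[ℝ] E}
    (hD : Module.finrank ℝ (LinearMap.ker (D : E × ℝ →ₗ[ℝ] E)) ≤ 2) {κ ρ : E × ℝ →L[ℝ] ℝ}
    {u k : E × ℝ} (hu : D u = 0) (hk : D k = 0) (hκu : κ u = 0) (hκk : κ k ≠ 0) (hρu : ρ u ≠ 0)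
    {w : E × ℝ} (hw : D w = 0) (hκw : κ w = 0) (hρw : ρ w = 0) : w = 0 := by
  set S := LinearMap.ker (D : E × ℝ →ₗ[ℝ] E) with hS
  set φ : S →ₗ[ℝ] ℝ × ℝ := ((κ : E × ℝ →ₗ[ℝ] ℝ).prod (ρ : E × ℝ →ₗ[ℝ] ℝ)).domRestrict S with hφ
  have hsurj : Function.Surjective φ := by
    rintro ⟨a, b⟩
    have hmem : D ((a / κ k) • k + ((b - a / κ k * ρ k) / ρ u) • u) = 0 := by simp [hu, hk]
    refine ⟨⟨_, hmem⟩, ?_⟩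
    have hval : ((κ ((a / κ k) • k + ((b - a / κ k * ρ k) / ρ u) • u),
        ρ ((a / κ k) • k + ((b - a / κ k * ρ k) / ρ u) • u)) : ℝ × ℝ) = (a, b) := by
      simp only [map_add, map_smul, hκu, smul_eq_mul, mul_zero, add_zero]
      ext <;> simp only <;> field_simp
      ring
    exact hval
  have hle := LinearMap.finrank_range_add_finrank_ker φ
  rw [LinearMap.range_eq_top.2 hsurj, finrank_top, Module.finrank_prod, Module.finrank_self] at hle
  have hker : Module.finrank ℝ (LinearMap.ker φ) = 0 := by omega
  have hbot : LinearMap.ker φ = ⊥ := Submodule.finrank_eq_zero.1 hker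
  have : (⟨w, hw⟩ : S) ∈ LinearMap.ker φ := by
    change (κ w, ρ w) = 0
    rw [hκw, hρw]; rfl
  rw [hbot, Submodule.mem_bot] at this
  exact congrArg Subtype.val this

/-- `(D, κ, ρ)` maps into `ker h × ℝ²`, which has the same dimension as `E × ℝ`. Injectivity
therefore gives surjectivity. -/
theorem exists_of_injective {D : E × ℝ →L[ℝ] E} {κ ρ : E × ℝ →L[ℝ] ℝ} {h : E →L[ℝ] ℝ} (hh : h ≠ 0)
    (hhD : ∀ w, h (D w) = 0) (hinj : ∀ w, D w = 0 → κ w = 0 → ρ w = 0 → w = 0) {e : E}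
    (he : h e = 0) : ∃ w, D w = e ∧ κ w = 0 ∧ ρ w = 0 := by
  set N := LinearMap.ker (h : E →ₗ[ℝ] ℝ) with hN
  set φ : E × ℝ →ₗ[ℝ] N × ℝ × ℝ :=
    ((D : E × ℝ →ₗ[ℝ] E).codRestrict N hhD).prod
      ((κ : E × ℝ →ₗ[ℝ] ℝ).prod (ρ : E × ℝ →ₗ[ℝ] ℝ)) with hφ
  have hφi : Function.Injective φ := by
    rw [injective_iff_map_eq_zero]
    intro w hw
    have h1 : D w = 0 := congrArg (fun x : N × ℝ × ℝ => (x.1 : E)) hw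
    have h2 : κ w = 0 := congrArg (fun x : N × ℝ × ℝ => x.2.1) hw
    have h3 : ρ w = 0 := congrArg (fun x : N × ℝ × ℝ => x.2.2) hw
    exact hinj w h1 h2 h3
  have hdim : Module.finrank ℝ (E × ℝ) = Module.finrank ℝ (N × ℝ × ℝ) := by
    have h1 := LinearMap.finrank_range_add_finrank_ker (h : E →ₗ[ℝ] ℝ)
    have h2 : LinearMap.range (h : E →ₗ[ℝ] ℝ) = ⊤ :=
      LinearMap.range_eq_top.2 (LinearMap.surjective fun hz => hh (by
        ext x; exact congrArg (fun L : E →ₗ[ℝ] ℝ => L x) hz))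
    rw [h2, finrank_top, Module.finrank_self, ← hN] at h1
    simp only [Module.finrank_prod, Module.finrank_self]
    omega
  obtain ⟨w, hw⟩ := (LinearMap.injective_iff_surjective_of_finrank_eq_finrank hdim).1 hφi
    (⟨e, he⟩, 0, 0)
  exact ⟨w, congrArg (fun x : N × ℝ × ℝ => (x.1 : E)) hw,
    congrArg (fun x : N × ℝ × ℝ => x.2.1) hw, congrArg (fun x : N × ℝ × ℝ => x.2.2) hw⟩

/-- The kernel of an operator onto at most a hyperplane contains a vector which is independent of
a given one. -/
theorem exists_ker_independent {D : E × ℝ →L[ℝ] E} {h : E →L[ℝ] ℝ} (hh : h ≠ 0)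
    (hhD : ∀ w, h (D w) = 0) (u : E × ℝ) :
    ∃ (k : E × ℝ) (κ : E × ℝ →L[ℝ] ℝ), D k = 0 ∧ κ u = 0 ∧ κ k = 1 := by
  have hex : ∃ k, D k = 0 ∧ k ∉ Submodule.span ℝ {u} := by
    by_contra! hcon
    have h1 := LinearMap.finrank_range_add_finrank_ker (D : E × ℝ →ₗ[ℝ] E)
    have h2 : Module.finrank ℝ (LinearMap.ker (D : E × ℝ →ₗ[ℝ] E)) ≤ 1 :=
      (Submodule.finrank_mono (fun k hk => hcon k hk)).trans ((finrank_span_le_card {u}).trans (by simp))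
    have h3 : LinearMap.range (D : E × ℝ →ₗ[ℝ] E) ≠ ⊤ := by
      intro htop
      refine hh (ContinuousLinearMap.ext fun x => ?_)
      obtain ⟨w, hw⟩ := LinearMap.range_eq_top.1 htop x
      rw [← hw]
      exact hhD w
    have h4 := Submodule.finrank_lt h3
    rw [Module.finrank_prod, Module.finrank_self] at h1
    omega
  obtain ⟨k, hk, hku⟩ := hex
  obtain ⟨φ, hφk, hφ⟩ := Submodule.exists_le_ker_of_notMem hku
  refine ⟨k, LinearMap.toContinuousLinearMap ((φ k)⁻¹ • φ), hk, ?_, ?_⟩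
  · have : φ u = 0 := hφ (Submodule.mem_span_singleton_self u)
    simp [this]
  · simp [hφk]

end LinearAlgebra

/-! ### The equation of variations along the orbit -/

section Variational

universe u

variable {E : Type u} [NormedAddCommGroup E] [NormedSpace ℝ E]
variable {O : Set E} {f : E → E} {H : E → ℝ} {z : ℝ → E} {τ : ℝ} {Y : ℝ → E →L[ℝ] E}

theorem IsVariationalSolution.hasDerivAt_apply (hY : IsVariationalSolution f z Y) (v : E) (t : ℝ) :
    HasDerivAt (fun t => Y t v) (fderiv ℝ f (z t) (Y t v)) t := by
  have := (hY.ode t).clm_apply (hasDerivAt_const t v)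
  simpa using this

namespace ConservativeOrbit

theorem exists_norm_fderiv_le (h : ConservativeOrbit O f H z τ) :
    ∃ K, ∀ t, ‖fderiv ℝ f (z t)‖ ≤ K := by
  obtain ⟨K, hK⟩ := (h.isCompact_range.image h.continuous_fderiv_f).isBounded.exists_norm_le
  exact ⟨K, fun t => hK _ (mem_image_of_mem _ (mem_range_self t))⟩

theorem variational_unique (h : ConservativeOrbit O f H z τ) {y₁ y₂ : ℝ → E}
    (h₁ : ∀ t, HasDerivAt y₁ (fderiv ℝ f (z t) (y₁ t)) t)
    (h₂ : ∀ t, HasDerivAt y₂ (fderiv ℝ f (z t) (y₂ t)) t) {t₀ : ℝ} (h0 : y₁ t₀ = y₂ t₀) :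
    y₁ = y₂ := by
  obtain ⟨K, hK⟩ := h.exists_norm_fderiv_le
  exact linear_solution_unique hK h₁ h₂ h0

theorem variational_injective (h : ConservativeOrbit O f H z τ)
    (hY : IsVariationalSolution f z Y) (t : ℝ) : Function.Injective (Y t) := by
  rw [injective_iff_map_eq_zero]
  intro v hv
  have := h.variational_unique (y₁ := fun t => Y t v) (y₂ := fun _ => 0) (t₀ := t)
    (fun t => hY.hasDerivAt_apply v t) (fun t => by simpa using hasDerivAt_const t (0 : E)) hv
  have h0 := congrFun this 0
  simpa [hY.init] using h0

theorem variational_apply_velocity (h : ConservativeOrbit O f H z τ)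
    (hY : IsVariationalSolution f z Y) (t : ℝ) : Y t (f (z 0)) = f (z t) := by
  refine congrFun (h.variational_unique (y₁ := fun t => Y t (f (z 0))) (y₂ := fun t => f (z t))
    (t₀ := 0) (fun t => hY.hasDerivAt_apply _ t) (fun t => ?_) (by simp [hY.init])) t
  exact ((h.contDiff_f.differentiable two_ne_zero (z t)).hasFDerivAt).comp_hasDerivAt t (h.ode t)

theorem variational_add_period (h : ConservativeOrbit O f H z τ)
    (hY : IsVariationalSolution f z Y) (m : ℕ) (t : ℝ) (v : E) :
    Y (t + m * τ) v = Y t ((Y τ ^ m) v) := by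
  have step : ∀ t v, Y (t + τ) v = Y t (Y τ v) := by
    intro t v
    refine congrFun (h.variational_unique (y₁ := fun t => Y (t + τ) v)
      (y₂ := fun t => Y t (Y τ v)) (t₀ := 0) (fun t => ?_) (fun t => hY.hasDerivAt_apply _ t)
      (by simp [hY.init])) t
    have := (hY.hasDerivAt_apply v (t + τ)).comp_add_const t τ
    rwa [h.periodic t] at this
  induction m generalizing t v with
  | zero => simp
  | succ m ih =>
    have : t + (m + 1 : ℕ) * τ = (t + m * τ) + τ := by push_cast; ring
    rw [this, step, ih, pow_succ]
    rfl

/-- For a curve solving the equation of variations the integrand of `fderiv_sub_eq_integral`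
vanishes: `DH` is conserved by the linearised flow. -/
theorem fderiv_variational [CompleteSpace E] (h : ConservativeOrbit O f H z τ)
    (hY : IsVariationalSolution f z Y) (t : ℝ) (v : E) :
    fderiv ℝ H (z t) (Y t v) = fderiv ℝ H (z 0) v := by
  have hd : ∀ θ, HasDerivAt (fun θ => Y (t * θ) v) (t • fderiv ℝ f (z (t * θ)) (Y (t * θ) v)) θ := by
    intro θ
    have h1 : HasDerivAt (fun θ : ℝ => t * θ) t θ := by
      simpa using (hasDerivAt_id θ).const_mul t
    exact (hY.hasDerivAt_apply v (t * θ)).scomp θ h1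
  have hYc : Continuous fun θ => Y (t * θ) v :=
    continuous_iff_continuousAt.2 fun θ => (hd θ).continuousAt
  have hc : Continuous fun θ => t • fderiv ℝ f (z (t * θ)) (Y (t * θ) v) :=
    ((h.continuous_fderiv_f.comp (h.continuous.comp (continuous_const_mul t))).clm_apply
      hYc).const_smul t
  have := h.fderiv_sub_eq_integral 0 t hc.continuousOn fun θ _ => hd θ
  simp only [zero_add, mul_one, mul_zero, hY.init, ContinuousLinearMap.id_apply, sub_self, map_zero,
    intervalIntegral.integral_zero] at this
  exact sub_eq_zero.1 this

end ConservativeOrbit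
end Variational
end Resonance

/-! ### Deviations from the orbit, divided by `ε` -/

namespace Resonance

open Filter Topology

theorem isInvertible_of_injective {X : Type*} [NormedAddCommGroup X] [NormedSpace ℝ X]
    [FiniteDimensional ℝ X] {L : X →L[ℝ] X} (hL : ∀ x, L x = 0 → x = 0) : L.IsInvertible := by
  have hinj : Function.Injective (L : X →ₗ[ℝ] X) := (injective_iff_map_eq_zero _).2 hL
  refine ⟨(LinearEquiv.ofInjectiveEndo (L : X →ₗ[ℝ] X) hinj).toContinuousLinearEquiv, ?_⟩
  ext x
  rfl

/-- The product rule needs only continuity of `A` when the other factor vanishes at the point. It is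
applied to `DH` along the orbit, which is merely continuous. -/
theorem hasDerivAt_clm_apply_of_eq_zero {E : Type*} [NormedAddCommGroup E] [NormedSpace ℝ E]
    {A : ℝ → E →L[ℝ] ℝ} {e : ℝ → E} {e' : E} {a : ℝ} (hA : ContinuousAt A a)
    (he : HasDerivAt e e' a) (h0 : e a = 0) : HasDerivAt (fun t => A t (e t)) (A a e') a := by
  rw [hasDerivAt_iff_tendsto_slope] at he ⊢
  have h1 : Tendsto (fun t => A t (slope e a t)) (𝓝[≠] a) (𝓝 (A a e')) :=
    (isBoundedBilinearMap_apply.continuous.tendsto (A a, e')).comp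
      ((hA.tendsto.mono_left nhdsWithin_le_nhds).prodMk_nhds he)
  refine h1.congr fun t => ?_
  simp [slope, h0]

universe u

variable {E : Type u} [NormedAddCommGroup E] [NormedSpace ℝ E]

/-- The vector field of the perturbed system in rescaled time, for the deviation `y` from the
unperturbed orbit with phase `a`, divided by `ε`. The parameters are `(T₁, a, ε)`, where the forcing
period is `c / l + ε T₁`. -/
noncomputable def deviationField (f : E → E) (g : (E × ℝ × ℝ) × ℝ → E) (z : ℝ → E) (c l : ℝ)
    (w : (E × (ℝ × ℝ × ℝ)) × ℝ) : E :=
  c • hadamardQuotient f (z (w.1.2.2.1 + c * w.2), w.1.1, w.1.2.2.2) +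
  (l * w.1.2.1) • f (z (w.1.2.2.1 + c * w.2) + w.1.2.2.2 • w.1.1) +
  (c + w.1.2.2.2 * (l * w.1.2.1)) •
    g ((z (w.1.2.2.1 + c * w.2) + w.1.2.2.2 • w.1.1, c / l + w.1.2.2.2 * w.1.2.1, w.1.2.2.2),
      (c + w.1.2.2.2 * (l * w.1.2.1)) * w.2)

theorem contDiff_deviationField {f : E → E} {g : (E × ℝ × ℝ) × ℝ → E} {z : ℝ → E} {n : ℕ}
    (hf : ContDiff ℝ (n + 1 : ℕ) f) (hg : ContDiff ℝ n g) (hz : ContDiff ℝ n z) (c l : ℝ) :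
    ContDiff ℝ n (deviationField f g z c l) := by
  have hQ := contDiff_hadamardQuotient hf
  have hf' : ContDiff ℝ n f := hf.of_le (by exact_mod_cast Nat.le_succ n)
  unfold deviationField
  refine ((ContDiff.const_smul c (hQ.comp ?_)).add
    (ContDiff.smul (by fun_prop) (hf'.comp (by fun_prop)))).add
    (ContDiff.smul (by fun_prop) (hg.comp (by fun_prop)))
  fun_prop

theorem deviationField_zero [CompleteSpace E] (f : E → E) (g : (E × ℝ × ℝ) × ℝ → E) (z : ℝ → E)
    (c l : ℝ) (y : E) (T₁ a θ : ℝ) :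
    deviationField f g z c l ((y, (T₁, a, 0)), θ) = c • fderiv ℝ f (z (a + c * θ)) y +
      (l * T₁) • f (z (a + c * θ)) + c • g ((z (a + c * θ), c / l, 0), c * θ) := by
  simp [deviationField, hadamardQuotient_zero]

/-- The deviations give solutions of the perturbed system in rescaled time. -/
theorem hasDerivAt_of_deviation [CompleteSpace E] {f : E → E} {g : (E × ℝ × ℝ) × ℝ → E} {z : ℝ → E}
    (hf : ContDiff ℝ 1 f) (hz : ∀ t, HasDerivAt z (f (z t)) t) {c l : ℝ} {y : ℝ → E}
    {T₁ a ε θ : ℝ} (hy : HasDerivAt y (deviationField f g z c l ((y θ, (T₁, a, ε)), θ)) θ) :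
    HasDerivAt (fun θ => z (a + c * θ) + ε • y θ) ((c + ε * (l * T₁)) •
      (f (z (a + c * θ) + ε • y θ) + ε • g ((z (a + c * θ) + ε • y θ, c / l + ε * T₁, ε),
        (c + ε * (l * T₁)) * θ))) θ := by
  have h1 : HasDerivAt (fun θ : ℝ => a + c * θ) c θ := by
    simpa using ((hasDerivAt_id θ).const_mul c).const_add a
  have h2 := ((hz (a + c * θ)).scomp θ h1).add (hy.const_smul ε)
  refine h2.congr_deriv ?_
  have h3 := hadamardQuotient_spec hf (z (a + c * θ)) (y θ) ε
  simp only [deviationField]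
  generalize hadamardQuotient f (z (a + c * θ), y θ, ε) = Q at h3 ⊢
  generalize f (z (a + c * θ) + ε • y θ) = F at h3 ⊢
  subst h3
  module

section Branch

variable {O : Set E} {f : E → E} {H : E → ℝ} {z : ℝ → E} {τ : ℝ} {Y : ℝ → E →L[ℝ] E}
  {g : (E × ℝ × ℝ) × ℝ → E} {m l : ℕ}

/-- The first integral pairs the end point of a deviation with the Melnikov function. -/
theorem ConservativeOrbit.fderiv_deviation_eq_melnikov [CompleteSpace E]
    (h : ConservativeOrbit O f H z τ) (hg : Continuous g) {y : ℝ → E} {T₁ a : ℝ}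
    (hy : ∀ θ ∈ Icc (0 : ℝ) 1,
      HasDerivAt y (deviationField f g z (m * τ) l ((y θ, (T₁, a, 0)), θ)) θ) :
    fderiv ℝ H (z a) (y 1 - y 0) = melnikov H (curried g) z τ m l a := by
  have hyc : ContinuousOn y (Icc 0 1) := fun t ht => (hy t ht).continuousAt.continuousWithinAt
  have hzc := h.continuous
  have hfc : Continuous f := h.contDiff_f.continuous
  simp only [deviationField_zero] at hy
  have hc : ContinuousOn (fun θ => (m * τ) • fderiv ℝ f (z (a + m * τ * θ)) (y θ) +
      (l * T₁) • f (z (a + m * τ * θ)) +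
      (m * τ) • g ((z (a + m * τ * θ), m * τ / l, 0), m * τ * θ)) (Icc 0 1) := by
    have h1 : ContinuousOn (fun θ : ℝ => fderiv ℝ f (z (a + m * τ * θ)) (y θ)) (Icc 0 1) :=
      (h.continuous_fderiv_f.comp (by fun_prop :
        Continuous fun θ : ℝ => z (a + m * τ * θ))).continuousOn.clm_apply hyc
    have h2 : Continuous fun θ => (l * T₁) • f (z (a + m * τ * θ)) := by fun_prop
    have h3 : Continuous fun θ => (m * τ) • g ((z (a + m * τ * θ), m * τ / l, 0), m * τ * θ) := by
      fun_prop
    exact ((h1.const_smul _).add h2.continuousOn).add h3.continuousOn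
  have key := h.fderiv_sub_eq_integral a (m * τ) hc hy
  rw [(h.periodic.nat_mul m) a, ← map_sub] at key
  rw [key, melnikov_eq_integral_unit]
  refine intervalIntegral.integral_congr fun θ _ => ?_
  simp only [add_sub_right_comm, sub_self, zero_add, map_add, map_smul, smul_eq_mul,
    h.integral _ (h.mem _), mul_zero, curried]

/-- Solutions of the homogeneous part of the equation of deviations at `ε = 0`. -/
theorem ConservativeOrbit.hasDerivAt_deviation_add [CompleteSpace E]
    (h : ConservativeOrbit O f H z τ)
    (hY : IsVariationalSolution f z Y) {y : ℝ → E} {c lam T₁ a θ : ℝ}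
    (hy : HasDerivAt y (deviationField f g z c lam ((y θ, (T₁, a, 0)), θ)) θ) (v : E) (T' : ℝ) :
    HasDerivAt (fun θ => y θ + (Y (a + c * θ) v + (lam * T' * θ) • f (z (a + c * θ))))
      (deviationField f g z c lam
        ((y θ + (Y (a + c * θ) v + (lam * T' * θ) • f (z (a + c * θ))), (T₁ + T', a, 0)), θ)) θ := by
  rw [deviationField_zero] at hy ⊢
  have h1 : HasDerivAt (fun θ : ℝ => a + c * θ) c θ := by
    simpa using ((hasDerivAt_id θ).const_mul c).const_add a
  have h2 := (hY.hasDerivAt_apply v (a + c * θ)).scomp θ h1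
  have h3 : HasDerivAt (fun t => f (z t)) (fderiv ℝ f (z (a + c * θ)) (f (z (a + c * θ))))
      (a + c * θ) :=
    ((h.contDiff_f.differentiable two_ne_zero _).hasFDerivAt).comp_hasDerivAt _ (h.ode _)
  have h4 := h3.scomp θ h1
  -- The velocity solves the equation of variations, so the factor linear in `θ` contributes only
  -- its own derivative, which accounts for the change of `T₁` to `T₁ + T'`.
  have h5 : HasDerivAt (fun θ : ℝ => lam * T' * θ) (lam * T') θ := by
    simpa using (hasDerivAt_id θ).const_mul (lam * T')
  have h6 := hy.add (h2.add (h5.smul h4))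
  refine h6.congr_deriv ?_
  simp only [map_add, map_smul, Function.comp_apply]
  module

theorem ConservativeOrbit.endpoint_deviation_add (h : ConservativeOrbit O f H z τ)
    (hY : IsVariationalSolution f z Y) (a : ℝ) (w : E × ℝ) :
    Y (a + m * τ * 1) w.1 + (l * w.2 * 1) • f (z (a + m * τ * 1)) =
      Y a w.1 + Y a (periodDefect (Y τ ^ m) (f (z 0)) l w) := by
  rw [mul_one, mul_one, h.variational_add_period hY, (h.periodic.nat_mul m) a, periodDefect_apply,
    map_add, map_sub, map_smul, h.variational_apply_velocity hY]
  abel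

/-- `DH` is invariant under the monodromy and annihilates the velocity. The linearised period map
thus misses a direction wherever `DH ≠ 0`; this is the origin of the Melnikov condition. -/
theorem ConservativeOrbit.fderiv_variational_periodDefect [CompleteSpace E]
    (h : ConservativeOrbit O f H z τ)
    (hY : IsVariationalSolution f z Y) (a c : ℝ) (w : E × ℝ) :
    fderiv ℝ H (z a) (Y a (periodDefect (Y τ ^ m) (f (z 0)) c w)) = 0 := by
  have h1 := h.variational_add_period hY m 0 w.1
  rw [zero_add, hY.init, ContinuousLinearMap.id_apply] at h1
  have h2 := h.fderiv_variational hY (m * τ) w.1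
  have h3 := (h.periodic.nat_mul m) 0
  rw [zero_add] at h3
  rw [h3, h1] at h2
  rw [h.fderiv_variational hY, periodDefect_apply, map_add, map_sub, map_smul, h2, sub_self,
    h.integral _ (h.mem 0), smul_zero, add_zero]

/-- Each `Y t` is bijective and `DH` is conserved, so a zero of `DH` at one point of the orbit
spreads to all of it and forces `M = 0`. -/
theorem ConservativeOrbit.fderiv_ne_zero_of_melnikov [FiniteDimensional ℝ E]
    (h : ConservativeOrbit O f H z τ) (hY : IsVariationalSolution f z Y)
    {s : ℝ} (hs : melnikov H (curried g) z τ m l s ≠ 0) (a : ℝ) : fderiv ℝ H (z a) ≠ 0 := by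
  have := FiniteDimensional.complete ℝ E
  intro h0
  have h1 : ∀ v, fderiv ℝ H (z 0) v = 0 := fun v => by
    rw [← h.fderiv_variational hY a v, h0]; rfl
  refine hs ?_
  have h2 : ∀ t w, fderiv ℝ H (z t) w = 0 := by
    intro t w
    obtain ⟨v, rfl⟩ := (LinearMap.injective_iff_surjective (f := (Y t : E →ₗ[ℝ] E))).1
      (h.variational_injective hY t) w
    exact (h.fderiv_variational hY t v).trans (h1 v)
  simp [melnikov, h2]

/-- The reference deviation at `ε = 0` and at a zero of the Melnikov function. -/
theorem ConservativeOrbit.exists_periodic_deviation [FiniteDimensional ℝ E]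
    (h : ConservativeOrbit O f H z τ) (hg : Continuous g) (hY : IsVariationalSolution f z Y) {a : ℝ}
    (ha : melnikov H (curried g) z τ m l a = 0) (hH : fderiv ℝ H (z a) ≠ 0)
    {κ ρ : E × ℝ →L[ℝ] ℝ}
    (hinj : ∀ w : E × ℝ, Y a (periodDefect (Y τ ^ m) (f (z 0)) l w) = 0 →
      κ (Y a w.1, w.2) = 0 → ρ (Y a w.1, w.2) = 0 → w = 0) :
    ∃ (y : ℝ → E) (T₁ : ℝ), y 1 = y 0 ∧ κ (y 0, T₁) = 0 ∧
      ∀ θ ∈ Icc (0 : ℝ) 1,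
        HasDerivAt y (deviationField f g z (m * τ) l ((y θ, (T₁, a, 0)), θ)) θ := by
  have := FiniteDimensional.complete ℝ E
  have hzc := h.continuous
  have hfc := h.continuous_fderiv_f
  obtain ⟨y, hy0, hy⟩ := exists_affine_solution
    (A := fun θ => (m * τ) • fderiv ℝ f (z (a + m * τ * θ)))
    (b := fun θ => (m * τ) • g ((z (a + m * τ * θ), m * τ / l, 0), m * τ * θ))
    (Continuous.const_smul (hfc.comp (by fun_prop : Continuous fun θ : ℝ => z (a + m * τ * θ)))
      (m * τ))
    (by fun_prop) (0 : E)
  have hy' : ∀ θ ∈ Icc (0 : ℝ) 1,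
      HasDerivAt y (deviationField f g z (m * τ) l ((y θ, (0, a, 0)), θ)) θ := by
    intro θ hθ
    rw [deviationField_zero, mul_zero, zero_smul, add_zero]
    exact hy θ hθ
  have he := h.fderiv_deviation_eq_melnikov hg hy'
  rw [ha, hy0, sub_zero] at he
  set B : E × ℝ →L[ℝ] E × ℝ := (Y a).prodMap (ContinuousLinearMap.id ℝ ℝ) with hB
  -- The particular solution starts at `0` with `T₁ = 0`. Its end point lies in the kernel of `DH`
  -- since `M(a) = 0`, so a homogeneous solution can cancel it.
  obtain ⟨w, hw1, hw2, -⟩ := exists_of_injective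
    (D := (Y a) ∘L periodDefect (Y τ ^ m) (f (z 0)) l) (κ := κ ∘L B) (ρ := ρ ∘L B) hH
    (fun w => h.fderiv_variational_periodDefect hY a l w) hinj (e := -y 1) (by rw [map_neg, he, neg_zero])
  refine ⟨fun θ => y θ + (Y (a + m * τ * θ) w.1 + (l * w.2 * θ) • f (z (a + m * τ * θ))), 0 + w.2,
    ?_, ?_, fun θ hθ => h.hasDerivAt_deviation_add hY (hy' θ hθ) w.1 w.2⟩
  · have hw1' : Y a (periodDefect (Y τ ^ m) (f (z 0)) l w) = -y 1 := hw1
    simp only [h.endpoint_deviation_add hY, hw1']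
    simp [hy0]
  · have : κ (Y a w.1, w.2) = 0 := hw2
    simpa [hy0] using this

end Branch
end Resonance

/-! ### The branch of periodic deviations -/

namespace Resonance

open Filter Topology

universe u

variable {E : Type u} [NormedAddCommGroup E] [NormedSpace ℝ E] [FiniteDimensional ℝ E]
variable {O : Set E} {f : E → E} {H : E → ℝ} {z : ℝ → E} {τ : ℝ} {Y : ℝ → E →L[ℝ] E}
  {g : (E × ℝ × ℝ) × ℝ → E} {m l : ℕ}

theorem solution_unique_of_contDiff {P : Type} [NormedAddCommGroup P] [NormedSpace ℝ P]
    {V : (E × P) × ℝ → E} (hV : ContDiff ℝ 1 V) (p : P) {y₁ y₂ : ℝ → E}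
    (h₁ : ∀ t ∈ Icc (0 : ℝ) 1, HasDerivAt y₁ (V ((y₁ t, p), t)) t)
    (h₂ : ∀ t ∈ Icc (0 : ℝ) 1, HasDerivAt y₂ (V ((y₂ t, p), t)) t) (h0 : y₁ 0 = y₂ 0) :
    EqOn y₁ y₂ (Icc 0 1) :=
  solution_unique isOpen_univ (F := fun w : E × ℝ => V ((w.1, p), w.2))
    (hV.comp (by fun_prop)).contDiffOn (fun _ _ => mem_univ _) (fun _ _ => mem_univ _) h₁ h₂ h0

/-- Derivative of the end point of the deviation along the affine directions at `ε = 0`. -/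
theorem ConservativeOrbit.fderiv_endpoint_affine (h : ConservativeOrbit O f H z τ)
    (hY : IsVariationalSolution f z Y)
    (hV : ContDiff ℝ 1 (deviationField f g z (m * τ) l)) {y : ℝ → E} {T₀ s₀ : ℝ}
    (hy : ∀ θ ∈ Icc (0 : ℝ) 1,
      HasDerivAt y (deviationField f g z (m * τ) l ((y θ, (T₀, s₀, 0)), θ)) θ)
    {S : E × (ℝ × ℝ × ℝ) → ℝ → E}
    (hSd : DifferentiableAt ℝ (fun q => S q 1) (y 0, (T₀, s₀, 0)))
    (hS : ∀ᶠ q in 𝓝 (y 0, (T₀, s₀, (0 : ℝ))), S q 0 = q.1 ∧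
        ∀ t ∈ Icc (0 : ℝ) 1, HasDerivAt (S q) (deviationField f g z (m * τ) l ((S q t, q.2), t)) t)
    (w : E × ℝ) :
    fderiv ℝ (fun q => S q 1) (y 0, (T₀, s₀, 0)) (Y s₀ w.1, (w.2, 0, 0)) =
      Y s₀ w.1 + Y s₀ (periodDefect (Y τ ^ m) (f (z 0)) l w) := by
  have := FiniteDimensional.complete ℝ E
  set γ : ℝ → E × (ℝ × ℝ × ℝ) := fun t => (y 0 + t • Y s₀ w.1, (T₀ + t * w.2, s₀, 0)) with hγ
  have hγ0 : γ 0 = (y 0, (T₀, s₀, 0)) := by simp [hγ]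
  have hγd : HasDerivAt γ (Y s₀ w.1, (w.2, 0, 0)) 0 := by
    have h1 : HasDerivAt (fun t : ℝ => y 0 + t • Y s₀ w.1) (Y s₀ w.1) 0 := by
      simpa using ((hasDerivAt_id (0 : ℝ)).smul_const (Y s₀ w.1)).const_add (y 0)
    have h2 : HasDerivAt (fun t : ℝ => T₀ + t * w.2) w.2 0 := by
      simpa using ((hasDerivAt_id (0 : ℝ)).mul_const w.2).const_add T₀
    exact h1.prodMk (h2.prodMk ((hasDerivAt_const _ _).prodMk (hasDerivAt_const _ _)))
  have hd1 : HasDerivAt (fun t => S (γ t) 1)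
      (fderiv ℝ (fun q => S q 1) (y 0, (T₀, s₀, 0)) (Y s₀ w.1, (w.2, 0, 0))) 0 := by
    have h1 := hSd.hasFDerivAt
    rw [← hγ0] at h1 ⊢
    exact HasFDerivAt.comp_hasDerivAt (f := γ) 0 h1 hγd
  refine hd1.unique ?_
  -- At `ε = 0` and fixed phase the end point is exactly affine along `γ`, by uniqueness, and its
  -- derivative can be read off.
  have hev : (fun t => S (γ t) 1) =ᶠ[𝓝 0] fun t => y 1 +
      t • (Y s₀ w.1 + Y s₀ (periodDefect (Y τ ^ m) (f (z 0)) l w)) := by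
    have hγc : Tendsto γ (𝓝 0) (𝓝 (y 0, (T₀, s₀, 0))) := hγ0 ▸ hγd.continuousAt.tendsto
    filter_upwards [hγc.eventually hS] with t ht
    have huniq := solution_unique_of_contDiff hV (T₀ + t * w.2, s₀, 0) (y₁ := S (γ t))
      (y₂ := fun θ => y θ + (Y (s₀ + m * τ * θ) (t • w.1) +
        (l * (t * w.2) * θ) • f (z (s₀ + m * τ * θ)))) ht.2
      (fun θ hθ => h.hasDerivAt_deviation_add hY (hy θ hθ) (t • w.1) (t * w.2))
      (by rw [ht.1]; simp [hγ])
    have h1 := huniq (x := 1) (by simp)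
    have h2 := h.endpoint_deviation_add hY (m := m) (l := l) s₀ (t • w)
    simp only [Prod.smul_fst, Prod.smul_snd, smul_eq_mul] at h2
    rw [h1]
    simp only [h2]
    rw [map_smul, map_smul, map_smul, smul_add]
  refine HasDerivAt.congr_of_eventuallyEq ?_ hev
  simpa using ((hasDerivAt_id (0 : ℝ)).smul_const
    (Y s₀ w.1 + Y s₀ (periodDefect (Y τ ^ m) (f (z 0)) l w))).const_add (y 1)

/-- Derivative of the end point of the deviation with respect to the phase, at `ε = 0`. -/
theorem ConservativeOrbit.fderiv_endpoint_phase (h : ConservativeOrbit O f H z τ)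
    (hg : Continuous g) {y : ℝ → E} {T₀ s₀ : ℝ} (hy1 : y 1 = y 0)
    {S : E × (ℝ × ℝ × ℝ) → ℝ → E} (hS0 : S (y 0, (T₀, s₀, 0)) 1 = y 1)
    (hSd : DifferentiableAt ℝ (fun q => S q 1) (y 0, (T₀, s₀, 0)))
    (hS : ∀ᶠ q in 𝓝 (y 0, (T₀, s₀, (0 : ℝ))), S q 0 = q.1 ∧
        ∀ t ∈ Icc (0 : ℝ) 1, HasDerivAt (S q) (deviationField f g z (m * τ) l ((S q t, q.2), t)) t) :
    fderiv ℝ H (z s₀) (fderiv ℝ (fun q => S q 1) (y 0, (T₀, s₀, 0)) (0, (0, 1, 0))) =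
      deriv (melnikov H (curried g) z τ m l) s₀ := by
  have := FiniteDimensional.complete ℝ E
  set γ : ℝ → E × (ℝ × ℝ × ℝ) := fun a => (y 0, (T₀, a, 0)) with hγ
  have hγd : HasDerivAt γ (0, (0, 1, 0)) s₀ :=
    (hasDerivAt_const _ _).prodMk ((hasDerivAt_const _ _).prodMk
      ((hasDerivAt_id _).prodMk (hasDerivAt_const _ _)))
  have hd1 : HasDerivAt (fun a => S (γ a) 1 - y 0)
      (fderiv ℝ (fun q => S q 1) (y 0, (T₀, s₀, 0)) (0, (0, 1, 0))) s₀ :=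
    (HasFDerivAt.comp_hasDerivAt (f := γ) s₀ hSd.hasFDerivAt hγd).sub_const (y 0)
  have hA : ContinuousAt (fun a => fderiv ℝ H (z a)) s₀ :=
    (h.continuous_fderiv_H.comp h.continuous).continuousAt
  have h0 : S (γ s₀) 1 - y 0 = 0 := by rw [hγ, hS0, hy1, sub_self]
  have hd2 := hasDerivAt_clm_apply_of_eq_zero hA hd1 h0
  refine (HasDerivAt.congr_of_eventuallyEq hd2 ?_).deriv.symm
  filter_upwards [hγd.continuousAt.tendsto.eventually hS] with a ha
  have := h.fderiv_deviation_eq_melnikov hg ha.2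
  rw [ha.1] at this
  exact this.symm

/-- The branch of periodic deviations at a simple zero of the Melnikov function, under an additional
scalar condition `q`. -/
theorem ConservativeOrbit.exists_deviation_branch (h : ConservativeOrbit O f H z τ)
    {n : ℕ} (hn : 1 ≤ n) (hf : ContDiff ℝ (n + 1 : ℕ) f) (hg : ContDiff ℝ n g) (hl : 0 < l)
    (hY : IsVariationalSolution f z Y) (hfz : f (z 0) ≠ 0)
    (hnormal : Module.finrank ℝ
        (Module.End.eigenspace ((Y τ ^ m : E →L[ℝ] E) : Module.End ℝ E) 1) = 1 ∨
      (Module.finrank ℝ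
        (Module.End.eigenspace ((Y τ ^ m : E →L[ℝ] E) : Module.End ℝ E) 1) = 2 ∧
        ¬ ∃ v : E, (Y τ ^ m) v - v = f (z 0)))
    {s₀ : ℝ} (hM : melnikov H (curried g) z τ m l s₀ = 0)
    (hM' : deriv (melnikov H (curried g) z τ m l) s₀ ≠ 0) (hH : fderiv ℝ H (z s₀) ≠ 0)
    {q : E × (ℝ × ℝ × ℝ) → ℝ} (hq : ContDiff ℝ n q) {κ : E × ℝ →L[ℝ] ℝ}
    (hqκ : ∀ v T₁, q (v, (T₁, s₀, 0)) = κ (v, T₁)) (hκu : κ (f (z s₀), 0) = 0) {k : E × ℝ}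
    (hk : periodDefect (Y τ ^ m) (f (z 0)) l k = 0) (hκk : κ (Y s₀ k.1, k.2) ≠ 0) :
    ∃ (ψ : ℝ → E × ℝ × ℝ) (B : ℝ), ContDiffAt ℝ n ψ 0 ∧ (ψ 0).2.2 = s₀ ∧
      ∀ᶠ ε in 𝓝 (0 : ℝ), q ((ψ ε).1, ((ψ ε).2.1, (ψ ε).2.2, ε)) = 0 ∧
        ∃ y : ℝ → E, y 0 = (ψ ε).1 ∧ y 1 = (ψ ε).1 ∧ (∀ θ ∈ Icc (0 : ℝ) 1, ‖y θ‖ ≤ B) ∧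
          ∀ θ ∈ Icc (0 : ℝ) 1, HasDerivAt y
            (deviationField f g z (m * τ) l ((y θ, ((ψ ε).2.1, (ψ ε).2.2, ε)), θ)) θ := by
  have := FiniteDimensional.complete ℝ E
  have hn0 : ((n : ℕ) : WithTop ℕ∞) ≠ 0 := by exact_mod_cast (by omega : n ≠ 0)
  have hn1 : (1 : WithTop ℕ∞) ≤ (n : ℕ) := by exact_mod_cast hn
  have hz : ContDiff ℝ n z := (contDiff_solution hf h.ode).of_le (by exact_mod_cast (by omega))
  have hV := contDiff_deviationField hf hg hz (m * τ) l
  have hV1 := hV.of_le hn1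
  have hl' : (l : ℝ) ≠ 0 := by exact_mod_cast hl.ne'
  -- A displacement along the velocity is redundant with a change of phase `a`. The functional `ρ`
  -- fixes it.
  obtain ⟨ρ, hρ⟩ := SeparatingDual.exists_ne_zero (R := ℝ) (x := f (z s₀)) (by
    rw [← h.variational_apply_velocity hY]
    intro h0
    exact hfz (h.variational_injective hY s₀ (h0.trans (map_zero _).symm)))
  have hinj : ∀ w : E × ℝ, Y s₀ (periodDefect (Y τ ^ m) (f (z 0)) l w) = 0 →
      κ (Y s₀ w.1, w.2) = 0 → (ρ ∘L ContinuousLinearMap.fst ℝ E ℝ) (Y s₀ w.1, w.2) = 0 →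
      w = 0 := by
    intro w h1 h2 h3
    have h1' : periodDefect (Y τ ^ m) (f (z 0)) l w = 0 :=
      h.variational_injective hY s₀ (h1.trans (map_zero _).symm)
    have hu : periodDefect (Y τ ^ m) (f (z 0)) l (f (z 0), 0) = 0 := by
      have h4 := h.variational_add_period hY m 0 (f (z 0))
      rw [h.variational_apply_velocity hY, (h.periodic.nat_mul m) 0, hY.init] at h4
      rw [periodDefect_apply]
      simp only [mul_zero, zero_smul, add_zero]
      rw [ContinuousLinearMap.id_apply] at h4
      rw [← h4, sub_self]
    set B : E × ℝ →L[ℝ] E × ℝ := (Y s₀).prodMap (ContinuousLinearMap.id ℝ ℝ) with hB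
    refine eq_zero_of_finrank_ker_le_two (finrank_ker_periodDefect_le _ _ hl' hnormal)
      (κ := κ ∘L B) (ρ := (ρ ∘L ContinuousLinearMap.fst ℝ E ℝ) ∘L B) hu hk ?_ hκk ?_ h1' h2 h3
    · change κ (Y s₀ (f (z 0)), 0) = 0
      rw [h.variational_apply_velocity hY, hκu]
    · change ρ (Y s₀ (f (z 0))) ≠ 0
      rwa [h.variational_apply_velocity hY]
  obtain ⟨y, T₀, hy1, hκ0, hy⟩ := h.exists_periodic_deviation hg.continuous hY hM hH hinj
  obtain ⟨S, hSc, hS0, hS, hSb, -⟩ := exists_solution_map hn hV hy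
  have hSd : DifferentiableAt ℝ (fun q => S q 1) (y 0, (T₀, s₀, 0)) := hSc.differentiableAt hn0
  have hS1 : S (y 0, (T₀, s₀, 0)) 1 = y 1 := hS0 1 (by simp)
  have haff := h.fderiv_endpoint_affine hY hV1 hy hSd hS
  have hph := h.fderiv_endpoint_phase hg.continuous hy1 hS1 hSd hS
  set q₀ : E × (ℝ × ℝ × ℝ) := (y 0, (T₀, s₀, 0)) with hq₀
  set DΨ := fderiv ℝ (fun q => S q 1) q₀ with hDΨ
  set ι : ℝ × (E × ℝ × ℝ) →L[ℝ] E × (ℝ × ℝ × ℝ) :=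
    ((ContinuousLinearMap.fst ℝ E (ℝ × ℝ)) ∘L ContinuousLinearMap.snd ℝ _ _).prod
      (((ContinuousLinearMap.fst ℝ ℝ ℝ) ∘L ContinuousLinearMap.snd ℝ E (ℝ × ℝ) ∘L
        ContinuousLinearMap.snd ℝ _ _).prod
      (((ContinuousLinearMap.snd ℝ ℝ ℝ) ∘L ContinuousLinearMap.snd ℝ E (ℝ × ℝ) ∘L
        ContinuousLinearMap.snd ℝ _ _).prod (ContinuousLinearMap.fst ℝ _ _))) with hι
  set π : ℝ × (E × ℝ × ℝ) →L[ℝ] E :=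
    ContinuousLinearMap.fst ℝ E (ℝ × ℝ) ∘L ContinuousLinearMap.snd ℝ _ _ with hπ
  -- Periodicity, the condition `q` and the phase condition: as many equations as unknowns `(y(0),
  -- T₁, a)`, with `ε` as the parameter.
  set Φ : ℝ × (E × ℝ × ℝ) → E × ℝ × ℝ := fun w =>
    (S (ι w) 1 - π w, q (ι w), ρ (π w)) with hΦ
  set w₀ : ℝ × (E × ℝ × ℝ) := (0, (y 0, T₀, s₀)) with hw₀
  have hιw : ι w₀ = q₀ := rfl
  have hΦc : ContDiffAt ℝ n Φ w₀ := by
    have h1 : ContDiffAt ℝ n (fun w => S (ι w) 1) w₀ :=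
      ContDiffAt.comp (g := fun q => S q 1) w₀ hSc ι.contDiff.contDiffAt
    exact (h1.sub π.contDiff.contDiffAt).prodMk
      ((hq.comp ι.contDiff).contDiffAt.prodMk (ρ.contDiff.comp π.contDiff).contDiffAt)
  have hΦd : HasFDerivAt Φ ((DΨ ∘L ι - π).prod ((fderiv ℝ q q₀ ∘L ι).prod (ρ ∘L π))) w₀ := by
    have h1 : HasFDerivAt (fun w => S (ι w) 1) (DΨ ∘L ι) w₀ :=
      HasFDerivAt.comp (g := fun q => S q 1) w₀ hSd.hasFDerivAt ι.hasFDerivAt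
    have h2 : HasFDerivAt (fun w => q (ι w)) (fderiv ℝ q q₀ ∘L ι) w₀ :=
      HasFDerivAt.comp (g := q) w₀ (hq.differentiable hn0 q₀).hasFDerivAt ι.hasFDerivAt
    exact (h1.sub π.hasFDerivAt).prodMk (h2.prodMk (ρ ∘L π).hasFDerivAt)
  have hqd : ∀ v T, fderiv ℝ q q₀ (v, (T, 0, 0)) = κ (v, T) := by
    intro v T
    set j : E × ℝ →L[ℝ] E × (ℝ × ℝ × ℝ) := (ContinuousLinearMap.fst ℝ E ℝ).prod
      ((ContinuousLinearMap.snd ℝ E ℝ).prod 0) with hj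
    have h1 : HasFDerivAt (fun w : E × ℝ => q (j w + (0, (0, s₀, 0)))) (fderiv ℝ q q₀ ∘L j)
        (y 0, T₀) := by
      refine HasFDerivAt.comp (g := q) (f := fun w : E × ℝ => j w + (0, (0, s₀, 0))) (y 0, T₀)
        ?_ (j.hasFDerivAt.add_const _)
      have : j (y 0, T₀) + (0, (0, s₀, 0)) = q₀ := by simp [hj, hq₀]
      rw [this]
      exact (hq.differentiable hn0 q₀).hasFDerivAt
    have h2 : (fun w : E × ℝ => q (j w + (0, (0, s₀, 0)))) = κ := by
      ext w
      rw [← hqκ w.1 w.2]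
      simp [hj]
    rw [h2] at h1
    have h3 := h1.unique κ.hasFDerivAt
    exact DFunLike.congr_fun h3 (v, T)
  have hinv : (fderiv ℝ Φ w₀ ∘L .inr ℝ ℝ (E × ℝ × ℝ)).IsInvertible := by
    refine isInvertible_of_injective ?_
    rintro ⟨v, T, a⟩ hzero
    rw [hΦd.fderiv] at hzero
    have h1 : DΨ (v, (T, a, 0)) - v = 0 := congrArg Prod.fst hzero
    have h2 : fderiv ℝ q q₀ (v, (T, a, 0)) = 0 := congrArg (fun x => x.2.1) hzero
    have h3 : ρ v = 0 := congrArg (fun x => x.2.2) hzero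
    obtain ⟨u, rfl⟩ := (LinearMap.injective_iff_surjective (f := (Y s₀ : E →ₗ[ℝ] E))).1
      (h.variational_injective hY s₀) v
    simp only [ContinuousLinearMap.coe_coe] at h1 h2 h3 ⊢
    have hsplit : ((Y s₀ u, (T, a, 0)) : E × (ℝ × ℝ × ℝ)) =
        (Y s₀ u, (T, 0, 0)) + a • (0, (0, 1, 0)) := by simp
    have h4 := haff (u, T)
    simp only at h4
    rw [hsplit, map_add, map_smul, h4] at h1
    -- Pairing with `DH` removes the contribution of `(v, T)` and leaves `a M'(s₀) = 0`. With `a =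
    -- 0`, what remains is the injective system `hinj`.
    have h5 := congrArg (fderiv ℝ H (z s₀)) h1
    rw [map_sub, map_add, map_add, h.fderiv_variational_periodDefect hY, map_smul, hph, add_zero,
      add_sub_cancel_left, map_zero, smul_eq_mul] at h5
    have ha : a = 0 := (mul_eq_zero.1 h5).resolve_right hM'
    subst ha
    rw [zero_smul, add_zero, add_sub_cancel_left] at h1
    rw [hqd] at h2
    have := hinj (u, T) h1 h2 h3
    simp only [Prod.mk_eq_zero] at this
    simp [this.1, this.2]
  set ψ := hΦc.implicitFunction hn0 hinv with hψ
  have hψ0 : ψ 0 = (y 0, T₀, s₀) := hΦc.implicitFunction_apply_self hn0 hinv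
  have hψc : ContDiffAt ℝ n ψ 0 := hΦc.contDiffAt_implicitFunction hn0 hinv
  have hψe := hΦc.eventually_apply_implicitFunction hn0 hinv
  have hyc : ContinuousOn y (Icc 0 1) := fun t ht => (hy t ht).continuousAt.continuousWithinAt
  obtain ⟨B, hB⟩ := (isCompact_Icc.image_of_continuousOn hyc).isBounded.exists_norm_le
  refine ⟨ψ, B + 1, hψc, by rw [hψ0], ?_⟩
  have htend : Tendsto (fun ε => ι (ε, ψ ε)) (𝓝 0) (𝓝 q₀) := by
    have h1 : ContinuousAt (fun ε => ι (ε, ψ ε)) 0 :=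
      ι.continuous.continuousAt.comp (continuousAt_id.prodMk hψc.continuousAt)
    have h2 : ι (0, ψ 0) = q₀ := by rw [hψ0]; exact hιw
    exact h2 ▸ h1.tendsto
  -- The implicit function keeps `Φ` at its value for the reference deviation, where the first two
  -- components vanish. The value of `ρ` is immaterial.
  filter_upwards [hψe, htend.eventually hS, htend.eventually (hSb 1 one_pos)] with ε h1 h2 h3
  have h4 : S (ι (ε, ψ ε)) 1 - (ψ ε).1 = S q₀ 1 - y 0 := congrArg Prod.fst h1
  have h5 : q (ι (ε, ψ ε)) = q q₀ := congrArg (fun x => x.2.1) h1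
  refine ⟨?_, S (ι (ε, ψ ε)), h2.1, ?_, fun θ hθ => ?_, h2.2⟩
  · have : q q₀ = 0 := by rw [hq₀, hqκ, hκ0]
    rw [this] at h5
    exact h5
  · rw [hS1, hy1, sub_self, sub_eq_zero] at h4
    exact h4
  · have h6 := hB _ (mem_image_of_mem y hθ)
    calc ‖S (ι (ε, ψ ε)) θ‖ ≤ ‖S (ι (ε, ψ ε)) θ - y θ‖ + ‖y θ‖ := norm_le_norm_sub_add _ _
      _ ≤ B + 1 := by linarith [h3 θ hθ]

end Resonance

/-! ### Passage between global and local data -/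

namespace Resonance

open Filter Topology

universe u

variable {E : Type u} [NormedAddCommGroup E] [NormedSpace ℝ E]

/-- The vector field `fh`, the function `Hh` and the perturbation `gh`, which are defined globally,
agree with `f`, `H` and `g` on the open set `O` and for periods near `T₀` and small `ε`. -/
structure IsGlobalisation (U : Set E) (f : E → E) (H : E → ℝ) (ε₁ : ℝ) (g : E → ℝ → ℝ → ℝ → E)
    (T₀ : ℝ) (O : Set E) (fh : E → E) (Hh : E → ℝ) (gh : (E × ℝ × ℝ) × ℝ → E) : Prop where
  subset : O ⊆ U
  f_eq : ∀ x ∈ O, fh x = f x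
  fderiv_f_eq : ∀ x ∈ O, fderiv ℝ fh x = fderiv ℝ f x
  fderiv_H_eq : ∀ x ∈ O, fderiv ℝ Hh x = fderiv ℝ H x
  g_eq : ∀ᶠ p in 𝓝 (T₀, (0 : ℝ)), 0 < p.1 ∧ p.2 ∈ Ioo (-ε₁) ε₁ ∧
    ∀ x ∈ O, ∀ t, gh ((x, p), t) = g x t p.1 p.2

variable {U : Set E} {r : ℕ} {f : E → E} {H : E → ℝ} {ε₁ : ℝ} {g : E → ℝ → ℝ → ℝ → E}
  {z : ℝ → E} {τ T₀ : ℝ} {O : Set E} {fh : E → E} {Hh : E → ℝ} {gh : (E × ℝ × ℝ) × ℝ → E}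

/-- All data are cut off near the compact orbit, and the perturbation near the orbit times `(T₀,
0)`. The tube lemma then splits the region of agreement into a neighbourhood `O` of the orbit and
one of the parameters. -/
theorem exists_globalisation [FiniteDimensional ℝ E] (hU : IsOpen U) (hr : 2 ≤ r)
    (hf : ContDiffOn ℝ (r : WithTop ℕ∞) f U) (hH : ContDiffOn ℝ 1 H U)
    (hHf : ∀ x ∈ U, fderiv ℝ H x (f x) = 0) (hε₁ : 0 < ε₁) (hg : IsPerturbation U ε₁ r g)
    (hz : IsPeriodicOrbit U f z τ) (hT₀ : 0 < T₀) :
    ∃ (O : Set E) (fh : E → E) (Hh : E → ℝ) (gh : (E × ℝ × ℝ) × ℝ → E),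
      ConservativeOrbit O fh Hh z τ ∧ IsGlobalisation U f H ε₁ g T₀ O fh Hh gh ∧
      ContDiff ℝ r fh ∧ ContDiff ℝ (r - 1 : ℕ) gh := by
  have hzc : Continuous z := continuous_iff_continuousAt.2 fun t => (hz.ode t).continuousAt
  have hK : IsCompact (range z) := by
    rw [← hz.periodic.image_uIcc hz.pos.ne' 0]
    exact isCompact_uIcc.image hzc
  have hKU : range z ⊆ U := range_subset_iff.2 hz.mem
  obtain ⟨fh, hfh, hfe⟩ := exists_contDiff_extension hU hK hKU hf
  obtain ⟨Hh, hHh, hHe⟩ := exists_contDiff_extension (n := 1) hU hK hKU (by exact_mod_cast hH)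
  have hK2 : IsCompact (range z ×ˢ ({(T₀, 0)} : Set (ℝ × ℝ))) := hK.prod isCompact_singleton
  have hW : IsOpen (paramDomain U ε₁) := hU.prod (isOpen_Ioi.prod isOpen_Ioo)
  have hKW : range z ×ˢ ({(T₀, 0)} : Set (ℝ × ℝ)) ⊆ paramDomain U ε₁ := by
    rintro ⟨x, p⟩ ⟨hx, hp⟩
    simp only [mem_singleton_iff] at hp
    subst hp
    exact ⟨hKU hx, hT₀, by simpa using hε₁, hε₁⟩
  obtain ⟨gh, hgh, hge⟩ := exists_contDiff_extension_prod hW hK2 hKW hg.joint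
  obtain ⟨V, hVo, hVK, hV⟩ := mem_nhdsSet_iff_exists.1 (hge.and (hW.mem_nhdsSet.2 hKW))
  obtain ⟨u, v, huo, hvo, hu, hv, huv⟩ := generalized_tube_lemma hK isCompact_singleton hVo hVK
  obtain ⟨O', hO'o, hO'K, hO'⟩ :=
    mem_nhdsSet_iff_exists.1 ((hfe.and hHe).and (hU.mem_nhdsSet.2 hKU))
  have hO : IsOpen (O' ∩ u) := hO'o.inter huo
  have hOf : ∀ x ∈ O' ∩ u, fderiv ℝ fh x = fderiv ℝ f x := fun x hx =>
    Filter.EventuallyEq.fderiv_eq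
      (Filter.eventually_of_mem (hO.mem_nhds hx) fun y hy => (hO' hy.1).1.1)
  have hOH : ∀ x ∈ O' ∩ u, fderiv ℝ Hh x = fderiv ℝ H x := fun x hx =>
    Filter.EventuallyEq.fderiv_eq
      (Filter.eventually_of_mem (hO.mem_nhds hx) fun y hy => (hO' hy.1).1.2)
  have hzO : ∀ t, z t ∈ O' ∩ u := fun t => ⟨hO'K (mem_range_self t), hu (mem_range_self t)⟩
  refine ⟨O' ∩ u, fh, Hh, gh, ?_, ?_, hfh, hgh⟩
  · refine ⟨hO, hfh.of_le (by exact_mod_cast hr), by exact_mod_cast hHh, fun x hx => ?_, hzO,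
      fun t => ?_, hz.pos, hz.periodic⟩
    · rw [hOH x hx, (hO' hx.1).1.1]
      exact hHf x (hO' hx.1).2
    · rw [(hO' (hzO t).1).1.1]
      exact hz.ode t
  · refine ⟨fun x hx => (hO' hx.1).2, fun x hx => (hO' hx.1).1.1, hOf, hOH, ?_⟩
    have hv' : v ∈ 𝓝 (T₀, (0 : ℝ)) := hvo.mem_nhds (hv rfl)
    filter_upwards [hv'] with p hp
    have hz0 := (hV (huv (show (z 0, p) ∈ u ×ˢ v from ⟨(hzO 0).2, hp⟩))).2
    exact ⟨hz0.2.1, hz0.2.2, fun x hx t =>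
      (hV (huv (show (x, p) ∈ u ×ˢ v from ⟨hx.2, hp⟩))).1 t⟩

namespace IsGlobalisation

theorem melnikov_eq {m l : ℕ}
    (hG : IsGlobalisation U f H ε₁ g (m * τ / l) O fh Hh gh) (hz : ∀ t, z t ∈ O) :
    melnikov H g z τ m l = melnikov Hh (curried gh) z τ m l := by
  funext s
  refine intervalIntegral.integral_congr fun t _ => ?_
  simp only [curried]
  rw [hG.fderiv_H_eq _ (hz _), hG.g_eq.self_of_nhds.2.2 _ (hz _)]

theorem isVariationalSolution (hG : IsGlobalisation U f H ε₁ g T₀ O fh Hh gh) (hz : ∀ t, z t ∈ O)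
    {Y : ℝ → E →L[ℝ] E} (hY : IsVariationalSolution f z Y) : IsVariationalSolution fh z Y :=
  ⟨hY.init, fun t => by rw [hG.fderiv_f_eq _ (hz t)]; exact hY.ode t⟩

/-- A deviation with equal end points which stays close to the unperturbed orbit gives a periodic
solution. -/
theorem hasPeriodicSolution [CompleteSpace E] {m l : ℕ} {r : ℕ}
    (hG : IsGlobalisation U f H ε₁ g (m * τ / l) O fh Hh gh)
    (h : ConservativeOrbit O fh Hh z τ) (hg : IsPerturbation U ε₁ r g) (hl : 0 < l)
    {T₁ a ε : ℝ} {v : E}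
    (hp : 0 < m * τ / l + ε * T₁ ∧ ε ∈ Ioo (-ε₁) ε₁ ∧
      ∀ x ∈ O, ∀ t, gh ((x, (m * τ / l + ε * T₁, ε)), t) = g x t (m * τ / l + ε * T₁) ε)
    {y : ℝ → E} (hy0 : y 0 = v) (hy1 : y 1 = v)
    (hy : ∀ θ ∈ Icc (0 : ℝ) 1,
      HasDerivAt y (deviationField fh gh z (m * τ) l ((y θ, (T₁, a, ε)), θ)) θ)
    (hO : ∀ θ ∈ Icc (0 : ℝ) 1, z (a + m * τ * θ) + ε • y θ ∈ O) :
    HasPeriodicSolution U f g (m * τ / l + ε * T₁) ε (l * (m * τ / l + ε * T₁))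
      (z a + ε • v) := by
  have hl' : (0 : ℝ) < l := by exact_mod_cast hl
  set T := m * τ / l + ε * T₁ with hT
  set P := l * T with hP
  have hPpos : 0 < P := mul_pos hl' hp.1
  have hPe : m * τ + ε * (l * T₁) = P := by rw [hP, hT]; field_simp
  set x : ℝ → E := fun θ => z (a + m * τ * θ) + ε • y θ with hx
  have hmem : ∀ t ∈ Icc 0 P, t / P ∈ Icc (0 : ℝ) 1 := fun t ht =>
    ⟨div_nonneg ht.1 hPpos.le, (div_le_one hPpos).2 ht.2⟩
  have hd : ∀ t ∈ Icc 0 P, HasDerivAt (fun t => x (t / P))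
      (f (x (t / P)) + ε • g (x (t / P)) t T ε) t := by
    intro t ht
    have h1 := hasDerivAt_of_deviation (h.contDiff_f.of_le one_le_two) h.ode (hy _ (hmem t ht))
    rw [hPe] at h1
    have h2 : HasDerivAt (fun t : ℝ => t / P) (1 / P) t := (hasDerivAt_id t).div_const P
    refine (h1.scomp t h2).congr_deriv ?_
    rw [smul_smul, one_div, inv_mul_cancel₀ hPpos.ne', one_smul, mul_div_cancel₀ _ hPpos.ne',
      hG.f_eq _ (hO _ (hmem t ht)), hp.2.2 _ (hO _ (hmem t ht))]
  have hF : ∀ s ∈ Icc 0 P,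
      Function.Periodic (fun t => f (x (s / P)) + ε • g (x (s / P)) t T ε) P := by
    intro s hs t
    have hper : Function.Periodic (fun t => g (x (s / P)) t T ε) T := fun t =>
      hg.periodic _ (hG.subset (hO _ (hmem s hs))) t T ε hp.1 hp.2.1
    have := (hper.nat_mul l) t
    simp only at this ⊢
    rw [← hP] at this
    rw [this]
  have hend : x (P / P) = x (0 / P) := by
    simp only [div_self hPpos.ne', zero_div, hx, hy0, hy1, mul_zero, mul_one, add_zero]
    rw [(h.periodic.nat_mul m) a]
  obtain ⟨w, hw0, hwp, hwd, hwm⟩ := exists_periodic_extension hPpos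
    (F := fun x t => f x + ε • g x t T ε) (y := fun t => x (t / P)) hF hd hend
  refine ⟨w, fun t => ?_, ?_, hwd, hwp⟩
  · obtain ⟨s, hs, hws⟩ := hwm t
    rw [hws]
    exact hG.subset (hO _ (hmem s hs))
  · rw [hw0]
    simp [hx, hy0]

/-- The uniform bound `B` keeps `z + ε y` inside `O` for small `ε`, where the globalised equation is
the original one. The predicate `q` transports any additional condition along the branch. -/
theorem exists_isBranch [CompleteSpace E] {m l n : ℕ} {r : ℕ}
    (hG : IsGlobalisation U f H ε₁ g (m * τ / l) O fh Hh gh)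
    (h : ConservativeOrbit O fh Hh z τ) (hg : IsPerturbation U ε₁ r g) (hl : 0 < l)
    (hε₁ : 0 < ε₁) (hz : ContDiff ℝ n z)
    {s₀ B : ℝ} {ψ : ℝ → E × ℝ × ℝ} (hψ : ContDiffAt ℝ n ψ 0) (hψ0 : (ψ 0).2.2 = s₀)
    {q : E × (ℝ × ℝ × ℝ) → Prop}
    (hev : ∀ᶠ ε in 𝓝 (0 : ℝ), q ((ψ ε).1, ((ψ ε).2.1, (ψ ε).2.2, ε)) ∧
        ∃ y : ℝ → E, y 0 = (ψ ε).1 ∧ y 1 = (ψ ε).1 ∧ (∀ θ ∈ Icc (0 : ℝ) 1, ‖y θ‖ ≤ B) ∧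
          ∀ θ ∈ Icc (0 : ℝ) 1, HasDerivAt y
            (deviationField fh gh z (m * τ) l ((y θ, ((ψ ε).2.1, (ψ ε).2.2, ε)), θ)) θ) :
    ∃ ε₀ > 0, IsBranch U f g ε₁ z τ m l n s₀ ε₀ (fun ε => z (ψ ε).2.2 + ε • (ψ ε).1)
      (fun ε => m * τ / l + ε * (ψ ε).2.1) ∧
      ∀ ε ∈ Ico 0 ε₀, q ((ψ ε).1, ((ψ ε).2.1, (ψ ε).2.2, ε)) := by
  have hψ1 : ContDiffAt ℝ n (fun ε => (ψ ε).1) 0 := hψ.fst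
  have hψ2 : ContDiffAt ℝ n (fun ε => (ψ ε).2.1) 0 := hψ.snd.fst
  have hψ3 : ContDiffAt ℝ n (fun ε => (ψ ε).2.2) 0 := hψ.snd.snd
  have hξ : ContDiffAt ℝ n (fun ε => z (ψ ε).2.2 + ε • (ψ ε).1) 0 :=
    (hz.contDiffAt.comp 0 hψ3).add (contDiffAt_id.smul hψ1)
  have hT : ContDiffAt ℝ n (fun ε => m * τ / l + ε * (ψ ε).2.1) 0 :=
    contDiffAt_const.add (contDiffAt_id.mul hψ2)
  have hp : Tendsto (fun ε => (m * τ / l + ε * (ψ ε).2.1, ε)) (𝓝 0) (𝓝 (m * τ / l, 0)) := by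
    have h1 : ContinuousAt (fun ε => (m * τ / l + ε * (ψ ε).2.1, ε)) 0 :=
      hT.continuousAt.prodMk continuousAt_id
    simpa [ContinuousAt] using h1
  obtain ⟨δ, hδ, hthick⟩ := h.isCompact_range.exists_thickening_subset_open h.isOpen
    (range_subset_iff.2 h.mem)
  have hsmall : ∀ᶠ ε in 𝓝 (0 : ℝ), |ε| * B < δ := by
    have : Tendsto (fun ε : ℝ => |ε| * B) (𝓝 0) (𝓝 (|0| * B)) :=
      (continuous_abs.mul continuous_const).tendsto 0
    rw [abs_zero, zero_mul] at this
    exact this.eventually (gt_mem_nhds hδ)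
  have hall := (((hξ.eventually (by simp)).and (hT.eventually (by simp))).and
    (hp.eventually hG.g_eq)).and (hsmall.and hev)
  obtain ⟨ε₂, hε₂, hball⟩ := Metric.eventually_nhds_iff.1 hall
  have hmem : ∀ ε ∈ Ico 0 (min ε₂ ε₁), dist ε 0 < ε₂ := fun ε hε => by
    rw [Real.dist_eq, sub_zero, abs_of_nonneg hε.1]
    exact hε.2.trans_le (min_le_left _ _)
  refine ⟨min ε₂ ε₁, lt_min hε₂ hε₁, ⟨lt_min hε₂ hε₁, min_le_right _ _, ?_, ?_, ?_, ?_, ?_, ?_⟩,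
    fun ε hε => (hball (hmem ε hε)).2.2.1⟩
  · exact fun ε hε => (hball (hmem ε hε)).1.1.1.contDiffWithinAt
  · exact fun ε hε => (hball (hmem ε hε)).1.1.2.contDiffWithinAt
  · simp [hψ0]
  · simp
  · exact fun ε hε => (hball (hmem ε hε)).1.2.1
  · intro ε hε
    obtain ⟨⟨-, hpe⟩, hs, -, y, hy0, hy1, hyB, hy⟩ := hball (hmem ε hε)
    refine hG.hasPeriodicSolution h hg hl hpe hy0 hy1 hy fun θ hθ => hthick ?_
    rw [Metric.mem_thickening_iff]
    refine ⟨z ((ψ ε).2.2 + m * τ * θ), mem_range_self _, ?_⟩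
    rw [dist_eq_norm, add_sub_cancel_left, norm_smul, Real.norm_eq_abs]
    exact (mul_le_mul_of_nonneg_left (hyB θ hθ) (abs_nonneg _)).trans_lt hs

end IsGlobalisation
end Resonance

/-! ### Differentiation of families of conservative solutions -/

namespace Resonance

open Filter Topology

universe u

theorem eventually_mem_of_uniformly_close {E : Type*} [NormedAddCommGroup E] {O : Set E} {X : Type*}
    {l : Filter X} (hO : IsOpen O) {y : ℝ → E}
    (hyc : ContinuousOn y (Icc 0 1)) (hy : ∀ t ∈ Icc (0 : ℝ) 1, y t ∈ O) {S : X → ℝ → E}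
    (hS : ∀ η > 0, ∀ᶠ q in l, ∀ t ∈ Icc (0 : ℝ) 1, ‖S q t - y t‖ < η) :
    ∀ᶠ q in l, ∀ t ∈ Icc (0 : ℝ) 1, S q t ∈ O := by
  obtain ⟨δ, hδ, hthick⟩ := (isCompact_Icc.image_of_continuousOn hyc).exists_thickening_subset_open
    hO (image_subset_iff.2 hy)
  filter_upwards [hS δ hδ] with q hq t ht
  refine hthick (Metric.mem_thickening_iff.2 ⟨y t, mem_image_of_mem _ ht, ?_⟩)
  rw [dist_eq_norm]
  exact hq t ht

variable {E : Type u} [NormedAddCommGroup E] [NormedSpace ℝ E] [FiniteDimensional ℝ E]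
variable {U : Set E} {f : E → E} {z : ℝ → E} {τ : ℝ} {O : Set E} {fh : E → E} {Hh : E → ℝ}
  {Y : ℝ → E →L[ℝ] E}

/-- Differentiation of a family of solutions with respect to its parameter. -/
theorem ConservativeOrbit.hasDerivAt_family (h : ConservativeOrbit O fh Hh z τ)
    (hY : IsVariationalSolution fh z Y) (hU : IsOpen U) (hf : ContDiffOn ℝ 1 f U) (hOU : O ⊆ U)
    (hff : ∀ x ∈ O, fh x = f x) {X : ℝ → ℝ → E} {σ : ℝ → ℝ} {lam₀ σ' : ℝ} {η : E}
    (hX0 : X lam₀ = z)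
    (hX : ∀ᶠ lam in 𝓝 lam₀, (∀ t, X lam t ∈ U) ∧ ∀ t, HasDerivAt (X lam) (f (X lam t)) t)
    (hη : HasDerivAt (fun lam => X lam 0) η lam₀) (hσ : HasDerivAt σ σ' lam₀) :
    HasDerivAt (fun lam => X lam (σ lam)) (Y (σ lam₀) η + σ' • fh (z (σ lam₀))) lam₀ := by
  have := FiniteDimensional.complete ℝ E
  -- With the travel time as a parameter of the field, evaluation at the variable time `σ lam`
  -- becomes evaluation at time `1`.
  set V : (E × ℝ) × ℝ → E := fun w => w.1.2 • fh w.1.1 with hV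
  have hfh1 : ContDiff ℝ 1 fh := h.contDiff_f.of_le one_le_two
  have hVc : ContDiff ℝ (1 : ℕ) V := by
    rw [Nat.cast_one]
    exact ContDiff.smul (by fun_prop) (hfh1.comp (by fun_prop))
  have hsc : ∀ s t : ℝ, HasDerivAt (fun t : ℝ => s * t) s t := fun s t => by
    simpa using (hasDerivAt_id t).const_mul s
  set y : ℝ → E := fun t => z (σ lam₀ * t) with hy
  have hyd : ∀ t ∈ Icc (0 : ℝ) 1, HasDerivAt y (V ((y t, σ lam₀), t)) t := fun t _ =>
    (h.ode _).scomp t (hsc _ t)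
  have hyc : Continuous y := h.continuous.comp (continuous_const_mul _)
  obtain ⟨S, hSc, -, hS, hSb, hSw⟩ := exists_solution_map le_rfl hVc hyd
  have hy0 : y 0 = X lam₀ 0 := by simp [hy, hX0]
  set γ : ℝ → E × ℝ := fun lam => (X lam 0, σ lam) with hγ
  have hγd : HasDerivAt γ (η, σ') lam₀ := hη.prodMk hσ
  have hγ0 : γ lam₀ = (y 0, σ lam₀) := by rw [hy0]
  have hγt : Tendsto γ (𝓝 lam₀) (𝓝 (y 0, σ lam₀)) := hγ0 ▸ hγd.continuousAt.tendsto
  have hSd : HasFDerivAt (fun q => S q 1) (fderiv ℝ (fun q => S q 1) (y 0, σ lam₀)) (γ lam₀) := by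
    rw [hγ0]
    exact (hSc.differentiableAt (by simp)).hasFDerivAt
  have hcomp : HasDerivAt (fun lam => S (γ lam) 1)
      (fderiv ℝ (fun q => S q 1) (y 0, σ lam₀) (η, σ')) lam₀ :=
    HasFDerivAt.comp_hasDerivAt (f := γ) lam₀ hSd hγd
  have hev : (fun lam => X lam (σ lam)) =ᶠ[𝓝 lam₀] fun lam => S (γ lam) 1 := by
    filter_upwards [hX, hγt.eventually hS, hγt.eventually (eventually_mem_of_uniformly_close h.isOpen
      hyc.continuousOn (fun t _ => h.mem _) hSb)] with lam h1 h2 h3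
    have huniq := solution_unique hU (F := fun w => σ lam • f w.1) (y₁ := fun t => X lam (σ lam * t))
      (y₂ := S (γ lam))
      ((hf.comp contDiffOn_fst fun w hw => hw.1).const_smul _) (fun t _ => h1.1 _)
      (fun t ht => hOU (h3 t ht)) (fun t _ => (h1.2 _).scomp t (hsc _ t))
      (fun t ht => by
        have := h2.2 t ht
        simp only [hV] at this
        rwa [hff _ (h3 t ht)] at this)
      (by rw [h2.1]; simp [hγ])
    have := huniq (x := 1) (by simp)
    simpa using this
  refine HasDerivAt.congr_of_eventuallyEq ?_ hev
  convert hcomp using 1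
  obtain ⟨w, hw0, hw, hw1⟩ := hSw (η, σ')
  rw [hw1]
  have hzc : ContDiff ℝ 1 z := (contDiff_solution (n := 2) h.contDiff_f h.ode).of_le (by norm_num)
  have hF : ContDiff ℝ 1 fun p : E × ℝ =>
      σ lam₀ • fderiv ℝ fh (z (σ lam₀ * p.2)) p.1 + σ' • fh (z (σ lam₀ * p.2)) := by
    have h1 : ContDiff ℝ 1 (fderiv ℝ fh) := h.contDiff_f.fderiv_right (by norm_num)
    have h2 : ContDiff ℝ 1 fun p : E × ℝ => z (σ lam₀ * p.2) := hzc.comp (by fun_prop)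
    exact (((h1.comp h2).clm_apply contDiff_fst).const_smul _).add ((hfh1.comp h2).const_smul _)
  have hVd : ∀ x s t v s', fderiv ℝ V ((x, s), t) ((v, s'), 0) =
      s • fderiv ℝ fh x v + s' • fh x := by
    intro x s t v s'
    have h1 : HasFDerivAt (fun w : (E × ℝ) × ℝ => w.1.2)
        (ContinuousLinearMap.snd ℝ E ℝ ∘L ContinuousLinearMap.fst ℝ (E × ℝ) ℝ) ((x, s), t) :=
      (ContinuousLinearMap.snd ℝ E ℝ ∘L ContinuousLinearMap.fst ℝ (E × ℝ) ℝ).hasFDerivAt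
    have h2 : HasFDerivAt (fun w : (E × ℝ) × ℝ => fh w.1.1)
        (fderiv ℝ fh x ∘L ContinuousLinearMap.fst ℝ E ℝ ∘L ContinuousLinearMap.fst ℝ (E × ℝ) ℝ)
        ((x, s), t) :=
      HasFDerivAt.comp (g := fh) ((x, s), t) (hfh1.differentiable one_ne_zero x).hasFDerivAt
        (ContinuousLinearMap.fst ℝ E ℝ ∘L ContinuousLinearMap.fst ℝ (E × ℝ) ℝ).hasFDerivAt
    rw [show V = (fun w : (E × ℝ) × ℝ => w.1.2) • fun w => fh w.1.1 from rfl, (h1.smul h2).fderiv]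
    simp
  -- The derivative of the solution map is identified by an explicit solution of the linearised
  -- rescaled equation.
  have huniq := solution_unique isOpen_univ hF.contDiffOn (y₁ := w)
    (y₂ := fun t => Y (σ lam₀ * t) η + (σ' * t) • fh (z (σ lam₀ * t)))
    (fun _ _ => mem_univ _) (fun _ _ => mem_univ _)
    (fun t ht => by
      have := hw t ht
      rwa [hVd] at this)
    (fun t _ => by
      have h1 := (hY.hasDerivAt_apply η (σ lam₀ * t)).scomp t (hsc _ t)
      have h2 : HasDerivAt (fun t => fh (z t)) (fderiv ℝ fh (z (σ lam₀ * t))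
          (fh (z (σ lam₀ * t)))) (σ lam₀ * t) :=
        ((hfh1.differentiable one_ne_zero _).hasFDerivAt).comp_hasDerivAt _ (h.ode _)
      have h3 := h2.scomp t (hsc _ t)
      refine (h1.add ((hsc σ' t).smul h3)).congr_deriv ?_
      simp only [map_add, map_smul, Function.comp_apply]
      module)
    (by simp [hw0, hY.init])
  have := huniq (x := 1) (by simp)
  rw [this]
  simp

/-! ### Topologically transverse zeros -/

section Transverse

theorem isTransverseZero_neg {F : ℝ → ℝ} {s : ℝ} (h : IsTransverseZero (fun t => -F t) s) :
    IsTransverseZero F s := by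
  obtain ⟨a, b, ha, hb, hz, hs⟩ := h
  refine ⟨a, b, ha, hb, fun u hu => neg_eq_zero.1 (hz u hu), fun δ hδ => ?_⟩
  obtain ⟨u, hu, v, hv, huv⟩ := hs δ hδ
  exact ⟨u, hu, v, hv, by simpa using huv⟩

/-- Let `b` be the infimum of the points where `F < 0`, and `a` the supremum of the points before
`b` where `F > 0`. Then `F` vanishes on `[a, b]`, with positive values arbitrarily close to the left
and negative ones arbitrarily close to the right. -/
theorem exists_isTransverseZero_of_pos_of_neg {F : ℝ → ℝ} (hF : Continuous F) {p q : ℝ}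
    (hpq : p < q) (hp : 0 < F p) (hq : F q < 0) : ∃ s ∈ Ioo p q, IsTransverseZero F s := by
  set N : Set ℝ := {u | u ∈ Icc p q ∧ F u < 0} with hN
  have hNne : N.Nonempty := ⟨q, ⟨hpq.le, le_rfl⟩, hq⟩
  have hNb : BddBelow N := ⟨p, fun u hu => hu.1.1⟩
  set b := sInf N with hb
  have hpb : p ≤ b := le_csInf hNne fun u hu => hu.1.1
  have hbq : b ≤ q := csInf_le hNb ⟨⟨hpq.le, le_rfl⟩, hq⟩
  have hFb0 : F b ≤ 0 := by
    have hmem : b ∈ closure N := csInf_mem_closure hNne hNb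
    have hsub : N ⊆ {u | F u ≤ 0} := fun u hu => hu.2.le
    exact closure_minimal hsub (isClosed_le hF continuous_const) hmem
  have hpos : ∀ u ∈ Ico p b, 0 ≤ F u := fun u hu => by
    by_contra! hneg
    exact absurd (csInf_le hNb ⟨⟨hu.1, hu.2.le.trans hbq⟩, hneg⟩) (not_le.2 hu.2)
  have hpb' : p < b := lt_of_le_of_ne hpb fun h => by rw [← h] at hFb0; linarith
  have hFb : F b = 0 := by
    refine le_antisymm hFb0 ?_
    have hmem : b ∈ closure (Ico p b) := by
      rw [closure_Ico hpb'.ne]; exact ⟨hpb, le_rfl⟩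
    exact closure_minimal (show Ico p b ⊆ {u | 0 ≤ F u} from hpos)
      (isClosed_le continuous_const hF) hmem
  have hbq' : b < q := lt_of_le_of_ne hbq fun h => by rw [h] at hFb; linarith
  set M : Set ℝ := {u | u ∈ Icc p b ∧ 0 < F u} with hM
  have hMne : M.Nonempty := ⟨p, ⟨le_rfl, hpb⟩, hp⟩
  have hMb : BddAbove M := ⟨b, fun u hu => hu.1.2⟩
  set a := sSup M with ha
  have hpa : p ≤ a := le_csSup hMb ⟨⟨le_rfl, hpb⟩, hp⟩
  have hab : a ≤ b := csSup_le hMne fun u hu => hu.1.2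
  have hzero : ∀ u ∈ Ioc a b, F u = 0 := by
    intro u hu
    rcases hu.2.eq_or_lt with rfl | hlt
    · exact hFb
    · refine le_antisymm ?_ (hpos u ⟨hpa.trans hu.1.le, hlt⟩)
      by_contra! h
      exact absurd (le_csSup hMb ⟨⟨hpa.trans hu.1.le, hu.2⟩, h⟩) (not_le.2 hu.1)
  have hFa : F a = 0 := by
    rcases hab.eq_or_lt with heq | hlt
    · rw [heq, hFb]
    · have hmem : a ∈ closure (Ioc a b) := by
        rw [closure_Ioc hlt.ne]; exact ⟨le_rfl, hab⟩
      exact closure_minimal (show Ioc a b ⊆ {u | F u = 0} from hzero)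
        (isClosed_eq hF continuous_const) hmem
  refine ⟨b, ⟨hpb', hbq'⟩, a, b, hab, le_rfl, fun u hu => ?_, fun δ hδ => ?_⟩
  · rcases hu.1.eq_or_lt with rfl | hlt
    · exact hFa
    · exact hzero u ⟨hlt, hu.2⟩
  · obtain ⟨u, hu, hua⟩ := exists_lt_of_lt_csSup hMne (show a - δ < sSup M by linarith)
    obtain ⟨v, hv, hvb⟩ := exists_lt_of_csInf_lt hNne (show sInf N < b + δ by linarith)
    have hua' : u < a := lt_of_le_of_ne (le_csSup hMb hu) fun h => by
      have := hu.2; rw [h, hFa] at this; exact lt_irrefl _ this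
    have hvb' : b < v := lt_of_le_of_ne (csInf_le hNb hv) fun h => by
      have := hv.2; rw [← h, hFb] at this; exact lt_irrefl _ this
    exact ⟨u, ⟨hua, hua'⟩, v, ⟨hvb', hvb⟩, mul_neg_of_pos_of_neg hu.2 hv.2⟩

/-- A continuous periodic function with a simple zero has a further transverse zero within the
period. -/
theorem exists_further_isTransverseZero {F : ℝ → ℝ} (hF : Continuous F) {P : ℝ} (hP : 0 < P)
    (hper : Function.Periodic F P) {s₀ : ℝ} (h0 : F s₀ = 0) (hd : deriv F s₀ ≠ 0) :
    ∃ s ∈ Ioo s₀ (s₀ + P), IsTransverseZero F s := by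
  wlog hpos : 0 < deriv F s₀ generalizing F
  · have hneg : 0 < deriv (fun t => -F t) s₀ := by
      rw [deriv.fun_neg]
      exact neg_pos.2 (lt_of_le_of_ne (not_lt.1 hpos) hd)
    obtain ⟨s, hs, hst⟩ := this hF.neg (fun t => by simp [hper t]) (by simp [h0]) hneg.ne' hneg
    exact ⟨s, hs, isTransverseZero_neg hst⟩
  have hda : HasDerivAt F (deriv F s₀) s₀ := (differentiableAt_of_deriv_ne_zero hd).hasDerivAt
  have hslope := (hasDerivAt_iff_tendsto_slope.1 hda).eventually (lt_mem_nhds hpos)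
  rw [eventually_nhdsWithin_iff] at hslope
  obtain ⟨δ, hδ, hball⟩ := Metric.eventually_nhds_iff.1 hslope
  -- The bound `P / 3` ensures `s₀ + η < s₀ + P - η`.
  set η := min (δ / 2) (P / 3) with hη
  have hηpos : 0 < η := by positivity
  have hηδ : η < δ := (min_le_left _ _).trans_lt (by linarith)
  have hηP : η ≤ P / 3 := min_le_right _ _
  have h1 : 0 < F (s₀ + η) := by
    have := hball (y := s₀ + η) (by simp [abs_of_pos hηpos, hηδ])
      (by simp [hηpos.ne'])
    simp only [slope, vsub_eq_sub, h0, sub_zero, smul_eq_mul, add_sub_cancel_left] at this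
    exact (mul_pos_iff_of_pos_left (inv_pos.2 hηpos)).1 this
  have h2 : F (s₀ + P - η) < 0 := by
    have := hball (y := s₀ - η) (by simp [abs_of_pos hηpos, hηδ])
      (by simp [hηpos.ne'])
    simp only [slope, vsub_eq_sub, h0, sub_zero, smul_eq_mul] at this
    have h3 : (s₀ - η - s₀)⁻¹ < 0 := inv_lt_zero.2 (by linarith)
    have h4 : F (s₀ - η) < 0 := by
      by_contra! hge
      exact absurd this (not_lt.2 (mul_nonpos_of_nonpos_of_nonneg h3.le hge))
    have h5 := hper (s₀ - η)
    rw [show s₀ + P - η = s₀ - η + P by ring, h5]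
    exact h4
  obtain ⟨s, hs, hst⟩ := exists_isTransverseZero_of_pos_of_neg hF
    (show s₀ + η < s₀ + P - η by linarith) h1 h2
  exact ⟨s, ⟨by linarith [hs.1], by linarith [hs.2]⟩, hst⟩

end Transverse
end Resonance

/-! ### Persistence at simple zeros, free and along a level of `L` -/

namespace Resonance

open Filter Topology

universe u

variable {E : Type u} [NormedAddCommGroup E] [NormedSpace ℝ E]
variable {U : Set E} {r : ℕ} {f : E → E} {H : E → ℝ} {ε₁ : ℝ} {g : E → ℝ → ℝ → ℝ → E}
  {z : ℝ → E} {τ : ℝ} {O : Set E} {fh : E → E} {Hh : E → ℝ} {gh : (E × ℝ × ℝ) × ℝ → E}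
  {Y : ℝ → E →L[ℝ] E} {m l n : ℕ} {s₀ : ℝ}

/-- If the velocity vanished at one point it would vanish along the orbit; a constant `z` has period
`τ / 2`, against minimality. -/
theorem ConservativeOrbit.velocity_ne_zero (h : ConservativeOrbit O fh Hh z τ)
    (hY : IsVariationalSolution fh z Y)
    (hmin : ∀ σ, 0 < σ → σ < τ → ¬ Function.Periodic z σ) : fh (z 0) ≠ 0 := by
  intro h0
  have hd : ∀ t, HasDerivAt z 0 t := fun t => by
    have := h.ode t
    rwa [← h.variational_apply_velocity hY, h0, map_zero] at this
  refine hmin (τ / 2) (half_pos h.pos) (half_lt_self h.pos) fun t => ?_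
  exact is_const_of_deriv_eq_zero (fun t => (hd t).differentiableAt) (fun t => (hd t).deriv) _ _

theorem IsGlobalisation.persistsAt [FiniteDimensional ℝ E]
    (hG : IsGlobalisation U f H ε₁ g (m * τ / l) O fh Hh gh)
    (h : ConservativeOrbit O fh Hh z τ) (hg : IsPerturbation U ε₁ r g) (hl : 0 < l) (hε₁ : 0 < ε₁)
    (hn : 1 ≤ n) (hfh : ContDiff ℝ (n + 1 : ℕ) fh) (hgh : ContDiff ℝ n gh)
    (hY : IsVariationalSolution fh z Y) (hfz : fh (z 0) ≠ 0)
    (hnormal : Module.finrank ℝ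
        (Module.End.eigenspace ((Y τ ^ m : E →L[ℝ] E) : Module.End ℝ E) 1) = 1 ∨
      (Module.finrank ℝ
        (Module.End.eigenspace ((Y τ ^ m : E →L[ℝ] E) : Module.End ℝ E) 1) = 2 ∧
        ¬ ∃ v : E, (Y τ ^ m) v - v = fh (z 0)))
    (hM : melnikov Hh (curried gh) z τ m l s₀ = 0)
    (hM' : deriv (melnikov Hh (curried gh) z τ m l) s₀ ≠ 0)
    (hH : ∀ a, fderiv ℝ Hh (z a) ≠ 0) :
    PersistsAt U f g ε₁ z τ m l n s₀ := by
  have := FiniteDimensional.complete ℝ E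
  have hh : ∀ w, fderiv ℝ Hh (z 0) (periodDefect (Y τ ^ m) (fh (z 0)) l w) = 0 := fun w => by
    simpa [hY.init] using h.fderiv_variational_periodDefect (m := m) hY 0 l w
  obtain ⟨k, κ, hk, hκu, hκk⟩ := exists_ker_independent (hH 0) hh (fh (z 0), 0)
  obtain ⟨e, he⟩ := isInvertible_of_injective (L := Y s₀) fun x hx =>
    h.variational_injective hY s₀ (hx.trans (map_zero _).symm)
  have heY : ∀ x, e.symm (Y s₀ x) = x := fun x => by rw [← he]; simp
  -- The functional `κ` is adapted to `p = z 0`; the inverse of `Y s₀` transports it to `z s₀`.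
  -- Without a prescribed constraint any such normalisation serves as `q`.
  set κ' : E × ℝ →L[ℝ] ℝ :=
    κ ∘L ((e.symm : E →L[ℝ] E).prodMap (ContinuousLinearMap.id ℝ ℝ)) with hκ'
  obtain ⟨ψ, B, hψ, hψ0, hev⟩ := h.exists_deviation_branch hn hfh hgh hl hY hfz hnormal hM hM'
    (hH s₀) (q := fun w => κ' (w.1, w.2.1)) (κ := κ') (κ'.contDiff.comp (by fun_prop))
    (fun _ _ => rfl)
    (by rw [← h.variational_apply_velocity hY]; simpa [hκ', heY] using hκu) hk
    (by simp [hκ', heY, hκk])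
  obtain ⟨ε₀, -, hb, -⟩ := hG.exists_isBranch h hg hl hε₁
    ((contDiff_solution hfh h.ode).of_le (by exact_mod_cast (by omega : n ≤ n + 1 + 1))) hψ hψ0
    (q := fun _ => True) (hev.mono fun _ hε => ⟨trivial, hε.2⟩)
  exact ⟨ε₀, _, _, hb⟩

/-- The tangent of the family is the second kernel vector: differentiating `X_lam(m 𝒯(lam)) =
X_lam(0)` puts it in the kernel of `periodDefect`. Differentiating `L = lam` along the family shows
that `DL` equals `1` on it, and constancy of `L` along `z` that `DL` vanishes on the velocity. -/
theorem IsGlobalisation.persistsAlong [FiniteDimensional ℝ E]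
    (hG : IsGlobalisation U f H ε₁ g (m * τ / l) O fh Hh gh)
    (h : ConservativeOrbit O fh Hh z τ) (hg : IsPerturbation U ε₁ r g) (hl : 0 < l) (hε₁ : 0 < ε₁)
    (hU : IsOpen U) (hf : ContDiffOn ℝ 1 f U)
    (hn : 1 ≤ n) (hfh : ContDiff ℝ (n + 1 : ℕ) fh) (hgh : ContDiff ℝ n gh)
    (hY : IsVariationalSolution fh z Y) (hfz : fh (z 0) ≠ 0)
    (hnormal : Module.finrank ℝ
        (Module.End.eigenspace ((Y τ ^ m : E →L[ℝ] E) : Module.End ℝ E) 1) = 1 ∨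
      (Module.finrank ℝ
        (Module.End.eigenspace ((Y τ ^ m : E →L[ℝ] E) : Module.End ℝ E) 1) = 2 ∧
        ¬ ∃ v : E, (Y τ ^ m) v - v = fh (z 0)))
    (hM : melnikov Hh (curried gh) z τ m l s₀ = 0)
    (hM' : deriv (melnikov Hh (curried gh) z τ m l) s₀ ≠ 0)
    (hH : ∀ a, fderiv ℝ Hh (z a) ≠ 0) {L : E × ℝ → ℝ} (hL : Parametrises U f z τ m (n + 1) L) :
    PersistsAlong U f g ε₁ z τ m l n L s₀ := by
  have := FiniteDimensional.complete ℝ E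
  have hl' : (l : ℝ) ≠ 0 := by exact_mod_cast hl.ne'
  obtain ⟨⟨V, hV, hzV, hLV⟩, δ, X, 𝒯, hδ, hX0, h𝒯0, hXc, h𝒯c, hX⟩ := hL
  set lam₀ := L (z 0, m * τ) with hlam₀
  have hK : IsCompact (range z ×ˢ ({m * τ} : Set ℝ)) := by
    rw [← h.periodic.image_uIcc h.pos.ne' 0]
    exact (isCompact_uIcc.image h.continuous).prod isCompact_singleton
  obtain ⟨Lh, hLhc, hLhe⟩ := exists_contDiff_extension (n := n + 1) hV hK
    (by rintro ⟨x, t⟩ ⟨⟨s, rfl⟩, rfl⟩; exact hzV s) hLV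
  have hLe : ∀ s, ∀ᶠ x in 𝓝 (z s, m * τ), Lh x = L x := fun s =>
    hLhe.filter_mono (nhds_le_nhdsSet (mk_mem_prod (mem_range_self s) (mem_singleton _)))
  have hLz : ∀ s, Lh (z s, m * τ) = lam₀ := fun s => by
    rw [(hLe s).self_of_nhds]
    have := (hX lam₀ (Metric.mem_ball_self hδ)).2.2.2.2 s
    rwa [hX0, h𝒯0] at this
  have hLd : ∀ s, HasFDerivAt Lh (fderiv ℝ Lh (z s, m * τ)) (z s, m * τ) := fun s =>
    (hLhc.differentiable (by simp) _).hasFDerivAt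
  have hball := Metric.ball_mem_nhds lam₀ hδ
  have hη : HasDerivAt (fun lam => X lam 0) (deriv (fun lam => X lam 0) lam₀) lam₀ :=
    ((hXc.contDiffAt hball).differentiableAt one_ne_zero).hasDerivAt
  have h𝒯 : HasDerivAt 𝒯 (deriv 𝒯 lam₀) lam₀ :=
    ((h𝒯c.contDiffAt hball).differentiableAt one_ne_zero).hasDerivAt
  set η := deriv (fun lam => X lam 0) lam₀
  set 𝒯' := deriv 𝒯 lam₀
  have hXev : ∀ᶠ lam in 𝓝 lam₀, (∀ t, X lam t ∈ U) ∧ ∀ t, HasDerivAt (X lam) (f (X lam t)) t :=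
    mem_of_superset hball fun lam hlam => ⟨(hX lam hlam).2.1, (hX lam hlam).2.2.1⟩
  -- the tangent of the family lies in the kernel of the period defect
  have hk : periodDefect (Y τ ^ m) (fh (z 0)) l (η, m * 𝒯' / l) = 0 := by
    have h1 := h.hasDerivAt_family hY hU hf hG.subset hG.f_eq hX0 hXev hη (h𝒯.const_mul (m : ℝ))
    have h2 : (fun lam => X lam (m * 𝒯 lam)) =ᶠ[𝓝 lam₀] fun lam => X lam 0 :=
      mem_of_superset hball fun lam hlam => by
        simpa using ((hX lam hlam).2.2.2.1.nat_mul m) 0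
    have h3 := (h2.hasDerivAt_iff.1 h1).unique hη
    have h4 := h.variational_add_period hY m 0 η
    have h5 : z (m * τ) = z 0 := by simpa using (h.periodic.nat_mul m) 0
    rw [hY.init, zero_add] at h4
    rw [h𝒯0, h4, h5] at h3
    rw [periodDefect_apply, mul_div_cancel₀ _ hl']
    simp only [ContinuousLinearMap.id_apply] at h3
    rw [sub_add_eq_add_sub, h3, sub_self]
  have hκk : fderiv ℝ Lh (z s₀, m * τ) (Y s₀ η, m * 𝒯') = 1 := by
    have h1 := h.hasDerivAt_family hY hU hf hG.subset hG.f_eq hX0 hXev hη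
      (hasDerivAt_const lam₀ s₀)
    rw [zero_smul, add_zero] at h1
    have h2 : HasDerivAt (fun lam => (X lam s₀, m * 𝒯 lam)) (Y s₀ η, m * 𝒯') lam₀ :=
      h1.prodMk (h𝒯.const_mul (m : ℝ))
    have h0 : (fun lam => (X lam s₀, m * 𝒯 lam)) lam₀ = (z s₀, m * τ) := by simp [hX0, h𝒯0]
    have h3 := HasFDerivAt.comp_hasDerivAt (l := Lh) lam₀ (h0 ▸ hLd s₀) h2
    rw [h0] at h3
    have h4 : (Lh ∘ fun lam => (X lam s₀, m * 𝒯 lam)) =ᶠ[𝓝 lam₀] fun lam => lam := by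
      have h5 := h2.continuousAt.tendsto
      rw [hX0, h𝒯0] at h5
      filter_upwards [h5.eventually (hLe s₀), hball] with lam h6 hlam
      rw [Function.comp_apply, h6]
      exact (hX lam hlam).2.2.2.2 s₀
    exact (h4.hasDerivAt_iff.1 h3).unique (hasDerivAt_id lam₀)
  have hκu : fderiv ℝ Lh (z s₀, m * τ) (fh (z s₀), 0) = 0 := by
    have h3 := (hLd s₀).comp_hasDerivAt s₀ ((h.ode s₀).prodMk (hasDerivAt_const s₀ (m * τ)))
    have h4 : (Lh ∘ fun t => (z t, m * τ)) = fun _ => lam₀ := funext hLz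
    rw [h4] at h3
    exact h3.unique (hasDerivAt_const _ _)
  -- the resonance condition, divided by `ε`
  obtain ⟨φ, hφ⟩ := SeparatingDual.exists_eq_one (R := ℝ) hfz
  set e₀ := fh (z 0)
  -- The Hadamard quotient needs a target in the universe of `E`, so `L` is placed on the line of
  -- `e₀` and recovered by `φ`, with `φ e₀ = 1`.
  set Lv : E × ℝ → E := fun x => Lh x • e₀ with hLv
  have hLvc : ContDiff ℝ (n + 1 : ℕ) Lv := hLhc.smul contDiff_const
  have hzc : ContDiff ℝ n z :=
    (contDiff_solution hfh h.ode).of_le (by exact_mod_cast (by omega : n ≤ n + 1 + 1))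
  set q : E × (ℝ × ℝ × ℝ) → ℝ := fun w =>
    φ (hadamardQuotient Lv ((z w.2.2.1, m * τ), (w.1, l * w.2.1), w.2.2.2)) with hq
  have hqc : ContDiff ℝ n q := by
    have h1 : ContDiff ℝ n fun w : E × (ℝ × ℝ × ℝ) => z w.2.2.1 := hzc.comp (by fun_prop)
    exact φ.contDiff.comp ((contDiff_hadamardQuotient hLvc).comp (by fun_prop))
  have hqs : ∀ v T₁ a ε, Lh (z a + ε • v, m * τ + ε * (l * T₁)) = lam₀ + ε * q (v, (T₁, a, ε)) := by
    intro v T₁ a ε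
    have h1 := congrArg φ (hadamardQuotient_spec
      (hLvc.of_le (by exact_mod_cast (by omega : 1 ≤ n + 1))) (z a, m * τ) (v, l * T₁) ε)
    simpa [hLv, hφ, hLz, hq] using h1
  set κ : E × ℝ →L[ℝ] ℝ := fderiv ℝ Lh (z s₀, m * τ) ∘L
    (ContinuousLinearMap.id ℝ E).prodMap ((l : ℝ) • ContinuousLinearMap.id ℝ ℝ) with hκ
  have hqκ : ∀ v T₁, q (v, (T₁, s₀, 0)) = κ (v, T₁) := by
    intro v T₁
    have : fderiv ℝ Lv (z s₀, m * τ) = _ := ((hLd s₀).smul_const e₀).fderiv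
    simp [hq, hadamardQuotient_zero, this, hφ, hκ]
  obtain ⟨ψ, B, hψ, hψ0, hev⟩ := h.exists_deviation_branch hn hfh hgh hl hY hfz hnormal hM hM'
    (hH s₀) hqc hqκ (by simpa [hκ] using hκu) hk
    (by simp [hκ, mul_div_cancel₀ _ hl', hκk])
  have hnear : ∀ᶠ ε in 𝓝 (0 : ℝ),
      L (z (ψ ε).2.2 + ε • (ψ ε).1, l * (m * τ / l + ε * (ψ ε).2.1)) = lam₀ := by
    have h1 : ContinuousAt (fun ε : ℝ =>
        (z (ψ ε).2.2 + ε • (ψ ε).1, l * (m * τ / l + ε * (ψ ε).2.1))) 0 := by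
      have h2 := hψ.continuousAt
      have h3 : ContinuousAt (fun ε => z (ψ ε).2.2) 0 :=
        h.continuous.continuousAt.comp h2.snd.snd
      exact (h3.add (continuousAt_id.smul h2.fst)).prodMk
        (continuousAt_const.mul (continuousAt_const.add (continuousAt_id.mul h2.snd.fst)))
    have h2 := h1.tendsto
    simp only [hψ0, zero_smul, add_zero, zero_mul, mul_div_cancel₀ _ hl'] at h2
    filter_upwards [h2.eventually (hLe s₀), hev] with ε h3 h4
    have h5 := hqs (ψ ε).1 (ψ ε).2.1 (ψ ε).2.2 ε
    rw [h4.1, mul_zero, add_zero] at h5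
    rw [← h3, ← h5]
    congr 2
    field_simp
  obtain ⟨ε₀, -, hb, hc⟩ := hG.exists_isBranch h hg hl hε₁ hzc hψ hψ0
    (q := fun w => L (z w.2.2.1 + w.2.2.2 • w.1, l * (m * τ / l + w.2.2.2 * w.2.1)) = lam₀)
    (hnear.and (hev.mono fun _ => And.right))
  exact ⟨ε₀, _, _, hb, hc⟩

end Resonance

/-! ### Non-persistence where the Melnikov function does not vanish -/

namespace Resonance

open Filter Topology

universe u

/-- Compactness of the orbit turns the pointwise neighbourhoods into a `δ`-tube in `E × ℝ × ℝ`. The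
bound `δ / (|C| + 1)` makes `C ε`, and `ε` itself, less than `δ`. -/
theorem exists_forall_not_of_eventually {E : Type*} [NormedAddCommGroup E] {z : ℝ → E}
    {Q : E × ℝ × ℝ → Prop} {T₀ : ℝ}
    (hK : IsCompact (range z)) (hQ : ∀ s, ∀ᶠ q : E × ℝ × ℝ in 𝓝 (z s, (T₀, 0)), Q q) (C : ℝ) :
    ∃ ε₀ > 0, ∀ ε ∈ Ioo 0 ε₀, ∀ (s : ℝ) (ξ : E) (T : ℝ),
      ‖ξ - z s‖ ≤ C * ε → |T - T₀| ≤ C * ε → Q (ξ, (T, ε)) := by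
  have hK2 : IsCompact (range z ×ˢ ({(T₀, 0)} : Set (ℝ × ℝ))) := hK.prod isCompact_singleton
  have hev : ∀ᶠ q in 𝓝ˢ (range z ×ˢ ({(T₀, 0)} : Set (ℝ × ℝ))), Q q := by
    refine eventually_nhdsSet_iff_forall.2 ?_
    rintro ⟨x, p⟩ ⟨⟨s, rfl⟩, rfl⟩
    exact hQ s
  obtain ⟨W, hW, hKW, hWQ⟩ := mem_nhdsSet_iff_exists.1 hev
  obtain ⟨δ, hδ, hthick⟩ := hK2.exists_thickening_subset_open hW hKW
  refine ⟨δ / (|C| + 1), by positivity, fun ε hε s ξ T hξ hT => hWQ (hthick ?_)⟩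
  have h1 : (|C| + 1) * ε < δ := by
    rw [mul_comm]
    exact (lt_div_iff₀ (by positivity)).1 hε.2
  have h2 : C * ε ≤ |C| * ε := mul_le_mul_of_nonneg_right (le_abs_self C) hε.1.le
  have h3 : 0 ≤ |C| * ε := mul_nonneg (abs_nonneg C) hε.1.le
  have hε0 := hε.1
  refine Metric.mem_thickening_iff.2 ⟨(z s, (T₀, 0)), ⟨mem_range_self s, rfl⟩, ?_⟩
  rw [Prod.dist_eq, Prod.dist_eq, dist_eq_norm, Real.dist_eq, Real.dist_0_eq_abs, abs_of_pos hε0]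
  exact max_lt (by linarith) (max_lt (by linarith) (by linarith))

variable {E : Type u} [NormedAddCommGroup E] [NormedSpace ℝ E]
variable {U : Set E} {r : ℕ} {f : E → E} {H : E → ℝ} {ε₁ : ℝ} {g : E → ℝ → ℝ → ℝ → E}
  {z : ℝ → E} {τ : ℝ} {O : Set E} {fh : E → E} {Hh : E → ℝ} {gh : (E × ℝ × ℝ) × ℝ → E}
  {m l : ℕ}

/-- Where the Melnikov function does not vanish, no periodic solutions of the perturbed system
start nearby. -/
theorem IsGlobalisation.eventually_not_hasPeriodicSolution [FiniteDimensional ℝ E]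
    (hG : IsGlobalisation U f H ε₁ g (m * τ / l) O fh Hh gh)
    (h : ConservativeOrbit O fh Hh z τ) (hU : IsOpen U) (hf : ContDiffOn ℝ 1 f U)
    (hr : 2 ≤ r) (hg : IsPerturbation U ε₁ r g) (hl : 0 < l) (hgh : ContDiff ℝ 1 gh)
    {s : ℝ} (hM : melnikov Hh (curried gh) z τ m l s ≠ 0) :
    ∀ᶠ q : E × ℝ × ℝ in 𝓝 (z s, (m * τ / l, 0)), q.2.2 ≠ 0 →
      ¬ HasPeriodicSolution U f g q.2.1 q.2.2 (l * q.2.1) q.1 := by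
  have := FiniteDimensional.complete ℝ E
  have hl' : (l : ℝ) ≠ 0 := by exact_mod_cast hl.ne'
  set p : ℝ × ℝ := (m * τ / l, 0) with hp
  have hsc : ∀ s t : ℝ, HasDerivAt (fun t : ℝ => s * t) s t := fun s t => by
    simpa using (hasDerivAt_id t).const_mul s
  have hfh1 : ContDiff ℝ 1 fh := h.contDiff_f.of_le one_le_two
  set V : (E × ℝ × ℝ) × ℝ → E := fun w =>
    (l * w.1.2.1) • (fh w.1.1 + w.1.2.2 • gh (w.1, l * w.1.2.1 * w.2)) with hV
  have hVc : ContDiff ℝ (1 : ℕ) V := by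
    rw [Nat.cast_one]
    have h1 : ContDiff ℝ 1 fun w : (E × ℝ × ℝ) × ℝ => fh w.1.1 := hfh1.comp (by fun_prop)
    have h2 : ContDiff ℝ 1 fun w : (E × ℝ × ℝ) × ℝ => gh (w.1, l * w.1.2.1 * w.2) :=
      hgh.comp (by fun_prop)
    exact ContDiff.smul (by fun_prop) (h1.add (ContDiff.smul (by fun_prop) h2))
  set y : ℝ → E := fun θ => z (s + m * τ * θ) with hy
  have hyc : Continuous y := h.continuous.comp (by fun_prop)
  have hyd : ∀ θ ∈ Icc (0 : ℝ) 1, HasDerivAt y (V ((y θ, p), θ)) θ := fun θ _ => by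
    have h1 := (h.ode (s + m * τ * θ)).scomp θ ((hsc (m * τ) θ).const_add s)
    refine h1.congr_deriv ?_
    simp [hV, hp, hy, mul_div_cancel₀ _ hl']
  obtain ⟨S, -, -, hS, hSb, -⟩ := exists_solution_map le_rfl hVc hyd
  have hy0 : y 0 = z s := by simp [hy]
  rw [hy0] at hS hSb
  have hSO := eventually_mem_of_uniformly_close h.isOpen hyc.continuousOn
    (fun θ _ => h.mem (s + m * τ * θ)) hSb
  -- the power of the perturbation
  set G : E × (ℝ × ℝ) × ℝ → ℝ := fun w =>
    fderiv ℝ Hh w.1 (gh ((w.1, w.2.1), l * w.2.1.1 * w.2.2)) with hGdef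
  have hGc : Continuous G := by
    have h1 : Continuous fun w : E × (ℝ × ℝ) × ℝ => fderiv ℝ Hh w.1 :=
      h.continuous_fderiv_H.comp continuous_fst
    have h2 : Continuous fun w : E × (ℝ × ℝ) × ℝ => gh ((w.1, w.2.1), l * w.2.1.1 * w.2.2) :=
      hgh.continuous.comp (by fun_prop)
    exact h1.clm_apply h2
  have hGy : Continuous fun θ => G (y θ, p, θ) := hGc.comp (by fun_prop)
  set c₀ := ∫ θ in (0 : ℝ)..1, G (y θ, p, θ) with hc₀
  have hc₀' : c₀ ≠ 0 := by
    rw [melnikov_eq_integral_unit, intervalIntegral.integral_const_mul] at hM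
    simpa [hc₀, hGdef, hp, mul_div_cancel₀ _ hl', curried] using right_ne_zero_of_mul hM
  have hclose : ∀ᶠ q in 𝓝 (z s, p), ∀ θ ∈ Icc (0 : ℝ) 1,
      ‖G (S q θ, q.2, θ) - G (y θ, p, θ)‖ < |c₀| / 2 := by
    -- Uniform closeness in `θ` is expressed as membership in an open set. The time component of `w`
    -- selects the reference point for comparison.
    have hW : IsOpen {w : E × (ℝ × ℝ) × ℝ | ‖G w - G (y w.2.2, p, w.2.2)‖ < |c₀| / 2} :=
      isOpen_lt (by fun_prop) continuous_const
    refine eventually_mem_of_uniformly_close hW (y := fun θ => (y θ, p, θ))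
      (by fun_prop) (fun θ _ => by simpa using hc₀') (S := fun q θ => (S q θ, q.2, θ)) ?_
    intro η hη
    have h1 : ∀ᶠ q : E × ℝ × ℝ in 𝓝 (z s, p), ‖q.2 - p‖ < η := by
      have : Continuous fun q : E × ℝ × ℝ => ‖q.2 - p‖ := by fun_prop
      exact this.continuousAt.eventually_lt_const (by simpa using hη)
    filter_upwards [hSb η hη, h1] with q h2 h3 θ hθ
    simp only [Prod.mk_sub_mk, sub_self, Prod.norm_def (_, _), norm_zero]
    exact max_lt (h2 θ hθ) (max_lt h3 hη)
  have hev : ∀ᶠ q : E × ℝ × ℝ in 𝓝 (z s, p), 0 < q.2.1 ∧ q.2.2 ∈ Ioo (-ε₁) ε₁ ∧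
      ∀ x ∈ O, ∀ t, gh ((x, q.2), t) = g x t q.2.1 q.2.2 :=
    (continuous_snd.tendsto (z s, p)).eventually hG.g_eq
  filter_upwards [hS, hSO, hclose, hev] with ⟨ξ, T, ε⟩ ⟨hS0, hSd⟩ hSO hcl ⟨hT, hε, hge⟩ hε0
  rintro ⟨x, hxU, hx0, hxd, hxp⟩
  simp only at hS0 hSd hSO hcl hT hε hge hε0 hxd hxp
  set S' := S (ξ, T, ε) with hS'
  set P := l * T with hP
  have hP0 : P ≠ 0 := mul_ne_zero hl' hT.ne'
  -- The given periodic solution is only known to stay in `U`. Uniqueness identifies it over one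
  -- period with the nearby solution, which stays in `O`.
  have huniq : EqOn S' (fun θ => x (P * θ)) (Icc 0 1) := by
    refine solution_unique hU
      (F := fun w => P • (f w.1 + ε • g w.1 (P * w.2) T ε)) ?_ (fun θ hθ => hG.subset (hSO θ hθ))
      (fun θ _ => hxU _) (fun θ hθ => ?_) (fun θ _ => ?_) (by simp [hx0, hS0])
    · have h1 : ContDiffOn ℝ 1 (fun w : E × ℝ => f w.1) (U ×ˢ univ) :=
        hf.comp contDiff_fst.contDiffOn fun w hw => hw.1
      have h2 : ContDiffOn ℝ 1 (fun w : E × ℝ => g w.1 (P * w.2) T ε) (U ×ˢ univ) :=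
        (hg.joint.of_le (by exact_mod_cast (by omega : 1 ≤ r - 1))).comp
          (f := fun w : E × ℝ => ((w.1, T, ε), P * w.2))
          (ContDiff.contDiffOn (by fun_prop)) fun w hw => ⟨⟨hw.1, hT, hε⟩, mem_univ _⟩
      exact contDiffOn_const.smul (h1.add (contDiffOn_const.smul h2))
    · have := hSd θ hθ
      simp only [hV] at this
      rwa [hG.f_eq _ (hSO θ hθ), hge _ (hSO θ hθ)] at this
    · exact (hxd (P * θ)).scomp θ (hsc P θ)
  have hS1 : S' 1 = S' 0 := by
    rw [huniq (x := 1) (by simp), hS0]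
    simpa [hx0] using hxp 0
  have hSc : ContinuousOn S' (Icc 0 1) := fun θ hθ => (hSd θ hθ).continuousAt.continuousWithinAt
  have hGS : ContinuousOn (fun θ => G (S' θ, (T, ε), θ)) (Icc 0 1) :=
    hGc.comp_continuousOn (by fun_prop)
  have hGi : IntervalIntegrable (fun θ => G (S' θ, (T, ε), θ)) MeasureTheory.volume 0 1 :=
    ContinuousOn.intervalIntegrable (by rwa [uIcc_of_le zero_le_one])
  -- Energy balance: `H` returns to its value after a period, and the factor `P ε` can be cancelled
  -- because `ε ≠ 0`.
  have hint : ∫ θ in (0 : ℝ)..1, G (S' θ, (T, ε), θ) = 0 := by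
    have h1 : ∫ θ in (0 : ℝ)..1, P * ε * G (S' θ, (T, ε), θ) = Hh (S' 1) - Hh (S' 0) := by
      refine intervalIntegral.integral_eq_sub_of_hasDerivAt (f := fun θ => Hh (S' θ))
        (fun θ hθ => ?_) (hGi.const_mul _)
      rw [uIcc_of_le zero_le_one] at hθ
      have h2 := ((h.contDiff_H.differentiable one_ne_zero (S' θ)).hasFDerivAt).comp_hasDerivAt θ
        (hSd θ hθ)
      refine h2.congr_deriv ?_
      simp only [hV, hGdef, map_smul, map_add, h.integral _ (hSO θ hθ), smul_eq_mul]
      ring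
    rw [hS1, sub_self, intervalIntegral.integral_const_mul] at h1
    exact (mul_eq_zero.1 h1).resolve_left (mul_ne_zero hP0 hε0)
  have hle := intervalIntegral.norm_integral_le_of_norm_le_const (a := (0 : ℝ)) (b := 1)
    (f := fun θ => G (S' θ, (T, ε), θ) - G (y θ, p, θ)) (C := |c₀| / 2)
    fun θ hθ => (hcl θ (Ioc_subset_Icc_self (by rwa [uIoc_of_le zero_le_one] at hθ))).le
  rw [intervalIntegral.integral_sub hGi (hGy.intervalIntegrable _ _), hint, zero_sub, norm_neg,
    ← hc₀, Real.norm_eq_abs] at hle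
  have := abs_pos.2 hc₀'
  simp at hle
  linarith

/-- Only the continuity of the branch at `ε = 0` enters, so this excludes persistence in every
class. -/
theorem IsBranch.frequently_hasPeriodicSolution {k : ℕ} {s ε₀ : ℝ} {ξ : ℝ → E} {T : ℝ → ℝ}
    (hb : IsBranch U f g ε₁ z τ m l k s ε₀ ξ T) :
    ∃ᶠ q : E × ℝ × ℝ in 𝓝 (z s, (m * τ / l, 0)), q.2.2 ≠ 0 ∧
      HasPeriodicSolution U f g q.2.1 q.2.2 (l * q.2.1) q.1 := by
  have h0 : (0 : ℝ) ∈ Ico 0 ε₀ := ⟨le_rfl, hb.pos⟩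
  have hc : ContinuousWithinAt (fun ε => (ξ ε, (T ε, ε))) (Ico 0 ε₀) 0 :=
    (hb.smooth_init.continuousOn 0 h0).prodMk
      ((hb.smooth_period.continuousOn 0 h0).prodMk continuousWithinAt_id)
  have hIoo : Ioo 0 ε₀ ∈ 𝓝[>] (0 : ℝ) := Ioo_mem_nhdsGT hb.pos
  have ht : Tendsto (fun ε => (ξ ε, (T ε, ε))) (𝓝[>] 0) (𝓝 (z s, (m * τ / l, 0))) := by
    have h1 := hc.tendsto
    rw [hb.init_zero, hb.period_zero] at h1
    exact h1.mono_left (nhdsWithin_le_of_mem (mem_of_superset hIoo Ioo_subset_Ico_self))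
  refine ht.frequently (Eventually.frequently (mem_of_superset hIoo fun ε hε => ?_))
  exact ⟨hε.1.ne', hb.orbit ε (Ioo_subset_Ico_self hε)⟩

end Resonance

/-! ### Proof of the theorem -/

theorem theorem1 {E : Type*} [NormedAddCommGroup E] [NormedSpace ℝ E] [FiniteDimensional ℝ E]
    (U : Set E) (hU : IsOpen U) (r : ℕ) (hr : 2 ≤ r)
    -- the conservative limit and its first integral
    (f : E → E) (hf : ContDiffOn ℝ (r : WithTop ℕ∞) f U)
    (H : E → ℝ) (hH : ContDiffOn ℝ 1 H U) (hHf : ∀ x ∈ U, fderiv ℝ H x (f x) = 0)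
    -- the perturbation
    (ε₁ : ℝ) (hε₁ : 0 < ε₁) (g : E → ℝ → ℝ → ℝ → E) (hg : IsPerturbation U ε₁ r g)
    -- the normal periodic orbit
    (z : ℝ → E) (τ : ℝ) (hz : IsPeriodicOrbit U f z τ)
    (m l : ℕ) (hm : 0 < m) (hl : 0 < l) (hml : Nat.Coprime l m) (hnormal : IsNormal f z τ m) :
    (∀ s₀ : ℝ, melnikov H g z τ m l s₀ = 0 → deriv (melnikov H g z τ m l) s₀ ≠ 0 →
      PersistsAt U f g ε₁ z τ m l (r - 1) s₀ ∧
      (∀ L : E × ℝ → ℝ, Parametrises U f z τ m r L →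
        PersistsAlong U f g ε₁ z τ m l (r - 1) L s₀) ∧
      ∃ s ∈ Ioo s₀ (s₀ + m * τ), IsTransverseZero (melnikov H g z τ m l) s) ∧
    ((∃ c > 0, ∀ s, c ≤ |melnikov H g z τ m l s|) →
      (¬ ∃ s, PersistsAt U f g ε₁ z τ m l 1 s) ∧
      ∀ C : ℝ, ∃ ε₀ > 0, ∀ ε ∈ Ioo 0 ε₀, ∀ (s : ℝ) (ξ : E) (T : ℝ), 0 < T →
        ‖ξ - z s‖ ≤ C * ε → |T - m * τ / l| ≤ C * ε →
          ¬ HasPeriodicSolution U f g T ε (l * T) ξ) := by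
  have := FiniteDimensional.complete ℝ E
  obtain ⟨n, rfl⟩ : ∃ n, r = n + 1 := ⟨r - 1, by omega⟩
  have hn : 1 ≤ n := by omega
  rw [Nat.add_sub_cancel]
  have hτ := hz.pos
  have hT₀ : (0 : ℝ) < m * τ / l := by positivity
  obtain ⟨O, fh, Hh, gh, h, hG, hfh, hgh⟩ :=
    exists_globalisation hU hr hf hH hHf hε₁ hg hz hT₀
  rw [Nat.add_sub_cancel] at hgh
  have hf1 : ContDiffOn ℝ 1 f U := hf.of_le (by exact_mod_cast (by omega : 1 ≤ n + 1))
  have hgh1 : ContDiff ℝ 1 gh := hgh.of_le (by exact_mod_cast hn)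
  have hMper : Function.Periodic (melnikov H g z τ m l) τ := periodic_melnikov hz.periodic m l
  rw [hG.melnikov_eq h.mem] at hMper ⊢
  have hMc : Continuous (melnikov Hh (curried gh) z τ m l) :=
    continuous_melnikov h hgh.continuous m l
  refine ⟨fun s₀ hM hM' => ?_, ?_⟩
  · obtain ⟨Y, hY, hYn⟩ := hnormal
    have hY' := hG.isVariationalSolution h.mem hY
    rw [← hG.f_eq _ (h.mem 0)] at hYn
    have hfz := h.velocity_ne_zero hY' hz.minimal
    -- That `DH` does not vanish on the orbit is not assumed: it follows once `M` is not identically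
    -- zero, which `M'(s₀) ≠ 0` guarantees.
    obtain ⟨s, hs⟩ : ∃ s, melnikov Hh (curried gh) z τ m l s ≠ 0 := by
      by_contra! h0
      exact hM' (by rw [funext h0]; exact deriv_const _ _)
    have hHz := h.fderiv_ne_zero_of_melnikov hY' hs
    refine ⟨hG.persistsAt h hg hl hε₁ hn hfh hgh hY' hfz hYn hM hM' hHz, fun L hL =>
      hG.persistsAlong h hg hl hε₁ hU hf1 hn hfh hgh hY' hfz hYn hM hM' hHz hL, ?_⟩
    -- `M` has period `τ`, so the further zero already occurs before `s₀ + τ ≤ s₀ + mτ`.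
    obtain ⟨t, ht, htr⟩ := exists_further_isTransverseZero hMc hτ hMper hM hM'
    refine ⟨t, ⟨ht.1, ht.2.trans_le ?_⟩, htr⟩
    have : (1 : ℝ) ≤ m := by exact_mod_cast hm
    nlinarith
  · rintro ⟨c, hc, hMc⟩
    have hnot := fun s => hG.eventually_not_hasPeriodicSolution h hU hf1 hr hg hl hgh1
      (abs_pos.1 (hc.trans_le (hMc s)))
    refine ⟨?_, fun C => ?_⟩
    · rintro ⟨s, ε₀, ξ, T, hb⟩
      exact hb.frequently_hasPeriodicSolution ((hnot s).mono fun q hq hq' => hq hq'.1 hq'.2)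
    · obtain ⟨ε₀, hε₀, hall⟩ := exists_forall_not_of_eventually h.isCompact_range hnot C
      exact ⟨ε₀, hε₀, fun ε hε s ξ T _ hξ hT => hall ε hε s ξ T hξ hT hε.1.ne'⟩
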